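/- Let $1<\alpha\le 2$ and $H=\frac{1+\alpha}{2}$, so that $H\in(1,\tfrac32]$. Consider particles in $\mathbb R$ whose initial positions $(x_k)$ form a Poisson random measure $\sum_k\delta_{x_k}$ with intensity the Lebesgue measure $\lambda$, and which move without branching, independently of each other and of the initial configuration, according to standard symmetric $\alpha$-stable Lévy processes $\vartheta^k$ (càdlàg, $\vartheta^k_0=0$, $E e^{iu(\vartheta^k_t-\vartheta^k_s)}=e^{-(t-s)|u|^\alpha}$ for $s\le t$). Let $N_s=\sum_k\delta_{x_k+\vartheta^k_s}$ and, for $T>0$, $$\langle Y_T(1),\varphi\rangle=\frac1{\sqrt T}\left(\int_0^T\langle N_s,\varphi\rangle\,ds-\int_0^T E\langle N_s,\varphi\rangle\,ds\right),\qquad \langle N_s,\varphi\rangle=\int\varphi\,dN_s .$$ For $t\ge 0$ let $\psi_t=1_{[0,t]}-1_{[-t,0]}$. Then there are a constant $K>0$, depending only on $\alpha$, and a negative sub-fractional Brownian motion $\zeta^H=(\zeta^H_t)_{t\ge0}$ with Hurst index $H$, i.e. a continuous centered Gaussian process with covariance $$E\zeta^H_s\zeta^H_t=(1-H)\left(s^{2H}+t^{2H}-\tfrac12\left((s+t)^{2H}+|t-s|^{2H}\right)\right),\qquad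 s,t\ge 0,$$ such that, as $T\to\infty$, the processes $(\langle Y_T(1),\psi_t\rangle)_{t\ge0}$ converge to $(K\zeta^H_t)_{t\ge0}$ in the sense of weak convergence of all finite-dimensional distributions. -/

import Mathlib

open MeasureTheory ProbabilityTheory Filter Topology
open scoped NNReal ENNReal

noncomputable section

namespace OccupationFluctuation

/-- `M : Ω → Measure E` is a Poisson random measure with intensity measure `m` under `P`: the
number of points in a measurable set of finite intensity `m A` is Poisson distributed with
parameter `m A`, and the numbers of points in pairwise disjoint sets are independent. -/
structure IsPoissonRandomMeasure {Ω E : Type*} [MeasurableSpace Ω] [MeasurableSpace E]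
    (M : Ω → Measure E) (m : Measure E) (P : Measure Ω) : Prop where
  measurable : Measurable M
  law_count : ∀ A : Set E, MeasurableSet A → m A ≠ ∞ →
    HasLaw (fun ω => M ω A)
      ((poissonMeasure (m A).toNNReal).map (fun n : ℕ => (n : ℝ≥0∞))) P
  indep_counts : ∀ (n : ℕ) (A : Fin n → Set E), (∀ i, MeasurableSet (A i)) →
    Pairwise (fun i j => Disjoint (A i) (A j)) → iIndepFun (fun i ω => M ω (A i)) P

/-- A path is càdlàg: right-continuous with (finite) left limits. -/
def IsCadlagPath (f : ℝ≥0 → ℝ) : Prop :=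
  ∀ t, ContinuousWithinAt f (Set.Ici t) t ∧ ∃ l, Tendsto f (𝓝[<] t) (𝓝 l)

/-- `X` is a standard symmetric `α`-stable Lévy process in `ℝ`: it starts at `0`, has independent
increments, the increment over `[s, t]` has characteristic function
`u ↦ exp (-(t - s) |u| ^ α)`, and the paths are almost surely càdlàg. -/
structure IsStandardStableLevy {Ω : Type*} [MeasurableSpace Ω]
    (α : ℝ) (X : ℝ≥0 → Ω → ℝ) (P : Measure Ω) : Prop where
  measurable : ∀ t, Measurable (X t)
  start : ∀ᵐ ω ∂P, X 0 ω = 0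
  indep_increments : HasIndepIncrements X P
  law_increment : ∀ s t : ℝ≥0, s ≤ t → ∀ u : ℝ,
    charFun (P.map (fun ω => X t ω - X s ω)) u =
      ((Real.exp (-((t : ℝ) - (s : ℝ)) * |u| ^ α) : ℝ) : ℂ)
  cadlag : ∀ᵐ ω ∂P, IsCadlagPath (fun t => X t ω)

/-- The empirical measure `N_s = ∑ k, δ_{x_k + ϑ^k_s}` at time `s` of the particles which start at
the points `x_k` and have displacements `ϑ^k_s`; `N_s A` is the number of particles in `A`. -/
def empirical {Ω : Type*} (x : ℕ → Ω → ℝ) (ϑ : ℕ → ℝ≥0 → Ω → ℝ) (s : ℝ≥0) (ω : Ω) : Measure ℝ :=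
  Measure.sum (fun k => Measure.dirac (x k ω + ϑ k s ω))

/-- The non-branching particle system: the initial configuration `∑ k, δ_{x_k}` is a Poisson random
measure with intensity the Lebesgue measure, and the particles move independently of each other and
of the initial configuration according to standard symmetric `α`-stable Lévy processes. -/
structure IsPoissonStableSystem {Ω : Type*} [MeasurableSpace Ω]
    (α : ℝ) (x : ℕ → Ω → ℝ) (ϑ : ℕ → ℝ≥0 → Ω → ℝ) (P : Measure Ω) : Prop where
  measurable_start : ∀ k, Measurable (x k)
  poisson_start : IsPoissonRandomMeasure
    (fun ω => Measure.sum (fun k => Measure.dirac (x k ω))) (volume : Measure ℝ) P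
  stable_motion : ∀ k, IsStandardStableLevy α (ϑ k) P
  indep_motions : iIndepFun (fun k ω => fun t : ℝ≥0 => ϑ k t ω) P
  indep_start : IndepFun (fun ω => fun k => x k ω) (fun ω => fun k => fun t : ℝ≥0 => ϑ k t ω) P

/-- The occupation time fluctuation `Y_T(t)` of a measure-valued process `N`, with norming `F`,
applied to the test function `φ`:
`⟨Y_T(t), φ⟩ = (1 / F_T) (∫_0^{Tt} ⟨N_s, φ⟩ ds - ∫_0^{Tt} E ⟨N_s, φ⟩ ds)`. -/
def occFluct {Ω : Type*} [MeasurableSpace Ω] (P : Measure Ω) (N : ℝ≥0 → Ω → Measure ℝ)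
    (F : ℝ → ℝ) (T t : ℝ) (φ : ℝ → ℝ) (ω : Ω) : ℝ :=
  (1 / F T) * ((∫ s in (0 : ℝ)..(T * t), ∫ y, φ y ∂(N s.toNNReal ω))
    - ∫ s in (0 : ℝ)..(T * t), ∫ ω', (∫ y, φ y ∂(N s.toNNReal ω')) ∂P)

/-- `ψ_t = 1_{[0,t]} - 1_{[-t,0]}`. -/
def oddStep (t : ℝ≥0) (y : ℝ) : ℝ :=
  (Set.Icc (0 : ℝ) (t : ℝ)).indicator 1 y - (Set.Icc (-(t : ℝ)) 0).indicator 1 y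

/-- `ζ` is a negative sub-fractional Brownian motion with Hurst index `H ∈ (1, 2)`: a continuous
centered Gaussian process with covariance
`(1 - H) (s^{2H} + t^{2H} - ((s + t)^{2H} + |t - s|^{2H}) / 2)`. -/
structure IsNegSubFBM {Ω : Type*} [MeasurableSpace Ω]
    (H : ℝ) (ζ : ℝ≥0 → Ω → ℝ) (P : Measure Ω) : Prop where
  one_lt : 1 < H
  lt_two : H < 2
  gaussian : IsGaussianProcess ζ P
  centered : ∀ t, ∫ ω, ζ t ω ∂P = 0
  covariance : ∀ s t : ℝ≥0, ∫ ω, ζ s ω * ζ t ω ∂P =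
    (1 - H) * ((s : ℝ) ^ (2 * H) + (t : ℝ) ^ (2 * H)
      - (((s : ℝ) + (t : ℝ)) ^ (2 * H) + |(t : ℝ) - (s : ℝ)| ^ (2 * H)) / 2)
  continuous_paths : ∀ ω, Continuous (fun t => ζ t ω)

/-- Convergence of the processes `X T` to `Z`, as `T → ∞`, in the sense of weak convergence of all
finite-dimensional distributions. -/
def TendstoFDD {Ω Ω' : Type*} [MeasurableSpace Ω] [MeasurableSpace Ω']
    (X : ℝ → ℝ≥0 → Ω → ℝ) (Z : ℝ≥0 → Ω' → ℝ) (P : Measure Ω) [IsProbabilityMeasure P]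
    (P' : Measure Ω') [IsProbabilityMeasure P'] : Prop :=
  ∀ (n : ℕ) (t : Fin n → ℝ≥0),
    TendstoInDistribution (fun (T : ℝ) ω => fun i : Fin n => X T (t i) ω) atTop
      (fun ω => fun i : Fin n => Z (t i) ω) (fun _ => P) P'

end OccupationFluctuation

end

/-!
The particles, marked with their paths, form a Poisson random measure on (paths) × ℝ with intensity
`Q ⊗ λ`, where `Q` is the law of the stable process. For `φ = ∑ aᵢ ψ_{tᵢ}` the fluctuation
`⟨Y_T, φ⟩` is almost surely the sum over the particles of `T^{-1/2} A_T`, where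
`A_T (w, x) = ∫₀ᵀ φ (x + w s) ds` (`IsPoissonStableSystem.ae_hasSum_occFluct`; the mean vanishes
because `φ` is odd), so its characteristic function is `exp (∫ (exp (i T^{-1/2} A_T) - 1) d(Q ⊗ λ))`
(`IsPoissonStableSystem.integral_exp_occFluct`). It remains to expand this exponent.

* First order: `∫ A_T = 0`, since `∫ φ = 0`.
* Second order: by Fourier inversion of the transition density, the correlation of the field at
  times `s, t` is `(2π)⁻¹ ∫ φ̂ₛ(u)² exp (-|t - s| |u|^α) du`, `φ̂ₛ` the sine transform of `φ`
  (`integral_particleField_mul`), and therefore `T⁻¹ ∫ A_T²` tends to `π⁻¹ ∫ φ̂ₛ(u)² |u|^{-α} du`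
  (`tendsto_integral_occupation_sq`). The last integral is finite because `φ̂ₛ(u) = O(u)` at `0`:
  this is where oddness produces the norming `√T`.
* Remainder: `∫ A_T⁴ = O(T^{7/4}) = o(T²)` (`exists_integral_occupation_pow_four_le`). With times
  `s₁ < s₂ < s₃ < s₄`, oddness and the Lipschitz bound for the density improve the decay of the
  correlation in the first and in the last gap from `r^{-1/α}` to `r^{-2/α}`.

For `ψ_t` the sine transform is `2 (1 - cos (u t)) / u`, so that the limiting covariance is
`(4/π) ∫ (1 - cos us) (1 - cos ut) |u|^{-2-α} du`, a positive multiple of the covariance of negative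
sub-fractional Brownian motion (`integral_specFun_mul`). The same integral is a Gram matrix in `L²`,
from which the continuous Gaussian process itself is built (`exists_negSubFBM`). Lévy's continuity
theorem concludes.

Two points need care. The Poisson property is stated through counts of points in sets, hence the
exponential formula is first obtained for simple functions and then extended
(`tendsto_integral_prod_poisson`).
The path space carries the product `σ`-algebra, on which evaluation is not jointly measurable in
time and path; `evalRight` is a jointly measurable substitute which agrees with evaluation on càdlàg
paths.
-/

noncomputable section

namespace OccupationFluctuation

/-! ### The transition density of the symmetric stable process -/

lemma integrable_comp_abs {f : ℝ → ℝ} (hf : IntegrableOn f (Set.Ioi 0)) :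
    Integrable (fun x => f |x|) := by
  have hf' : IntegrableOn (fun x => f |x|) (Set.Ioi 0) :=
    hf.congr_fun (fun u (hu : 0 < u) => by simp [abs_of_pos hu]) measurableSet_Ioi
  have int_Iic : IntegrableOn (fun x ↦ f |x|) (Set.Iic 0) := by
    rw [← Measure.map_neg_eq_self (volume : Measure ℝ)]
    have m : MeasurableEmbedding fun x : ℝ => -x := (Homeomorph.neg ℝ).measurableEmbedding
    rw [m.integrableOn_map_iff]
    simp_rw [Function.comp_def, abs_neg, Set.neg_preimage, Set.neg_Iic, neg_zero]
    exact Iff.mpr integrableOn_Ici_iff_integrableOn_Ioi hf'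
  rw [← integrableOn_univ, ← Set.Iic_union_Ioi (a := (0 : ℝ))]
  exact int_Iic.union hf'

lemma integrable_rpow_abs_mul_exp {α : ℝ} (hα : 0 < α) {q : ℝ} (hq : -1 < q) {r : ℝ}
    (hr : 0 < r) : Integrable (fun u : ℝ => |u| ^ q * Real.exp (-r * |u| ^ α)) := by
  have h := integrableOn_rpow_mul_exp_neg_mul_rpow hq hα hr
  exact integrable_comp_abs (f := fun u => u ^ q * Real.exp (-r * u ^ α)) h

lemma integral_rpow_abs_mul_exp {α : ℝ} (hα : 0 < α) {q : ℝ} (hq : -1 < q) {r : ℝ}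
    (hr : 0 < r) : ∫ u : ℝ, |u| ^ q * Real.exp (-r * |u| ^ α) =
      r ^ (-(q + 1) / α) * (2 * ((1 / α) * Real.Gamma ((q + 1) / α))) := by
  rw [integral_comp_abs (f := fun u => u ^ q * Real.exp (-r * u ^ α)),
    integral_rpow_mul_exp_neg_mul_rpow hα hq hr]
  ring

lemma integrable_exp_abs_rpow {α : ℝ} (hα : 0 < α) {r : ℝ} (hr : 0 < r) :
    Integrable (fun u : ℝ => Real.exp (-r * |u| ^ α)) := by
  simpa using integrable_rpow_abs_mul_exp hα (q := 0) (by norm_num) hr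

/-- The density `p_r(y) = (2π)⁻¹ ∫ cos (u y) exp (-r |u| ^ α) du` of the law of a standard symmetric
`α`-stable Lévy process at time `r > 0`. -/
def stableDensity (α r y : ℝ) : ℝ :=
  (2 * Real.pi)⁻¹ * ∫ u : ℝ, Real.cos (u * y) * Real.exp (-r * |u| ^ α)

lemma integrable_cos_mul_exp {α : ℝ} (hα : 0 < α) {r : ℝ} (hr : 0 < r) (y : ℝ) :
    Integrable (fun u : ℝ => Real.cos (u * y) * Real.exp (-r * |u| ^ α)) := by
  refine (integrable_exp_abs_rpow hα hr).bdd_mul (c := 1) (by fun_prop) ?_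
  exact ae_of_all _ fun u => by simpa using Real.abs_cos_le_one _

lemma continuous_stableDensity {α : ℝ} (hα : 0 < α) {r : ℝ} (hr : 0 < r) :
    Continuous (stableDensity α r) := by
  unfold stableDensity
  refine continuous_const.mul ?_
  refine continuous_of_dominated (bound := fun u => Real.exp (-r * |u| ^ α)) ?_ ?_
    (integrable_exp_abs_rpow hα hr) ?_
  · exact fun y => (integrable_cos_mul_exp hα hr y).aestronglyMeasurable
  · refine fun y => ae_of_all _ fun u => ?_
    rw [norm_mul, Real.norm_eq_abs, Real.norm_eq_abs, abs_of_pos (Real.exp_pos _)]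
    exact mul_le_of_le_one_left (Real.exp_pos _).le (Real.abs_cos_le_one _)
  · exact ae_of_all _ fun u => by fun_prop

lemma abs_stableDensity_le {α : ℝ} (hα : 0 < α) :
    ∃ C, 0 ≤ C ∧ ∀ r, 0 < r → ∀ y, |stableDensity α r y| ≤ C * r ^ (-1 / α) := by
  refine ⟨(2 * Real.pi)⁻¹ * (2 * ((1 / α) * Real.Gamma (1 / α))), ?_, fun r hr y => ?_⟩
  · have := Real.Gamma_pos_of_pos (one_div_pos.2 hα)
    have := Real.pi_pos
    positivity
  · have h := integral_rpow_abs_mul_exp hα (q := 0) (by norm_num) hr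
    simp only [Real.rpow_zero, one_mul, zero_add] at h
    rw [stableDensity, abs_mul, abs_of_pos (by have := Real.pi_pos; positivity), mul_assoc]
    refine mul_le_mul_of_nonneg_left ?_ (by have := Real.pi_pos; positivity)
    rw [mul_comm _ (r ^ _), ← h]
    refine (norm_integral_le_integral_norm (G := ℝ) _).trans ?_
    refine integral_mono (integrable_cos_mul_exp hα hr y).norm (integrable_exp_abs_rpow hα hr) ?_
    intro u
    simp only [norm_mul, Real.norm_eq_abs, abs_of_pos (Real.exp_pos _)]
    exact mul_le_of_le_one_left (Real.exp_pos _).le (Real.abs_cos_le_one _)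

lemma abs_stableDensity_sub_le {α : ℝ} (hα : 0 < α) :
    ∃ C, 0 ≤ C ∧ ∀ r, 0 < r → ∀ y z,
      |stableDensity α r y - stableDensity α r z| ≤ C * r ^ (-2 / α) * |y - z| := by
  refine ⟨(2 * Real.pi)⁻¹ * (2 * ((1 / α) * Real.Gamma (2 / α))), ?_, fun r hr y z => ?_⟩
  · have := Real.Gamma_pos_of_pos (div_pos two_pos hα)
    have := Real.pi_pos
    positivity
  · have h := integral_rpow_abs_mul_exp hα (q := 1) (by norm_num) hr
    norm_num at h
    rw [stableDensity, stableDensity, ← mul_sub,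
      ← integral_sub (integrable_cos_mul_exp hα hr y) (integrable_cos_mul_exp hα hr z),
      abs_mul, abs_of_pos (by have := Real.pi_pos; positivity), mul_assoc, mul_assoc]
    refine mul_le_mul_of_nonneg_left ?_ (by have := Real.pi_pos; positivity)
    have h2 : (2 * ((1 / α) * Real.Gamma (2 / α))) * (r ^ (-2 / α) * |y - z|) =
        ∫ u : ℝ, (|u| * Real.exp (-(r * |u| ^ α))) * |y - z| := by
      rw [integral_mul_const, h]
      ring
    rw [h2]
    refine (norm_integral_le_integral_norm (G := ℝ) _).trans ?_
    refine integral_mono ((integrable_cos_mul_exp hα hr y).sub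
      (integrable_cos_mul_exp hα hr z)).norm ?_ ?_
    · refine Integrable.mul_const ?_ _
      simpa using integrable_rpow_abs_mul_exp hα (q := 1) (by norm_num) hr
    · intro u
      simp only [← sub_mul, norm_mul, Real.norm_eq_abs, abs_of_pos (Real.exp_pos _), neg_mul]
      have h3 : |Real.cos (u * y) - Real.cos (u * z)| ≤ |u| * |y - z| := by
        refine (Real.abs_cos_sub_cos_le _ _).trans ?_
        rw [← mul_sub, abs_mul]
      calc _ ≤ |u| * |y - z| * Real.exp (-(r * |u| ^ α)) := by gcongr
        _ = _ := by ring

open scoped FourierTransform in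
/-- The Fourier transform of the (rescaled) characteristic function is the density. -/
lemma fourier_exp_neg_abs_rpow {α : ℝ} (hα : 0 < α) {r : ℝ} (hr : 0 < r) (y : ℝ) :
    𝓕 (fun v : ℝ => ((Real.exp (-r * |2 * Real.pi * v| ^ α) : ℝ) : ℂ)) y =
      (stableDensity α r y : ℂ) := by
  have hint : Integrable (fun u : ℝ => Complex.exp ((-(u * y) : ℝ) * Complex.I) *
      ((Real.exp (-r * |u| ^ α) : ℝ) : ℂ)) := by
    refine Integrable.bdd_mul (c := 1) (integrable_exp_abs_rpow hα hr).ofReal (by fun_prop) ?_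
    exact ae_of_all _ fun u => (Complex.norm_exp_ofReal_mul_I _).le
  have h1 : ∫ u : ℝ, Complex.exp ((-(u * y) : ℝ) * Complex.I) *
      ((Real.exp (-r * |u| ^ α) : ℝ) : ℂ) =
      ((∫ u : ℝ, Real.cos (u * y) * Real.exp (-r * |u| ^ α) : ℝ) : ℂ) := by
    apply Complex.ext
    · have : (fun u : ℝ => (Complex.exp ((-(u * y) : ℝ) * Complex.I) *
          ((Real.exp (-r * |u| ^ α) : ℝ) : ℂ)).re) =
          fun u => Real.cos (u * y) * Real.exp (-r * |u| ^ α) := by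
        funext u
        rw [Complex.re_mul_ofReal, Complex.exp_ofReal_mul_I_re, Real.cos_neg]
      rw [Complex.ofReal_re, ← this]
      exact (integral_re hint).symm
    · have : (fun u : ℝ => (Complex.exp ((-(u * y) : ℝ) * Complex.I) *
          ((Real.exp (-r * |u| ^ α) : ℝ) : ℂ)).im) =
          fun u => -Real.sin (u * y) * Real.exp (-r * |u| ^ α) := by
        funext u
        rw [Complex.im_mul_ofReal, Complex.exp_ofReal_mul_I_im, Real.sin_neg]
      rw [Complex.ofReal_im]
      refine (integral_im hint).symm.trans ?_
      change ∫ u : ℝ, (Complex.exp ((-(u * y) : ℝ) * Complex.I) *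
          ((Real.exp (-r * |u| ^ α) : ℝ) : ℂ)).im = 0
      rw [this]
      -- the integrand is odd
      have h2 := integral_neg_eq_self (fun u : ℝ => -Real.sin (u * y) * Real.exp (-r * |u| ^ α))
        volume
      simp only [neg_mul, Real.sin_neg, abs_neg, neg_neg] at h2 ⊢
      rw [integral_neg] at h2 ⊢
      linarith
  rw [Real.fourier_real_eq_integral_exp_smul, stableDensity]
  have h3 := Measure.integral_comp_mul_left (fun u : ℝ => Complex.exp ((-(u * y) : ℝ) * Complex.I) *
      ((Real.exp (-r * |u| ^ α) : ℝ) : ℂ)) (2 * Real.pi)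
  rw [h1, abs_of_pos (by have := Real.pi_pos; positivity)] at h3
  rw [Complex.ofReal_mul, ← smul_eq_mul (α := ℂ), Complex.coe_smul, ← h3]
  refine integral_congr_ae (ae_of_all _ fun v => ?_)
  simp only [smul_eq_mul]
  congr 3
  push_cast
  ring

open scoped FourierTransform in
/-- Fourier inversion of the test function, followed by Fubini, identifies the density of a law with
the stable characteristic function. -/
lemma integral_smooth_of_charFun {α : ℝ} (hα : 0 < α) {r : ℝ} (hr : 0 < r) {μ : Measure ℝ}
    [IsProbabilityMeasure μ]
    (hμ : ∀ u, charFun μ u = ((Real.exp (-r * |u| ^ α) : ℝ) : ℂ)) {f : ℝ → ℝ}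
    (hf : ContDiff ℝ (⊤ : ℕ∞) f) (hfc : HasCompactSupport f) :
    ∫ y, f y ∂μ = ∫ y, f y * stableDensity α r y := by
  have hF1 : ContDiff ℝ (⊤ : ℕ∞) (fun y => (f y : ℂ)) := Complex.ofRealCLM.contDiff.comp hf
  have hF2 : HasCompactSupport (fun y => (f y : ℂ)) := hfc.comp_left (g := Complex.ofReal) rfl
  set F : SchwartzMap ℝ ℂ := hF2.toSchwartzMap hF1 with hFdef
  have hFf : ∀ y, F y = (f y : ℂ) := fun y => rfl
  have hFint : Integrable (fun y => F y) := F.integrable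
  have hFF : Integrable (𝓕 (fun y => F y)) := by
    have := (𝓕 F).integrable (μ := volume)
    rwa [SchwartzMap.fourier_coe] at this
  have hinv : 𝓕⁻ (𝓕 (fun y => F y)) = fun y => F y :=
    Continuous.fourierInv_fourier_eq F.continuous hFint hFF
  have hg : Integrable (fun v : ℝ => ((Real.exp (-r * |2 * Real.pi * v| ^ α) : ℝ) : ℂ)) := by
    have := (integrable_exp_abs_rpow hα hr).comp_mul_left' (R := 2 * Real.pi)
      (by have := Real.pi_pos; positivity)
    exact this.ofReal
  have key : ∫ y, F y ∂μ = ∫ y, F y * (stableDensity α r y : ℂ) := by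
    calc ∫ y, F y ∂μ = ∫ y, (𝓕⁻ (𝓕 (fun y => F y))) y ∂μ := by rw [hinv]
      _ = ∫ y, (∫ v, Complex.exp (↑(2 * Real.pi * inner ℝ v y) * Complex.I) •
            𝓕 (fun y => F y) v) ∂μ := by simp_rw [Real.fourierInv_eq']
      _ = ∫ v, (∫ y, Complex.exp (↑(2 * Real.pi * inner ℝ v y) * Complex.I) •
            𝓕 (fun y => F y) v ∂μ) := by
          refine integral_integral_swap ?_
          have : Integrable (fun p : ℝ × ℝ => 𝓕 (fun y => F y) p.2) (μ.prod volume) :=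
            hFF.comp_snd μ
          refine this.bdd_mul (c := 1) ?_ ?_
          · refine Continuous.aestronglyMeasurable ?_
            simp only [RCLike.inner_apply, conj_trivial]
            fun_prop
          · exact ae_of_all _ fun u => (Complex.norm_exp_ofReal_mul_I _).le
      _ = ∫ v, 𝓕 (fun y => F y) v •
            ((Real.exp (-r * |2 * Real.pi * v| ^ α) : ℝ) : ℂ) := by
          refine integral_congr_ae (ae_of_all _ fun v => ?_)
          simp only [smul_eq_mul]
          rw [integral_mul_const, ← hμ, charFun_apply_real, mul_comm]
          congr 1
          refine integral_congr_ae (ae_of_all _ fun y => ?_)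
          simp only [RCLike.inner_apply, conj_trivial]
          congr 1
          push_cast
          ring
      _ = ∫ y, F y • 𝓕 (fun v : ℝ => ((Real.exp (-r * |2 * Real.pi * v| ^ α) : ℝ) : ℂ)) y := by
          have h := VectorFourier.integral_fourierIntegral_smul_eq_flip
            Real.continuous_fourierChar (L := innerₗ ℝ)
            (by simp only [innerₗ_apply_apply, RCLike.inner_apply, conj_trivial]; fun_prop) hFint hg
          simp only [VectorFourier.fourierIntegral, innerₗ_apply_apply, LinearMap.flip_apply,
            RCLike.inner_apply, conj_trivial] at h
          simp only [Real.fourier_real_eq]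
          simp only [mul_comm] at h ⊢
          exact h
      _ = _ := by simp_rw [fourier_exp_neg_abs_rpow hα hr, smul_eq_mul]
  simp_rw [hFf, ← Complex.ofReal_mul, integral_complex_ofReal] at key
  exact_mod_cast key

lemma measureReal_Ioo_of_charFun {α : ℝ} (hα : 0 < α) {r : ℝ} (hr : 0 < r) {μ : Measure ℝ}
    [IsProbabilityMeasure μ]
    (hμ : ∀ u, charFun μ u = ((Real.exp (-r * |u| ^ α) : ℝ) : ℂ)) {a b : ℝ} (hab : a < b) :
    μ.real (Set.Ioo a b) = ∫ y in Set.Ioo a b, stableDensity α r y := by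
  -- bump functions increasing to the indicator of the interval
  set c := (a + b) / 2 with hc
  set R := (b - a) / 2 with hR
  have hRpos : 0 < R := by rw [hR]; linarith
  have hball : Metric.ball c R = Set.Ioo a b := by
    rw [Real.ball_eq_Ioo]; congr 1 <;> rw [hc, hR] <;> ring
  have hn : ∀ n : ℕ, 0 < (1 : ℝ) / (n + 2) := fun n => by positivity
  have hn1 : ∀ n : ℕ, (1 : ℝ) / (n + 2) < 1 := fun n => by
    rw [div_lt_one (by positivity)]; have : (0 : ℝ) ≤ n := n.cast_nonneg; linarith
  let f : ℕ → ContDiffBump c := fun n =>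
    { rIn := R * (1 - 1 / (n + 2)), rOut := R,
      rIn_pos := mul_pos hRpos (by have := hn1 n; linarith)
      rIn_lt_rOut := by have := hn n; nlinarith }
  have hlim : ∀ y, Tendsto (fun n => f n y) atTop
      (𝓝 ((Set.Ioo a b).indicator (fun _ => (1 : ℝ)) y)) := by
    intro y
    rw [← hball]
    by_cases hy : y ∈ Metric.ball c R
    · rw [Set.indicator_of_mem hy]
      refine tendsto_const_nhds.congr' ?_
      have hl : Tendsto (fun n : ℕ => R * (1 - 1 / ((n : ℝ) + 2))) atTop (𝓝 (R * (1 - 0))) := by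
        refine Tendsto.const_mul _ (tendsto_const_nhds.sub ?_)
        have := (tendsto_const_div_atTop_nhds_zero_nat (1 : ℝ)).comp (tendsto_add_atTop_nat 2)
        refine this.congr fun n => ?_
        simp
      have hy' : dist y c < R * (1 - 0) := by simpa using hy
      filter_upwards [hl.eventually (eventually_gt_nhds hy')] with n hn
      exact ((f n).one_of_mem_closedBall (by simpa [f] using hn.le)).symm
    · rw [Set.indicator_of_notMem hy]
      refine tendsto_const_nhds.congr fun n => ?_
      refine ((f n).zero_of_le_dist ?_).symm
      simpa [f] using hy
  have hbd : ∀ n y, ‖f n y‖ ≤ 1 := fun n y => by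
    rw [Real.norm_eq_abs, abs_of_nonneg (f n).nonneg]; exact (f n).le_one
  have hbd2 : ∀ n y, ‖f n y‖ ≤ (Set.Ioo a b).indicator (fun _ => (1 : ℝ)) y := fun n y => by
    rw [← hball]
    by_cases hy : y ∈ Metric.ball c R
    · rw [Set.indicator_of_mem hy]; exact hbd n y
    · rw [Set.indicator_of_notMem hy, (f n).zero_of_le_dist (by simpa [f] using hy)]; simp
  have h1 : Tendsto (fun n => ∫ y, f n y ∂μ) atTop
      (𝓝 (∫ y, (Set.Ioo a b).indicator (fun _ => (1 : ℝ)) y ∂μ)) :=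
    tendsto_integral_of_dominated_convergence (fun _ => 1)
      (fun n => (f n).continuous.aestronglyMeasurable) (integrable_const _)
      (fun n => ae_of_all _ (hbd n)) (ae_of_all _ hlim)
  have hpc := continuous_stableDensity hα hr
  have h2 : Tendsto (fun n => ∫ y, f n y * stableDensity α r y) atTop
      (𝓝 (∫ y, (Set.Ioo a b).indicator (fun _ => (1 : ℝ)) y * stableDensity α r y)) := by
    refine tendsto_integral_of_dominated_convergence
      ((Set.Ioo a b).indicator fun y => |stableDensity α r y|)
      (fun n => ((f n).continuous.mul hpc).aestronglyMeasurable) ?_ ?_ ?_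
    · refine IntegrableOn.integrable_indicator ?_ measurableSet_Ioo
      exact (hpc.abs.integrableOn_Icc (a := a) (b := b)).mono_set Set.Ioo_subset_Icc_self
    · refine fun n => ae_of_all _ fun y => ?_
      rw [norm_mul]
      refine (mul_le_mul_of_nonneg_right (hbd2 n y) (norm_nonneg _)).trans (le_of_eq ?_)
      by_cases hy : y ∈ Set.Ioo a b <;> simp [hy]
    · exact ae_of_all _ fun y => (hlim y).mul_const _
  have h3 : ∀ n, ∫ y, f n y ∂μ = ∫ y, f n y * stableDensity α r y := fun n =>
    integral_smooth_of_charFun hα hr hμ (f n).contDiff (f n).hasCompactSupport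
  simp_rw [h3] at h1
  have h4 := tendsto_nhds_unique h1 h2
  rw [integral_indicator_const _ measurableSet_Ioo, smul_eq_mul, mul_one] at h4
  rw [h4, ← integral_indicator measurableSet_Ioo]
  congr 1
  funext y
  by_cases hy : y ∈ Set.Ioo a b <;> simp [hy]

lemma stableDensity_nonneg_of_charFun {α : ℝ} (hα : 0 < α) {r : ℝ} (hr : 0 < r) {μ : Measure ℝ}
    [IsProbabilityMeasure μ]
    (hμ : ∀ u, charFun μ u = ((Real.exp (-r * |u| ^ α) : ℝ) : ℂ)) (y : ℝ) :
    0 ≤ stableDensity α r y := by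
  by_contra! hy
  -- by continuity the density is negative on an interval, which then has negative mass
  have hpc := continuous_stableDensity hα hr
  obtain ⟨ε, hε, h⟩ := Metric.continuousAt_iff.1 (hpc.continuousAt (x := y)) (-stableDensity α r y / 2)
    (by linarith)
  have h1 := measureReal_Ioo_of_charFun hα hr hμ (a := y - ε) (b := y + ε) (by linarith)
  have h2 : ∫ z in Set.Ioo (y - ε) (y + ε), stableDensity α r z ≤
      ∫ z in Set.Ioo (y - ε) (y + ε), stableDensity α r y / 2 := by
    refine setIntegral_mono_on ?_ (integrableOn_const (by simp)) measurableSet_Ioo ?_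
    · exact (hpc.integrableOn_Icc (a := y - ε) (b := y + ε)).mono_set Set.Ioo_subset_Icc_self
    · intro z hz
      have := h (x := z) (by rw [Real.dist_eq, abs_lt]; constructor <;> linarith [hz.1, hz.2])
      rw [Real.dist_eq, abs_lt] at this
      linarith [this.2]
  rw [setIntegral_const, ← h1, Real.volume_real_Ioo_of_le (by linarith), smul_eq_mul] at h2
  have h3 : 0 ≤ μ.real (Set.Ioo (y - ε) (y + ε)) := measureReal_nonneg
  nlinarith

/-- The law at time `r > 0` of a standard symmetric `α`-stable Lévy process, given by its
density. -/
def stableLaw (α r : ℝ) : Measure ℝ :=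
  volume.withDensity fun y => ENNReal.ofReal (stableDensity α r y)

/-- A probability measure with characteristic function `exp (-r |u| ^ α)` has density
`stableDensity α r`. -/
theorem eq_stableLaw_of_charFun {α : ℝ} (hα : 0 < α) {r : ℝ} (hr : 0 < r) {μ : Measure ℝ}
    [IsProbabilityMeasure μ]
    (hμ : ∀ u, charFun μ u = ((Real.exp (-r * |u| ^ α) : ℝ) : ℂ)) : μ = stableLaw α r := by
  refine Real.measure_ext_Ioo_rat fun a b => ?_
  rcases le_or_gt (b : ℝ) a with hab | hab
  · simp [Set.Ioo_eq_empty_of_le hab]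
  have hpc := continuous_stableDensity hα hr
  rw [stableLaw, withDensity_apply _ measurableSet_Ioo, ← ofReal_integral_eq_lintegral_ofReal,
    ← measureReal_Ioo_of_charFun hα hr hμ hab, ofReal_measureReal]
  · exact (hpc.integrableOn_Icc (a := (a : ℝ)) (b := b)).mono_set Set.Ioo_subset_Icc_self
  · exact ae_of_all _ fun y => stableDensity_nonneg_of_charFun hα hr hμ y

/-! ### The covariance of negative sub-fractional Brownian motion as a spectral integral -/

/-- A function bounded by `c x ^ 2` on `(0, 1]` and by `c` on `(1, ∞)` is integrable against
`x ^ (-α)`. -/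
lemma integrableOn_mul_rpow_neg {α : ℝ} (hα : 1 < α) (hα₂ : α ≤ 2) {g : ℝ → ℝ} {c : ℝ}
    (hg : Measurable g) (h0 : ∀ x, 0 < x → x ≤ 1 → |g x| ≤ c * x ^ 2)
    (h1 : ∀ x, 1 < x → |g x| ≤ c) :
    IntegrableOn (fun x => g x * x ^ (-α)) (Set.Ioi 0) := by
  rw [← Set.Ioc_union_Ioi_eq_Ioi (zero_le_one (α := ℝ))]
  refine IntegrableOn.union ?_ ?_
  · have hi : IntegrableOn (fun _ : ℝ => c) (Set.Ioc 0 1) := integrableOn_const (by simp)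
    refine Integrable.mono' hi (by fun_prop) ?_
    refine (ae_restrict_iff' measurableSet_Ioc).2 (ae_of_all _ fun x hx => ?_)
    have hc : 0 ≤ c := by
      have := (abs_nonneg _).trans (h0 1 one_pos le_rfl); simpa using this
    rw [norm_mul, Real.norm_eq_abs, Real.norm_of_nonneg (Real.rpow_nonneg hx.1.le _)]
    calc |g x| * x ^ (-α) ≤ c * x ^ 2 * x ^ (-α) := by
          gcongr
          · exact Real.rpow_nonneg hx.1.le _
          · exact h0 x hx.1 hx.2
      _ = c * x ^ (2 - α) := by
          rw [mul_assoc, ← Real.rpow_two, ← Real.rpow_add hx.1, sub_eq_add_neg]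
      _ ≤ c * 1 := by
          gcongr
          exact Real.rpow_le_one hx.1.le hx.2 (by linarith)
      _ = c := mul_one c
  · have hi := (integrableOn_Ioi_rpow_of_lt (a := -α) (c := 1) (by linarith) one_pos).const_mul c
    refine Integrable.mono' hi (by fun_prop) ?_
    refine (ae_restrict_iff' measurableSet_Ioi).2 (ae_of_all _ fun x (hx : 1 < x) => ?_)
    rw [norm_mul, Real.norm_eq_abs, Real.norm_of_nonneg (Real.rpow_nonneg (by linarith) _)]
    gcongr
    exact h1 x hx

lemma integrable_mul_rpow_abs_neg {α : ℝ} (hα : 1 < α) (hα₂ : α ≤ 2) {g : ℝ → ℝ} {c : ℝ}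
    (hg : Measurable g) (h0 : ∀ x, 0 < x → x ≤ 1 → |g x| ≤ c * x ^ 2)
    (h1 : ∀ x, 1 < x → |g x| ≤ c) :
    Integrable (fun x => g |x| * |x| ^ (-α)) :=
  integrable_comp_abs (integrableOn_mul_rpow_neg hα hα₂ hg h0 h1)

/-- `cos x - 1 + x ^ 2 / 2`, the second-order remainder of the cosine; it makes
`∫ (⋯) |x| ^ (-(2 + α)) dx` converge both at `0` and at infinity. -/
def cosRemainder (x : ℝ) : ℝ := Real.cos x - 1 + x ^ 2 / 2

lemma cosRemainder_nonneg (x : ℝ) : 0 ≤ cosRemainder x := by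
  have := Real.one_sub_sq_div_two_le_cos (x := x)
  unfold cosRemainder; linarith

lemma cosRemainder_le_sq (x : ℝ) : cosRemainder x ≤ x ^ 2 / 2 := by
  have := Real.cos_le_one x
  unfold cosRemainder; linarith

lemma cosRemainder_le_pow_four {x : ℝ} (hx : |x| ≤ 1) : cosRemainder x ≤ x ^ 4 := by
  have h := (abs_le.1 (Real.cos_bound hx)).2
  have h4 : |x| ^ 4 = x ^ 4 := by rw [Even.pow_abs (by decide)]
  have : 0 ≤ x ^ 4 := by positivity
  unfold cosRemainder
  rw [h4] at h
  linarith

lemma measurable_cosRemainder : Measurable cosRemainder := by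
  unfold cosRemainder; fun_prop

lemma rpow_abs_split {α u : ℝ} (hu : u ≠ 0) :
    |u| ^ (-(2 + α)) = (u ^ 2)⁻¹ * |u| ^ (-α) := by
  rw [neg_add, Real.rpow_add (abs_pos.2 hu), Real.rpow_neg (abs_nonneg _), Real.rpow_two, sq_abs]

lemma integrable_cosRemainder {α : ℝ} (hα : 1 < α) (hα₂ : α ≤ 2) :
    Integrable (fun x => cosRemainder x * |x| ^ (-(2 + α))) := by
  have h := integrable_mul_rpow_abs_neg hα hα₂ (g := fun x => cosRemainder x / x ^ 2) (c := 1)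
    (measurable_cosRemainder.div (by fun_prop)) ?_ ?_
  · refine h.congr ?_
    filter_upwards [compl_mem_ae_iff.2 (measure_singleton (0 : ℝ))] with x hx
    have hx0 : x ≠ 0 := hx
    have hc : cosRemainder |x| = cosRemainder x := by simp [cosRemainder]
    rw [hc, sq_abs, rpow_abs_split hx0]
    ring
  · intro x hx hx1
    rw [abs_of_nonneg (div_nonneg (cosRemainder_nonneg x) (sq_nonneg x)),
      div_le_iff₀ (by positivity)]
    have := cosRemainder_le_pow_four (x := x) (by rw [abs_of_pos hx]; exact hx1)
    nlinarith
  · intro x hx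
    have hx0 : 0 < x := by linarith
    rw [abs_of_nonneg (div_nonneg (cosRemainder_nonneg x) (sq_nonneg x)),
      div_le_iff₀ (by positivity)]
    have := cosRemainder_le_sq x
    nlinarith [sq_nonneg x]

/-- The constant `∫ (cos x - 1 + x ^ 2 / 2) |x| ^ (-(2 + α)) dx`. -/
def cosConst (α : ℝ) : ℝ := ∫ x : ℝ, cosRemainder x * |x| ^ (-(2 + α))

lemma cosConst_pos {α : ℝ} (hα : 1 < α) (hα₂ : α ≤ 2) : 0 < cosConst α := by
  unfold cosConst
  rw [integral_pos_iff_support_of_nonneg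
    (fun x => mul_nonneg (cosRemainder_nonneg x) (Real.rpow_nonneg (abs_nonneg x) _))
    (integrable_cosRemainder hα hα₂)]
  refine lt_of_lt_of_le ?_ (measure_mono (s := Set.Ioo (2 : ℝ) 3) ?_)
  · simp
    norm_num
  · intro x hx
    have h2 : 0 < cosRemainder x := by
      have := Real.neg_one_le_cos x
      unfold cosRemainder
      nlinarith [hx.1]
    have h3 : 0 < |x| := abs_pos.2 (by linarith [hx.1])
    exact (mul_pos h2 (Real.rpow_pos_of_pos h3 _)).ne'

lemma integrable_cosRemainder_mul {α : ℝ} (hα : 1 < α) (hα₂ : α ≤ 2) (s : ℝ) :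
    Integrable (fun u => cosRemainder (u * s) * |u| ^ (-(2 + α))) := by
  rcases eq_or_ne s 0 with rfl | hs
  · simp [cosRemainder]
  have h := ((integrable_cosRemainder hα hα₂).comp_mul_right' (R := s) hs).const_mul
    (|s| ^ (2 + α))
  refine h.congr (ae_of_all _ fun u => ?_)
  have hs' : 0 < |s| := abs_pos.2 hs
  simp only
  rw [abs_mul, Real.mul_rpow (abs_nonneg _) (abs_nonneg _), Real.rpow_neg (abs_nonneg s)]
  have := (Real.rpow_pos_of_pos hs' (2 + α)).ne'
  field_simp

/-- Scaling: `∫ (cos (u s) - 1 + (u s) ^ 2 / 2) |u| ^ (-(2 + α)) du` is proportional to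
`|s| ^ (1 + α)`. -/
lemma integral_cosRemainder_mul {α : ℝ} (hα : 1 < α) (s : ℝ) :
    ∫ u : ℝ, cosRemainder (u * s) * |u| ^ (-(2 + α)) = cosConst α * |s| ^ (1 + α) := by
  rcases eq_or_ne s 0 with rfl | hs
  · rw [abs_zero, Real.zero_rpow (by linarith)]
    simp [cosRemainder]
  have hs' : 0 < |s| := abs_pos.2 hs
  have h := Measure.integral_comp_mul_right (fun x => cosRemainder x * |x| ^ (-(2 + α))) s
  have h2 : ∀ u : ℝ, cosRemainder (u * s) * |u| ^ (-(2 + α)) =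
      |s| ^ (2 + α) * (cosRemainder (u * s) * |u * s| ^ (-(2 + α))) := by
    intro u
    rw [abs_mul, Real.mul_rpow (abs_nonneg _) (abs_nonneg _), Real.rpow_neg (abs_nonneg s)]
    have := (Real.rpow_pos_of_pos hs' (2 + α)).ne'
    field_simp
  simp_rw [h2]
  rw [integral_const_mul, h, smul_eq_mul, abs_inv, ← cosConst,
    show (2 + α) = (1 + α) + 1 by ring, Real.rpow_add hs', Real.rpow_one]
  field_simp

/-- The spectral function `u ↦ (1 - cos (u t)) |u| ^ (-(1 + α / 2))` of negative sub-fractional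
Brownian motion at time `t`. -/
def specFun (α t u : ℝ) : ℝ := (1 - Real.cos (u * t)) * |u| ^ (-(1 + α / 2))

lemma measurable_specFun (α t : ℝ) : Measurable (specFun α t) := by
  unfold specFun; fun_prop

lemma specFun_mul_specFun (α s t u : ℝ) :
    specFun α s u * specFun α t u =
      (1 - Real.cos (u * s)) * (1 - Real.cos (u * t)) * |u| ^ (-(2 + α)) := by
  unfold specFun
  rcases eq_or_ne u 0 with rfl | hu
  · simp
  rw [show -(2 + α) = -(1 + α / 2) + -(1 + α / 2) by ring, Real.rpow_add (abs_pos.2 hu)]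
  ring

/-- The quadratic terms cancel, so the product of the spectral functions is a combination of
cosine remainders. -/
lemma specFun_mul_eq (α s t u : ℝ) :
    specFun α s u * specFun α t u =
      (1 / 2) * (cosRemainder (u * (s + t)) * |u| ^ (-(2 + α)))
        + (1 / 2) * (cosRemainder (u * (t - s)) * |u| ^ (-(2 + α)))
        - cosRemainder (u * s) * |u| ^ (-(2 + α)) - cosRemainder (u * t) * |u| ^ (-(2 + α)) := by
  rw [specFun_mul_specFun]
  unfold cosRemainder
  rw [mul_add, mul_sub u, Real.cos_add, Real.cos_sub]
  ring

lemma integrable_specFun_mul {α : ℝ} (hα : 1 < α) (hα₂ : α ≤ 2) (s t : ℝ) :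
    Integrable (fun u => specFun α s u * specFun α t u) := by
  simp_rw [specFun_mul_eq]
  have h := integrable_cosRemainder_mul hα hα₂
  exact ((((h _).const_mul _).add ((h _).const_mul _)).sub (h _)).sub (h _)

theorem integral_specFun_mul {α : ℝ} (hα : 1 < α) (hα₂ : α ≤ 2) {s t : ℝ} (hs : 0 ≤ s)
    (ht : 0 ≤ t) :
    ∫ u, specFun α s u * specFun α t u =
      - cosConst α * (s ^ (1 + α) + t ^ (1 + α)
        - ((s + t) ^ (1 + α) + |t - s| ^ (1 + α)) / 2) := by
  simp_rw [specFun_mul_eq]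
  have h := integrable_cosRemainder_mul hα hα₂
  rw [integral_sub, integral_sub, integral_add, integral_const_mul, integral_const_mul]
  · simp_rw [integral_cosRemainder_mul hα]
    rw [abs_of_nonneg (add_nonneg hs ht), abs_of_nonneg hs, abs_of_nonneg ht]
    ring
  · exact (h _).const_mul _
  · exact (h _).const_mul _
  · exact ((h _).const_mul _).add ((h _).const_mul _)
  · exact h _
  · exact (((h _).const_mul _).add ((h _).const_mul _)).sub (h _)
  · exact h _

/-- The spectral functions are locally Lipschitz in `t` with respect to the `L²` norm. -/
lemma integral_specFun_sub_sq_le {α : ℝ} (hα : 1 < α) (hα₂ : α ≤ 2) (m : ℝ) :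
    ∃ C, 0 ≤ C ∧ ∀ s t, 0 ≤ s → s ≤ m → 0 ≤ t → t ≤ m →
      ∫ u, (specFun α s u - specFun α t u) ^ 2 ≤ C * (s - t) ^ 2 := by
  -- `min (u² m²) 1 |u|^(-α)` dominates the squared difference quotients for `s, t ∈ [0, m]`
  have hg : Integrable (fun u : ℝ => (min (|u| ^ 2 * m ^ 2) 1) * |u| ^ (-α)) := by
    refine integrable_mul_rpow_abs_neg hα hα₂ (g := fun x => min (x ^ 2 * m ^ 2) 1)
      (c := max (m ^ 2) 1) (by fun_prop) ?_ ?_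
    · intro x _ _
      rw [abs_of_nonneg (by positivity)]
      calc min (x ^ 2 * m ^ 2) 1 ≤ x ^ 2 * m ^ 2 := min_le_left _ _
        _ ≤ x ^ 2 * max (m ^ 2) 1 := by gcongr; exact le_max_left _ _
        _ = _ := mul_comm _ _
    · intro x _
      rw [abs_of_nonneg (by positivity)]
      exact (min_le_right _ _).trans (le_max_right _ _)
  refine ⟨∫ u : ℝ, (min (|u| ^ 2 * m ^ 2) 1) * |u| ^ (-α), ?_, fun s t hs hsm ht htm => ?_⟩
  · exact integral_nonneg fun u => by positivity
  · rw [← integral_mul_const]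
    refine integral_mono_of_nonneg (ae_of_all _ fun u => sq_nonneg _) (hg.mul_const _) ?_
    refine ae_of_all _ fun u => ?_
    rcases eq_or_ne u 0 with rfl | hu
    · simp only [specFun]
      simp
    have h1 : (specFun α s u - specFun α t u) ^ 2 =
        (Real.cos (u * s) - Real.cos (u * t)) ^ 2 * |u| ^ (-(2 + α)) := by
      unfold specFun
      rw [show -(2 + α) = -(1 + α / 2) + -(1 + α / 2) by ring, Real.rpow_add (abs_pos.2 hu)]
      ring
    simp only
    rw [h1, rpow_abs_split hu, sq_abs]
    have h2 : (Real.cos (u * s) - Real.cos (u * t)) ^ 2 ≤ (u ^ 2 * m ^ 2) * (u * (s - t)) ^ 2 := by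
      rw [Real.cos_sub_cos, mul_pow, mul_pow]
      have e1 : Real.sin ((u * s + u * t) / 2) ^ 2 ≤ u ^ 2 * m ^ 2 := by
        refine (sq_le_sq.2 (Real.abs_sin_le_abs)).trans ?_
        have : ((s + t) / 2) ^ 2 ≤ m ^ 2 := by
          apply pow_le_pow_left₀ (by linarith); linarith
        calc ((u * s + u * t) / 2) ^ 2 = u ^ 2 * ((s + t) / 2) ^ 2 := by ring
          _ ≤ _ := by gcongr
      have e2 : Real.sin ((u * s - u * t) / 2) ^ 2 ≤ (u * (s - t)) ^ 2 / 4 := by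
        refine (sq_le_sq.2 (Real.abs_sin_le_abs)).trans (le_of_eq ?_)
        ring
      have := mul_le_mul e1 e2 (sq_nonneg _) (by positivity)
      linarith
    have h3 : (Real.cos (u * s) - Real.cos (u * t)) ^ 2 ≤ 1 * (u * (s - t)) ^ 2 := by
      rw [one_mul]
      refine sq_le_sq.2 ((Real.abs_cos_sub_cos_le _ _).trans (le_of_eq ?_))
      rw [mul_sub]
    have h4 : (Real.cos (u * s) - Real.cos (u * t)) ^ 2 ≤
        min (u ^ 2 * m ^ 2) 1 * (u * (s - t)) ^ 2 := by
      rcases min_choice (u ^ 2 * m ^ 2) 1 with h | h <;> rw [h] <;> assumption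
    have hu2 : 0 < u ^ 2 := by positivity
    calc _ ≤ min (u ^ 2 * m ^ 2) 1 * (u * (s - t)) ^ 2 * ((u ^ 2)⁻¹ * |u| ^ (-α)) := by gcongr
      _ = _ := by field_simp

/-! ### Gaussian processes with continuous paths -/

/-- **Isonormal Gaussian process** over a Hilbert space: a linear isometry into the square
integrable random variables of some probability space, all of whose values are centered
Gaussian. -/
theorem exists_isonormal (H : Type) [NormedAddCommGroup H] [InnerProductSpace ℝ H]
    [CompleteSpace H] :
    ∃ (Ω : Type) (_ : MeasurableSpace Ω) (P : Measure Ω) (_ : IsProbabilityMeasure P)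
      (W : H →ₗᵢ[ℝ] Lp ℝ 2 P),
      ∀ h : H, P.map (W h) = gaussianReal 0 (‖h‖₊ ^ 2) := by
  classical
  obtain ⟨w, b, -⟩ := exists_hilbertBasis ℝ H
  let P : Measure (w → ℝ) := Measure.infinitePi fun _ => gaussianReal 0 1
  have hξ : ∀ i : w, HasLaw (fun ω : w → ℝ => ω i) (gaussianReal 0 1) P := fun i =>
    ⟨(measurable_pi_apply i).aemeasurable,
      (measurePreserving_eval_infinitePi (fun _ : w => gaussianReal 0 1) i).map_eq⟩
  have hind : iIndepFun (fun (i : w) (ω : w → ℝ) => ω i) P :=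
    iIndepFun_infinitePi (X := fun _ x => x) fun _ => measurable_id
  have hg : ∀ i : w, HasGaussianLaw (fun ω : w → ℝ => ω i) P := fun i =>
    ⟨by rw [(hξ i).map_eq]; infer_instance⟩
  have hL2 : ∀ i : w, MemLp (fun ω : w → ℝ => ω i) 2 P := fun i => (hg i).memLp_two
  have hmean : ∀ i : w, ∫ ω, ω i ∂P = 0 := fun i => by
    have := (hξ i).integral_comp (f := fun x => x) (by fun_prop)
    simpa using this
  have hsq : ∀ i : w, ∫ ω, ω i * ω i ∂P = 1 := fun i => by
    have h1 := (hξ i).variance_eq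
    rw [variance_of_integral_eq_zero (measurable_pi_apply i).aemeasurable (hmean i)] at h1
    simpa [pow_two] using h1
  let e : w → Lp ℝ 2 P := fun i => (hL2 i).toLp _
  have he : ∀ i, (e i : (w → ℝ) → ℝ) =ᵐ[P] fun ω => ω i := fun i => (hL2 i).coeFn_toLp
  have horth : Orthonormal ℝ e := by
    rw [orthonormal_iff_ite]
    intro i j
    rw [L2.inner_def]
    have h1 : ∫ ω, inner ℝ (e i ω) (e j ω) ∂P = ∫ ω, ω j * ω i ∂P := by
      refine integral_congr_ae ?_
      filter_upwards [he i, he j] with ω h1 h2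
      simp [h1, h2]
    rw [h1]
    split_ifs with hij
    · rw [hij]; exact hsq j
    · have := (hind.indepFun (Ne.symm hij)).integral_mul_eq_mul_integral
        (hL2 j).1 (hL2 i).1
      simpa [hmean] using this
  let V := horth.orthogonalFamily.linearIsometry
  let W : H →ₗᵢ[ℝ] Lp ℝ 2 P := V.comp b.repr.toLinearIsometry
  have hWb : ∀ i, W (b i) = e i := by
    intro i
    change V (b.repr (b i)) = e i
    rw [b.repr_self]
    simp [V]
  refine ⟨w → ℝ, inferInstance, P, inferInstance, W, fun h => ?_⟩
  have hWm : ∀ h, AEMeasurable (W h) P := fun h => (Lp.aestronglyMeasurable _).aemeasurable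
  -- it suffices to compute characteristic functions, which depend continuously on `h`
  have key : ∀ u : ℝ, ∀ h : H, charFun (P.map (W h)) u =
      Complex.exp (-((‖h‖ ^ 2 * u ^ 2 / 2 : ℝ) : ℂ)) := by
    intro u
    have hcf : ∀ h, charFun (P.map (W h)) u = ∫ ω, Complex.exp (u * W h ω * Complex.I) ∂P := by
      intro h
      rw [charFun_apply_real, integral_map (hWm h) (by fun_prop)]
    have hcont : Continuous fun h : H => ∫ ω, Complex.exp (u * W h ω * Complex.I) ∂P := by
      have hint : ∀ h, Integrable (fun ω => Complex.exp (u * W h ω * Complex.I)) P := by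
        intro h
        refine Integrable.of_bound (C := 1) ?_ (ae_of_all _ fun ω => ?_)
        · have := hWm h
          exact (by fun_prop : AEMeasurable _ P).aestronglyMeasurable
        · rw [← Complex.ofReal_mul, Complex.norm_exp_ofReal_mul_I]
      have hL1 : ∀ h, Integrable (W h : (w → ℝ) → ℝ) P := fun h =>
        (Lp.memLp (W h)).integrable (by norm_num)
      refine (LipschitzWith.of_dist_le_mul (K := ‖u‖₊) fun h h' => ?_).continuous
      rw [dist_eq_norm, ← integral_sub (hint h) (hint h')]
      calc _ ≤ ∫ ω, |u| * |W (h - h') ω| ∂P := by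
            refine norm_integral_le_of_norm_le ((hL1 _).abs.const_mul _) ?_
            filter_upwards [Lp.coeFn_sub (W h) (W h')] with ω hω
            rw [map_sub, hω, Pi.sub_apply, ← abs_mul, mul_sub, ← Complex.ofReal_mul,
              ← Complex.ofReal_mul]
            have h1 := Real.norm_exp_I_mul_ofReal_sub_one_le (x := u * W h ω - u * W h' ω)
            have h2 : Complex.exp (↑(u * W h ω) * Complex.I) -
                Complex.exp (↑(u * W h' ω) * Complex.I) =
                Complex.exp (↑(u * W h' ω) * Complex.I) *
                  (Complex.exp (Complex.I * ↑(u * W h ω - u * W h' ω)) - 1) := by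
              rw [mul_sub, mul_one, ← Complex.exp_add]
              congr 2
              push_cast
              ring
            rw [h2, norm_mul, Complex.norm_exp_ofReal_mul_I, one_mul]
            exact h1
        _ = |u| * ∫ ω, ‖W (h - h') ω‖ ∂P := by rw [integral_const_mul]; rfl
        _ ≤ |u| * ‖W (h - h')‖ := by
            gcongr
            rw [Lp.norm_def, integral_norm_eq_lintegral_enorm (Lp.aestronglyMeasurable _),
              ← eLpNorm_one_eq_lintegral_enorm]
            exact ENNReal.toReal_mono (Lp.eLpNorm_ne_top _)
              (eLpNorm_le_eLpNorm_of_exponent_le (by norm_num) (Lp.aestronglyMeasurable _))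
        _ = _ := by rw [W.norm_map, dist_eq_norm]; rfl
    have hspan : Dense (Submodule.span ℝ (Set.range b) : Set H) :=
      Submodule.dense_iff_topologicalClosure_eq_top.2 b.dense_span
    intro h
    rw [hcf]
    refine hspan.induction (P := fun h => ∫ ω, Complex.exp (u * W h ω * Complex.I) ∂P =
      Complex.exp (-((‖h‖ ^ 2 * u ^ 2 / 2 : ℝ) : ℂ))) ?_
      (isClosed_eq hcont (by fun_prop)) h
    intro x hx
    obtain ⟨c, rfl⟩ := (Finsupp.mem_span_range_iff_exists_finsupp).1 hx
    have hn : ‖c.sum fun i a => a • b i‖ ^ 2 = ∑ i ∈ c.support, c i ^ 2 := by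
      rw [← real_inner_self_eq_norm_sq, Finsupp.sum, b.orthonormal.inner_sum]
      simp [pow_two]
    have hW : (W (c.sum fun i a => a • b i) : (w → ℝ) → ℝ) =ᵐ[P]
        fun ω => ∑ i ∈ c.support, c i * ω i := by
      have h1 : W (c.sum fun i a => a • b i) = ∑ i ∈ c.support, c i • e i := by
        rw [Finsupp.sum, map_sum]
        simp [hWb]
      rw [h1]
      have h2 : ∀ᵐ ω ∂P, ∀ i ∈ c.support, (c i • e i : Lp ℝ 2 P) ω = c i * ω i := by
        refine (Finset.eventually_all _).2 fun i _ => ?_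
        filter_upwards [Lp.coeFn_smul (c i) (e i), he i] with ω h3 h4
        rw [h3, Pi.smul_apply, h4, smul_eq_mul]
      filter_upwards [Lp.coeFn_finsetSum c.support (fun i => c i • e i), h2] with ω h5 h6
      rw [h5, Finset.sum_apply]
      exact Finset.sum_congr rfl h6
    have h2 : ∫ ω, Complex.exp (u * W (c.sum fun i a => a • b i) ω * Complex.I) ∂P =
        ∫ ω, ∏ i : c.support, Complex.exp (u * (c i * ω i) * Complex.I) ∂P := by
      refine integral_congr_ae ?_
      filter_upwards [hW] with ω hω
      rw [hω, ← Complex.exp_sum, Finset.sum_coe_sort c.support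
        (fun i => (u : ℂ) * (c i * ω i) * Complex.I), ← Finset.sum_mul, ← Finset.mul_sum]
      push_cast
      rfl
    have hmexp : ∀ i : c.support, Measurable fun ω : w → ℝ =>
        Complex.exp (u * (c i * ω i) * Complex.I) := fun i => by
      have : Measurable fun ω : w → ℝ => ω i := measurable_pi_apply _
      fun_prop
    have hind2 : iIndepFun (fun (i : c.support) (ω : w → ℝ) =>
        Complex.exp (u * (c i * ω i) * Complex.I)) P :=
      (hind.precomp (g := fun i : c.support => (i : w)) Subtype.val_injective).comp
        (fun i x => Complex.exp (u * (c i * x) * Complex.I)) fun i => by fun_prop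
    rw [h2, hind2.integral_fun_prod_eq_prod_integral (fun i => (hmexp i).aestronglyMeasurable), hn]
    have h3 : ∀ i : c.support, ∫ ω, Complex.exp (u * (c i * ω i) * Complex.I) ∂P =
        Complex.exp (-(((c i) ^ 2 * u ^ 2 / 2 : ℝ) : ℂ)) := by
      intro i
      have h4 := charFun_gaussianReal (μ := 0) (v := 1) (u * c i)
      rw [← (hξ i).map_eq, charFun_apply_real, integral_map (hξ i).aemeasurable (by fun_prop)] at h4
      convert h4 using 2
      · funext ω
        push_cast
        ring_nf
      · push_cast
        ring_nf
    simp_rw [h3]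
    rw [← Complex.exp_sum, Finset.sum_coe_sort c.support
        (fun i => -(((c i) ^ 2 * u ^ 2 / 2 : ℝ) : ℂ)), Finset.sum_neg_distrib,
        ← Complex.ofReal_sum, ← Finset.sum_div, ← Finset.sum_mul]
  have : IsProbabilityMeasure (P.map (W h)) := Measure.isProbabilityMeasure_map (hWm h)
  refine Measure.ext_of_charFun (funext fun u => ?_)
  rw [key, charFun_gaussianReal]
  congr 1
  push_cast
  simp

/-- The largest dyadic number `k / 2 ^ n` that is at most `t`. -/
def dyadicFloor (n : ℕ) (t : ℝ≥0) : ℝ≥0 := ⌊t * 2 ^ n⌋₊ / 2 ^ n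

lemma dyadicFloor_le (n : ℕ) (t : ℝ≥0) : dyadicFloor n t ≤ t := by
  rw [dyadicFloor, div_le_iff₀ (by positivity)]
  exact Nat.floor_le (by positivity)

lemma lt_dyadicFloor_add (n : ℕ) (t : ℝ≥0) : t < dyadicFloor n t + (1 / 2) ^ n := by
  have h := Nat.lt_floor_add_one (t * 2 ^ n)
  rw [dyadicFloor, one_div, inv_pow, ← one_div, ← add_div, lt_div_iff₀ (by positivity)]
  exact h

lemma floor_lt_of_lt {m n : ℕ} {t : ℝ≥0} (ht : t < m) : ⌊t * 2 ^ n⌋₊ < m * 2 ^ n := by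
  rw [Nat.floor_lt (by positivity)]
  push_cast
  gcongr

lemma floor_succ_eq (n : ℕ) (t : ℝ≥0) :
    ⌊t * 2 ^ (n + 1)⌋₊ = 2 * ⌊t * 2 ^ n⌋₊ ∨ ⌊t * 2 ^ (n + 1)⌋₊ = 2 * ⌊t * 2 ^ n⌋₊ + 1 := by
  have h1 := Nat.floor_le (a := t * 2 ^ n) (by positivity)
  have h2 := Nat.lt_floor_add_one (t * 2 ^ n)
  set k := ⌊t * 2 ^ n⌋₊
  have e : t * 2 ^ (n + 1) = 2 * (t * 2 ^ n) := by ring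
  have h3 : 2 * k ≤ ⌊t * 2 ^ (n + 1)⌋₊ := by
    apply Nat.le_floor
    rw [e]
    push_cast
    gcongr
  have h4 : ⌊t * 2 ^ (n + 1)⌋₊ < 2 * k + 2 := by
    rw [Nat.floor_lt (by positivity), e]
    calc 2 * (t * 2 ^ n) < 2 * (k + 1) := by gcongr
      _ = _ := by push_cast; ring
  omega

/-- If the dyadic increments of `f` decay geometrically, locally uniformly, then the values of `f`
along dyadic approximations converge to a continuous function. -/
lemma exists_continuous_of_dyadic {f : ℝ≥0 → ℝ} {ρ : ℝ} (hρ0 : 0 < ρ) (hρ : ρ < 1)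
    (hf : ∀ m : ℕ, ∃ B : ℝ, ∀ n k : ℕ, k < m * 2 ^ n →
      |f ((k + 1 : ℕ) / 2 ^ n) - f ((k : ℕ) / 2 ^ n)| ≤ B * ρ ^ n) :
    ∃ g : ℝ≥0 → ℝ, Continuous g ∧
      ∀ t, Tendsto (fun n => f (dyadicFloor n t)) atTop (𝓝 (g t)) := by
  choose B hB using hf
  have hstep : ∀ m : ℕ, ∀ t : ℝ≥0, t < m → ∀ n,
      dist (f (dyadicFloor n t)) (f (dyadicFloor (n + 1) t)) ≤ |B m| * ρ ^ n := by
    intro m t ht n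
    rw [dyadicFloor, dyadicFloor]
    have e : ((⌊t * 2 ^ n⌋₊ : ℝ≥0) / 2 ^ n) = ((2 * ⌊t * 2 ^ n⌋₊ : ℕ) : ℝ≥0) / 2 ^ (n + 1) := by
      push_cast
      rw [pow_succ]
      field_simp
    have hlt : 2 * ⌊t * 2 ^ n⌋₊ < m * 2 ^ (n + 1) := by
      have := floor_lt_of_lt (n := n) ht
      rw [pow_succ]; linarith
    rw [e]
    rcases floor_succ_eq n t with h | h
    · rw [h, dist_self]; positivity
    · rw [h, dist_comm, Real.dist_eq]
      refine (hB m (n + 1) _ hlt).trans ?_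
      refine mul_le_mul (le_abs_self _) ?_ (by positivity) (abs_nonneg _)
      exact pow_le_pow_of_le_one hρ0.le hρ.le (Nat.le_succ n)
  have hcauchy : ∀ t : ℝ≥0, ∃ l, Tendsto (fun n => f (dyadicFloor n t)) atTop (𝓝 l) := by
    intro t
    obtain ⟨m, hm⟩ := exists_nat_gt t
    exact cauchySeq_tendsto_of_complete (cauchySeq_of_le_geometric ρ _ hρ (hstep m t hm))
  choose g hg using hcauchy
  refine ⟨g, ?_, hg⟩
  have happrox : ∀ m : ℕ, ∀ t : ℝ≥0, t < m → ∀ n,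
      dist (f (dyadicFloor n t)) (g t) ≤ |B m| * ρ ^ n / (1 - ρ) := fun m t ht n =>
    dist_le_of_le_geometric_of_tendsto ρ _ hρ (hstep m t ht) (hg t) n
  -- neighbouring points have equal or adjacent dyadic approximations
  have hnear : ∀ m n : ℕ, ∀ s t : ℝ≥0, s ≤ t → t < m → t < s + (1 / 2) ^ n →
      dist (f (dyadicFloor n s)) (f (dyadicFloor n t)) ≤ |B m| * ρ ^ n := by
    intro m n s t hst ht hts
    rw [dyadicFloor, dyadicFloor]
    have h1 : ⌊s * 2 ^ n⌋₊ ≤ ⌊t * 2 ^ n⌋₊ := Nat.floor_mono (by gcongr)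
    have h2 : ⌊t * 2 ^ n⌋₊ ≤ ⌊s * 2 ^ n⌋₊ + 1 := by
      rw [← Nat.floor_add_one (by positivity)]
      refine Nat.floor_mono ?_
      calc t * 2 ^ n ≤ (s + (1 / 2) ^ n) * 2 ^ n := by gcongr
        _ = _ := by rw [add_mul, ← mul_pow]; norm_num
    rcases Nat.le_or_eq_of_le_succ h2 with h | h
    · rw [le_antisymm h h1, dist_self]; positivity
    · rw [h, dist_comm, Real.dist_eq]
      refine (hB m n _ (floor_lt_of_lt (hst.trans_lt ht))).trans ?_
      gcongr
      exact le_abs_self _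
  have hmod : ∀ m n : ℕ, ∀ s t : ℝ≥0, s ≤ t → t < m → t < s + (1 / 2) ^ n →
      dist (g s) (g t) ≤ (2 * (|B m| / (1 - ρ)) + |B m|) * ρ ^ n := by
    intro m n s t hst ht hts
    calc dist (g s) (g t) ≤ dist (g s) (f (dyadicFloor n s)) +
          dist (f (dyadicFloor n s)) (f (dyadicFloor n t)) + dist (f (dyadicFloor n t)) (g t) :=
          dist_triangle4 _ _ _ _
      _ ≤ |B m| * ρ ^ n / (1 - ρ) + |B m| * ρ ^ n + |B m| * ρ ^ n / (1 - ρ) := by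
          gcongr
          · rw [dist_comm]; exact happrox m s (hst.trans_lt ht) n
          · exact hnear m n s t hst ht hts
          · exact happrox m t ht n
      _ = _ := by ring
  rw [Metric.continuous_iff']
  intro a ε hε
  obtain ⟨m, hm⟩ := exists_nat_gt a
  have hlim : Tendsto (fun n => (2 * (|B m| / (1 - ρ)) + |B m|) * ρ ^ n) atTop (𝓝 0) := by
    have := (tendsto_pow_atTop_nhds_zero_of_lt_one hρ0.le hρ).const_mul
      (2 * (|B m| / (1 - ρ)) + |B m|)
    simpa using this
  obtain ⟨n, hn⟩ := (hlim.eventually (gt_mem_nhds hε)).exists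
  have hδ : (0 : ℝ) < (1 / 2) ^ n := by positivity
  filter_upwards [Metric.ball_mem_nhds a hδ, gt_mem_nhds hm] with t ht htm
  rw [Metric.mem_ball, NNReal.dist_eq, abs_lt] at ht
  refine lt_of_le_of_lt ?_ hn
  rcases le_total t a with h | h
  · refine hmod m n t a h hm ?_
    rw [← NNReal.coe_lt_coe]; push_cast; linarith [ht.1]
  · rw [dist_comm]
    refine hmod m n a t h htm ?_
    rw [← NNReal.coe_lt_coe]; push_cast; linarith [ht.2]

/-- **Kolmogorov's continuity criterion**, for second moments of order `|s - t| ^ 2`. -/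
theorem exists_continuous_modification {Ω : Type*} [MeasurableSpace Ω] {P : Measure Ω}
    [IsProbabilityMeasure P] {X : ℝ≥0 → Ω → ℝ} (hX : ∀ t, AEMeasurable (X t) P)
    (hinc : ∀ m : ℕ, ∃ C : ℝ≥0, ∀ s t : ℝ≥0, s ≤ m → t ≤ m →
      ∫⁻ ω, ENNReal.ofReal ((X s ω - X t ω) ^ 2) ∂P ≤ C * ENNReal.ofReal (((s : ℝ) - t) ^ 2)) :
    ∃ Y : ℝ≥0 → Ω → ℝ, (∀ ω, Continuous fun t => Y t ω) ∧ ∀ t, X t =ᵐ[P] Y t := by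
  have hD : ∀ᵐ ω ∂P, ∀ m : ℕ, ∃ B : ℝ, ∀ n k : ℕ, k < m * 2 ^ n →
      |X ((k + 1 : ℕ) / 2 ^ n) ω - X ((k : ℕ) / 2 ^ n) ω| ≤ B * (5 / 6) ^ n := by
    rw [ae_all_iff]
    intro m
    obtain ⟨C, hC⟩ := hinc m
    -- The weight `(3 / 2) ^ n` keeps the expectations summable, as `2 * (3 / 2) * (1 / 4) < 1`, and
    -- forces the increments to be of order `(5 / 6) ^ n`, as `(3 / 2) * (5 / 6) ^ 2 ≥ 1`.
    let D : ℕ → ℕ → Ω → ℝ≥0∞ := fun n k ω => ENNReal.ofReal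
      ((3 / 2) ^ n * (X ((k + 1 : ℕ) / 2 ^ n) ω - X ((k : ℕ) / 2 ^ n) ω) ^ 2)
    have hDm : ∀ n k, AEMeasurable (D n k) P := fun n k => by
      have h1 := hX (((k + 1 : ℕ) : ℝ≥0) / 2 ^ n)
      have h2 := hX (((k : ℕ) : ℝ≥0) / 2 ^ n)
      exact ((((h1.sub h2).pow_const 2)).const_mul _).ennreal_ofReal
    have hDi : ∀ n k, k < m * 2 ^ n → ∫⁻ ω, D n k ω ∂P ≤ C * ENNReal.ofReal ((3 / 8) ^ n) := by
      intro n k hk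
      have hk' : ((k : ℕ) : ℝ≥0) / 2 ^ n ≤ m := by
        rw [div_le_iff₀ (by positivity)]; exact_mod_cast hk.le
      have hk'' : ((k + 1 : ℕ) : ℝ≥0) / 2 ^ n ≤ m := by
        rw [div_le_iff₀ (by positivity)]; exact_mod_cast hk
      simp only [D]
      simp_rw [ENNReal.ofReal_mul (show (0 : ℝ) ≤ (3 / 2) ^ n by positivity)]
      rw [lintegral_const_mul' _ _ ENNReal.ofReal_ne_top]
      refine (mul_le_mul_right (hC _ _ hk'' hk') _).trans (le_of_eq ?_)
      rw [mul_left_comm, ← ENNReal.ofReal_mul (by positivity)]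
      congr 2
      push_cast
      rw [← sub_div, add_sub_cancel_left, show (3 / 8 : ℝ) = 3 / 2 * (1 / 2) ^ 2 by norm_num,
        mul_pow, ← pow_mul, mul_comm 2 n, pow_mul, one_div_pow (2 : ℝ) n]
    have hsum : ∫⁻ ω, ∑' n, ∑ k ∈ Finset.range (m * 2 ^ n), D n k ω ∂P ≠ ∞ := by
      rw [lintegral_tsum fun n => Finset.aemeasurable_fun_sum _ fun k _ => hDm n k]
      have : ∀ n, ∫⁻ ω, ∑ k ∈ Finset.range (m * 2 ^ n), D n k ω ∂P ≤
          ENNReal.ofReal (m * C * (3 / 4) ^ n) := by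
        intro n
        rw [lintegral_finsetSum' _ fun k _ => hDm n k]
        refine (Finset.sum_le_sum fun k hk => hDi n k (Finset.mem_range.1 hk)).trans ?_
        rw [Finset.sum_const, Finset.card_range, nsmul_eq_mul]
        rw [← ENNReal.ofReal_natCast, ← ENNReal.ofReal_coe_nnreal,
          ← ENNReal.ofReal_mul (by positivity), ← ENNReal.ofReal_mul (by positivity)]
        refine ENNReal.ofReal_le_ofReal (le_of_eq ?_)
        push_cast
        rw [show (3 / 4 : ℝ) = 2 * (3 / 8) by norm_num, mul_pow]
        ring
      refine ne_top_of_le_ne_top ?_ (ENNReal.tsum_le_tsum this)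
      rw [← ENNReal.ofReal_tsum_of_nonneg (fun n => by positivity)]
      · exact ENNReal.ofReal_ne_top
      · exact (summable_geometric_of_lt_one (by norm_num) (by norm_num)).mul_left _
    have hmeas : AEMeasurable (fun ω => ∑' n, ∑ k ∈ Finset.range (m * 2 ^ n), D n k ω) P :=
      AEMeasurable.tsum fun n => Finset.aemeasurable_fun_sum _ fun k _ => hDm n k
    filter_upwards [ae_lt_top' hmeas hsum] with ω hω
    set S := ∑' n, ∑ k ∈ Finset.range (m * 2 ^ n), D n k ω with hS
    refine ⟨Real.sqrt S.toReal, fun n k hk => ?_⟩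
    have h1 : D n k ω ≤ S := by
      calc D n k ω ≤ ∑ k ∈ Finset.range (m * 2 ^ n), D n k ω :=
            Finset.single_le_sum (f := fun k => D n k ω) (fun _ _ => zero_le)
              (Finset.mem_range.2 hk)
        _ ≤ S := ENNReal.le_tsum (f := fun n => ∑ k ∈ Finset.range (m * 2 ^ n), D n k ω) n
    have h2 := (ENNReal.ofReal_le_iff_le_toReal hω.ne).1 h1
    refine abs_le_of_sq_le_sq ?_ (by positivity)
    rw [mul_pow, Real.sq_sqrt ENNReal.toReal_nonneg, ← pow_mul, mul_comm n 2, pow_mul]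
    have h3 : (1 : ℝ) ≤ (3 / 2) ^ n * ((5 / 6) ^ 2) ^ n := by
      rw [← mul_pow]; exact one_le_pow₀ (by norm_num)
    set x := (X ((k + 1 : ℕ) / 2 ^ n) ω - X ((k : ℕ) / 2 ^ n) ω) ^ 2
    have hx : 0 ≤ x := sq_nonneg _
    calc x ≤ x * ((3 / 2) ^ n * ((5 / 6) ^ 2) ^ n) := le_mul_of_one_le_right hx h3
      _ = (3 / 2) ^ n * x * ((5 / 6) ^ 2) ^ n := by ring
      _ ≤ S.toReal * ((5 / 6) ^ 2) ^ n := by gcongr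
  have hex : ∀ ω, ∃ g : ℝ≥0 → ℝ, Continuous g ∧
      ((∀ m : ℕ, ∃ B : ℝ, ∀ n k : ℕ, k < m * 2 ^ n →
        |X ((k + 1 : ℕ) / 2 ^ n) ω - X ((k : ℕ) / 2 ^ n) ω| ≤ B * (5 / 6) ^ n) →
      ∀ t, Tendsto (fun n => X (dyadicFloor n t) ω) atTop (𝓝 (g t))) := by
    intro ω
    by_cases h : ∀ m : ℕ, ∃ B : ℝ, ∀ n k : ℕ, k < m * 2 ^ n →
        |X ((k + 1 : ℕ) / 2 ^ n) ω - X ((k : ℕ) / 2 ^ n) ω| ≤ B * (5 / 6) ^ n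
    · obtain ⟨g, hg, hg'⟩ := exists_continuous_of_dyadic (f := fun t => X t ω) (ρ := 5 / 6)
        (by norm_num) (by norm_num) h
      exact ⟨g, hg, fun _ => hg'⟩
    · exact ⟨0, continuous_zero, fun h' => absurd h' h⟩
  choose Y hYc hY using hex
  refine ⟨fun t ω => Y ω t, hYc, fun t => ?_⟩
  -- the dyadic approximations converge to `X t` in `L²` and to `Y t` almost surely
  have hlim2 : TendstoInMeasure P (fun n => X (dyadicFloor n t)) atTop (X t) := by
    refine tendstoInMeasure_of_tendsto_eLpNorm (p := 2) two_ne_zero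
      (fun n => (hX _).aestronglyMeasurable) (hX t).aestronglyMeasurable ?_
    obtain ⟨m, hm⟩ := exists_nat_gt t
    obtain ⟨C, hC⟩ := hinc m
    have hb : ∀ n, eLpNorm (X (dyadicFloor n t) - X t) 2 P ≤
        (C * ENNReal.ofReal (((1 / 4 : ℝ)) ^ n)) ^ (1 / 2 : ℝ) := by
      intro n
      rw [eLpNorm_eq_lintegral_rpow_enorm_toReal two_ne_zero ENNReal.ofNat_ne_top]
      simp only [ENNReal.toReal_ofNat]
      refine ENNReal.rpow_le_rpow ?_ (by norm_num)
      have h1 : ∀ ω, ‖(X (dyadicFloor n t) - X t) ω‖ₑ ^ (2 : ℝ) =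
          ENNReal.ofReal ((X (dyadicFloor n t) ω - X t ω) ^ 2) := by
        intro ω
        rw [Pi.sub_apply, Real.enorm_eq_ofReal_abs, ENNReal.ofReal_rpow_of_nonneg (abs_nonneg _)
          (by norm_num), Real.rpow_two, sq_abs]
      simp_rw [h1]
      refine (hC _ _ ((dyadicFloor_le n t).trans hm.le) hm.le).trans ?_
      gcongr
      have h2 : ((dyadicFloor n t : ℝ≥0) : ℝ) ≤ t := dyadicFloor_le n t
      have h3 : (t : ℝ) < dyadicFloor n t + (1 / 2) ^ n := by
        have := lt_dyadicFloor_add n t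
        rw [← NNReal.coe_lt_coe] at this; push_cast at this; exact this
      rw [show (1 / 4 : ℝ) = (1 / 2) ^ 2 by norm_num, ← pow_mul, mul_comm 2 n, pow_mul]
      refine sq_le_sq' ?_ ?_ <;> linarith
    refine tendsto_of_tendsto_of_tendsto_of_le_of_le tendsto_const_nhds ?_
      (fun _ => zero_le) hb
    have h4 : Tendsto (fun n : ℕ => ENNReal.ofReal ((1 / 4 : ℝ) ^ n)) atTop (𝓝 0) := by
      rw [← ENNReal.ofReal_zero]
      exact ENNReal.tendsto_ofReal
        (tendsto_pow_atTop_nhds_zero_of_lt_one (by norm_num) (by norm_num))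
    have h5 := ENNReal.Tendsto.const_mul (a := (C : ℝ≥0∞)) h4 (Or.inr ENNReal.coe_ne_top)
    have h6 := (ENNReal.continuous_rpow_const (y := 1 / 2)).tendsto ((C : ℝ≥0∞) * 0) |>.comp h5
    simpa [Function.comp_def] using h6
  obtain ⟨ns, hns, hns'⟩ := hlim2.exists_seq_tendsto_ae
  filter_upwards [hD, hns'] with ω h1 h2
  exact tendsto_nhds_unique h2 ((hY ω h1 t).comp hns.tendsto_atTop)

/-- A family of vectors in a Hilbert space that is locally Lipschitz is the family of covariance
vectors of a centered Gaussian process with continuous paths. -/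
theorem exists_gaussianProcess {H : Type} [NormedAddCommGroup H] [InnerProductSpace ℝ H]
    [CompleteSpace H] (k : ℝ≥0 → H)
    (hk : ∀ m : ℕ, ∃ C : ℝ≥0, ∀ s t : ℝ≥0, s ≤ m → t ≤ m →
      ‖k s - k t‖ ^ 2 ≤ C * ((s : ℝ) - t) ^ 2) :
    ∃ (Ω : Type) (_ : MeasurableSpace Ω) (P : Measure Ω) (_ : IsProbabilityMeasure P)
      (ζ : ℝ≥0 → Ω → ℝ), IsGaussianProcess ζ P ∧ (∀ t, ∫ ω, ζ t ω ∂P = 0) ∧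
      (∀ s t, ∫ ω, ζ s ω * ζ t ω ∂P = inner ℝ (k s) (k t)) ∧
      (∀ ω, Continuous fun t => ζ t ω) ∧
      ∀ (n : ℕ) (t : Fin n → ℝ≥0) (a : Fin n → ℝ), ∫ ω, Complex.exp
        (((∑ i, a i * ζ (t i) ω : ℝ) : ℂ) * Complex.I) ∂P =
          Complex.exp (-((∑ i, ∑ j, a i * a j * inner ℝ (k (t i)) (k (t j)) : ℝ) : ℂ) / 2) := by
  obtain ⟨Ω, mΩ, P, hP, W, hW⟩ := exists_isonormal H
  have hWm : ∀ h, AEMeasurable (W h) P := fun h => (Lp.aestronglyMeasurable _).aemeasurable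
  have hWsq : ∀ h, ∫⁻ ω, ENNReal.ofReal ((W h ω) ^ 2) ∂P = ENNReal.ofReal (‖h‖ ^ 2) := by
    intro h
    rw [← ofReal_integral_eq_lintegral_ofReal (Lp.memLp (W h)).integrable_sq
      (ae_of_all _ fun _ => sq_nonneg _)]
    congr 1
    rw [← W.norm_map h, ← real_inner_self_eq_norm_sq, L2.inner_def]
    simp [pow_two]
  have hWlin : ∀ (ι : Type) (s : Finset ι) (a : ι → ℝ) (h : ι → H),
      (fun ω => ∑ i ∈ s, a i * W (h i) ω) =ᵐ[P] W (∑ i ∈ s, a i • h i) := by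
    intro ι s a h
    rw [map_sum]
    have h2 : ∀ᵐ ω ∂P, ∀ i ∈ s, (W (a i • h i)) ω = a i * W (h i) ω := by
      refine (Finset.eventually_all _).2 fun i _ => ?_
      rw [map_smul]
      filter_upwards [Lp.coeFn_smul (a i) (W (h i))] with ω h3
      rw [h3, Pi.smul_apply, smul_eq_mul]
    filter_upwards [Lp.coeFn_finsetSum s (fun i => W (a i • h i)), h2] with ω h5 h6
    rw [h5, Finset.sum_apply]
    exact (Finset.sum_congr rfl h6).symm
  obtain ⟨ζ, hζc, hζ⟩ := exists_continuous_modification (P := P) (X := fun t => W (k t))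
    (fun t => hWm _) (by
      intro m
      obtain ⟨C, hC⟩ := hk m
      refine ⟨C, fun s t hs ht => ?_⟩
      have h1 : ∫⁻ ω, ENNReal.ofReal ((W (k s) ω - W (k t) ω) ^ 2) ∂P =
          ∫⁻ ω, ENNReal.ofReal ((W (k s - k t) ω) ^ 2) ∂P := by
        refine lintegral_congr_ae ?_
        rw [map_sub]
        filter_upwards [Lp.coeFn_sub (W (k s)) (W (k t))] with ω hω
        rw [hω, Pi.sub_apply]
      rw [h1, hWsq, ← ENNReal.ofReal_coe_nnreal, ← ENNReal.ofReal_mul (by positivity)]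
      exact ENNReal.ofReal_le_ofReal (hC s t hs ht))
  have hWmean : ∀ h, ∫ ω, W h ω ∂P = 0 := fun h => by
    have := integral_map (hWm h) (f := fun x : ℝ => x) (by fun_prop)
    rw [hW] at this
    rw [← this]
    simp
  have hWvar : ∀ h, Var[W h; P] = ‖h‖ ^ 2 := fun h => by
    rw [variance_of_integral_eq_zero (hWm h) (hWmean h), ← W.norm_map h,
      ← real_inner_self_eq_norm_sq, L2.inner_def]
    simp [pow_two]
  have hGP : IsGaussianProcess (fun t => (W (k t) : Ω → ℝ)) P := by
    refine ⟨fun I => ⟨⟨fun L => ?_⟩⟩⟩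
    have hIm : AEMeasurable (fun ω => I.restrict fun t => (W (k t) : Ω → ℝ) ω) P :=
      aemeasurable_pi_lambda _ fun i => hWm _
    have hL : (fun ω => L (I.restrict fun t => (W (k t) : Ω → ℝ) ω)) =ᵐ[P]
        W (∑ i : I, L (Pi.single i 1) • k i) := by
      refine Filter.EventuallyEq.trans (ae_of_all _ fun ω => ?_)
        (hWlin I Finset.univ (fun i => L (Pi.single i 1)) (fun i => k i))
      have := L.toLinearMap.pi_apply_eq_sum_univ (I.restrict fun t => (W (k t) : Ω → ℝ) ω)
      simp only [ContinuousLinearMap.coe_coe, smul_eq_mul, Finset.restrict] at this ⊢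
      rw [this]
      refine Finset.sum_congr rfl fun i _ => ?_
      rw [mul_comm]
      congr 2
      funext j
      simp [Pi.single_apply, eq_comm]
    rw [AEMeasurable.map_map_of_aemeasurable (by fun_prop) hIm,
      integral_map hIm (by fun_prop), variance_map (by fun_prop) hIm]
    rw [integral_congr_ae hL, Function.comp_def, Measure.map_congr hL, variance_congr hL, hW,
      hWmean, hWvar]
    congr 1
    ext
    simp
  refine ⟨Ω, mΩ, P, hP, ζ, hGP.congr hζ, fun t => ?_, fun s t => ?_, hζc, fun n t a => ?_⟩
  · rw [← integral_congr_ae (hζ t)]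
    exact hWmean _
  · rw [← W.inner_map_map, L2.inner_def]
    refine integral_congr_ae ?_
    filter_upwards [hζ s, hζ t] with ω h1 h2
    rw [← h1, ← h2]
    simp [mul_comm]
  · have h1 : ∀ᵐ ω ∂P, ∑ i, a i * ζ (t i) ω = W (∑ i, a i • k (t i)) ω := by
      filter_upwards [hWlin (Fin n) Finset.univ a (fun i => k (t i)),
        ae_all_iff.2 fun i => hζ (t i)] with ω h2 h3
      rw [← h2]
      exact Finset.sum_congr rfl fun i _ => by rw [h3 i]
    have h2 := charFun_gaussianReal (μ := 0) (v := ‖∑ i, a i • k (t i)‖₊ ^ 2) 1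
    rw [← hW, charFun_apply_real, integral_map (hWm _) (by fun_prop)] at h2
    have h3 : ‖∑ i, a i • k (t i)‖ ^ 2 =
        ∑ i, ∑ j, a i * a j * inner ℝ (k (t i)) (k (t j)) := by
      rw [← real_inner_self_eq_norm_sq, sum_inner]
      refine Finset.sum_congr rfl fun i _ => ?_
      rw [inner_sum]
      refine Finset.sum_congr rfl fun j _ => ?_
      rw [real_inner_smul_left, real_inner_smul_right]
      ring
    rw [← h3]
    convert h2 using 1
    · refine integral_congr_ae ?_
      filter_upwards [h1] with ω hω
      rw [hω]
      simp
    · congr 1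
      push_cast
      ring_nf

/-! ### Campbell's formulas for Poisson random measures -/

lemma lintegral_natCast_poissonMeasure (r : ℝ≥0) :
    ∫⁻ n : ℕ, (n : ℝ≥0∞) ∂(poissonMeasure r) = r := by
  rw [poissonMeasure, lintegral_sum_measure]
  simp_rw [lintegral_smul_measure, lintegral_dirac, smul_eq_mul]
  have h : ∀ n : ℕ, ENNReal.ofReal (Real.exp (-r) * r ^ (n + 1) / (n + 1).factorial) *
      ((n + 1 : ℕ) : ℝ≥0∞) = r * ENNReal.ofReal (Real.exp (-r) * r ^ n / n.factorial) := by
    intro n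
    rw [← ENNReal.ofReal_natCast, ← ENNReal.ofReal_coe_nnreal, ← ENNReal.ofReal_mul (by positivity),
      ← ENNReal.ofReal_mul (by positivity)]
    congr 1
    rw [Nat.factorial_succ]
    push_cast
    field_simp
    ring
  rw [tsum_eq_zero_add' ENNReal.summable]
  simp_rw [h]
  rw [ENNReal.tsum_mul_left, ← ENNReal.ofReal_tsum_of_nonneg (fun n => by positivity)
    (hasSum_one_poissonMeasure r).summable, (hasSum_one_poissonMeasure r).tsum_eq]
  simp

lemma integral_pow_poissonMeasure (r : ℝ≥0) (z : ℂ) :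
    ∫ n : ℕ, z ^ n ∂(poissonMeasure r) = Complex.exp (r * (z - 1)) := by
  rw [integral_poissonMeasure]
  have h := (NormedSpace.expSeries_div_hasSum_exp ((r : ℂ) * z)).mul_left
    (Complex.exp (-(r : ℂ)))
  rw [← Complex.exp_eq_exp_ℂ, ← Complex.exp_add] at h
  rw [show (r : ℂ) * (z - 1) = -r + r * z by ring, ← h.tsum_eq]
  refine tsum_congr fun n => ?_
  rw [Complex.real_smul]
  push_cast
  rw [mul_pow]
  ring

section Campbell

variable {Ω E : Type*} [MeasurableSpace Ω] [MeasurableSpace E] {x : ℕ → Ω → E} {m : Measure E}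
  {P : Measure Ω}

lemma lintegral_count (h : IsPoissonRandomMeasure
    (fun ω => Measure.sum (fun k => Measure.dirac (x k ω))) m P) {A : Set E}
    (hA : MeasurableSet A) (hm : m A ≠ ∞) :
    ∫⁻ ω, (Measure.sum fun k => Measure.dirac (x k ω)) A ∂P = m A := by
  rw [(h.law_count A hA hm).lintegral_comp (f := fun v => v) aemeasurable_id,
    lintegral_map (f := fun v : ℝ≥0∞ => v) measurable_id .of_discrete, lintegral_natCast_poissonMeasure,
    ENNReal.coe_toNNReal hm]

/-- **Campbell's formula** for the mean of a sum over the points of a Poisson random measure. -/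
lemma lintegral_tsum_poisson [SigmaFinite m] (h : IsPoissonRandomMeasure
    (fun ω => Measure.sum (fun k => Measure.dirac (x k ω))) m P) {f : E → ℝ≥0∞}
    (hf : Measurable f) : ∫⁻ ω, ∑' k, f (x k ω) ∂P = ∫⁻ y, f y ∂m := by
  have hbind : P.bind (fun ω => Measure.sum (fun k => Measure.dirac (x k ω))) = m := by
    rw [Measure.ext_iff_of_iUnion_eq_univ (iUnion_spanningSets m)]
    intro i
    ext A hA
    rw [Measure.restrict_apply hA, Measure.restrict_apply hA]
    have hA' := hA.inter (measurableSet_spanningSets m i)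
    rw [Measure.bind_apply hA' h.measurable.aemeasurable]
    refine lintegral_count h hA' (ne_top_of_le_ne_top (measure_spanningSets_lt_top m i).ne
      (measure_mono Set.inter_subset_right))
  conv_rhs => rw [← hbind]
  rw [Measure.lintegral_bind h.measurable.aemeasurable hf.aemeasurable]
  refine lintegral_congr fun ω => ?_
  rw [lintegral_sum_measure]
  simp_rw [lintegral_dirac' _ hf]

lemma norm_prod_sub_prod_le (n : ℕ) {a b : ℕ → ℂ} (ha : ∀ k, ‖a k‖ ≤ 1) (hb : ∀ k, ‖b k‖ ≤ 1) :
    ‖∏ k ∈ Finset.range n, a k - ∏ k ∈ Finset.range n, b k‖ ≤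
      ∑ k ∈ Finset.range n, ‖a k - b k‖ := by
  induction n with
  | zero => simp
  | succ n ih =>
    rw [Finset.prod_range_succ, Finset.prod_range_succ, Finset.sum_range_succ]
    have h1 : ‖∏ k ∈ Finset.range n, a k‖ ≤ 1 := by
      rw [norm_prod]
      exact Finset.prod_le_one (fun _ _ => norm_nonneg _) fun k _ => ha k
    calc _ = ‖(∏ k ∈ Finset.range n, a k) * (a n - b n) +
          (∏ k ∈ Finset.range n, a k - ∏ k ∈ Finset.range n, b k) * b n‖ := by ring_nf
      _ ≤ ‖∏ k ∈ Finset.range n, a k‖ * ‖a n - b n‖ +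
          ‖∏ k ∈ Finset.range n, a k - ∏ k ∈ Finset.range n, b k‖ * ‖b n‖ := by
          refine (norm_add_le _ _).trans ?_
          rw [norm_mul, norm_mul]
      _ ≤ 1 * ‖a n - b n‖ + (∑ k ∈ Finset.range n, ‖a k - b k‖) * 1 := by
          gcongr
          exact hb n
      _ = _ := by ring

/-- The probability generating functional of a Poisson random measure at a step function. -/
lemma tendsto_integral_prod_simpleFunc [IsProbabilityMeasure P] (hx : ∀ k, Measurable (x k))
    (h : IsPoissonRandomMeasure
    (fun ω => Measure.sum (fun k => Measure.dirac (x k ω))) m P) (U : SimpleFunc E ℂ)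
    (hU : Integrable U m) (hU1 : ∀ y, ‖1 + U y‖ ≤ 1) :
    Tendsto (fun n => ∫ ω, ∏ k ∈ Finset.range n, (1 + U (x k ω)) ∂P) atTop
      (𝓝 (Complex.exp (∫ y, U y ∂m))) := by
  classical
  set S : Finset ℂ := U.range.filter (· ≠ 0) with hS
  let e := S.equivFin
  let c : Fin S.card → ℂ := fun i => e.symm i
  have hc0 : ∀ i, c i ≠ 0 := fun i => (Finset.mem_filter.1 (e.symm i).2).2
  have hcr : ∀ i, c i ∈ U.range := fun i => (Finset.mem_filter.1 (e.symm i).2).1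
  have hc1 : ∀ i, ‖1 + c i‖ ≤ 1 := fun i => by
    obtain ⟨y, hy⟩ := SimpleFunc.mem_range.1 (hcr i)
    rw [← hy]; exact hU1 y
  have hcinj : Function.Injective c := Subtype.val_injective.comp e.symm.injective
  let A : Fin S.card → Set E := fun i => U ⁻¹' {c i}
  have hA : ∀ i, MeasurableSet (A i) := fun i => U.measurableSet_preimage _
  have hAm : ∀ i, m (A i) ≠ ∞ := fun i =>
    (SimpleFunc.measure_preimage_lt_top_of_integrable U hU (hc0 i)).ne
  have hAd : Pairwise fun i j => Disjoint (A i) (A j) := fun i j hij => by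
    refine Set.disjoint_left.2 fun y hi hj => ?_
    exact hij (hcinj (hi.symm.trans hj))
  have hprod : ∀ g : ℂ → ℂ, ∏ z ∈ S, g z = ∏ i, g (c i) := fun g => by
    rw [← Finset.prod_coe_sort S g]
    exact (Equiv.prod_comp e.symm fun z : S => g z).symm
  let M : Ω → Measure E := fun ω => Measure.sum (fun k => Measure.dirac (x k ω))
  -- the number of points in the level set `A i`
  let G : Fin S.card → ℝ≥0∞ → ℂ := fun i v => (1 + c i) ^ ⌊v.toReal⌋₊
  have hG : ∀ i, Measurable (G i) := fun i =>
    (Measurable.of_discrete (f := fun n : ℕ => (1 + c i) ^ n)).comp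
      (Nat.measurable_floor.comp ENNReal.measurable_toReal)
  have hind : iIndepFun (fun i ω => G i (M ω (A i))) P :=
    (h.indep_counts _ A hA hAd).comp G hG
  have hMm : ∀ i, Measurable fun ω => M ω (A i) := fun i =>
    (Measure.measurable_coe (hA i)).comp h.measurable
  have hE : ∀ i, ∫ ω, G i (M ω (A i)) ∂P = Complex.exp ((m (A i)).toReal * c i) := by
    intro i
    have h1 := (h.law_count (A i) (hA i) (hAm i)).integral_comp (f := G i)
      (hG i).aestronglyMeasurable
    refine h1.trans ?_
    rw [integral_map .of_discrete (hG i).aestronglyMeasurable]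
    have h2 := integral_pow_poissonMeasure (m (A i)).toNNReal (1 + c i)
    rw [add_sub_cancel_left] at h2
    refine Eq.trans ?_ h2
    refine integral_congr_ae (ae_of_all _ fun n => ?_)
    simp [G]
  have hval : ∫ ω, ∏ i, G i (M ω (A i)) ∂P = Complex.exp (∫ y, U y ∂m) := by
    rw [hind.integral_fun_prod_eq_prod_integral
      (fun i => ((hG i).comp (hMm i)).aestronglyMeasurable)]
    simp_rw [hE]
    rw [← Complex.exp_sum]
    congr 1
    have h3 : ∫ y, U y ∂m = ∑ z ∈ S, m.real (U ⁻¹' {z}) • z := by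
      rw [← SimpleFunc.integral_eq_integral U hU, SimpleFunc.integral_eq_sum_filter]
    rw [h3, ← Finset.sum_coe_sort S fun z => m.real (U ⁻¹' {z}) • z]
    refine Eq.trans ?_ (Equiv.sum_comp e.symm fun z : S => m.real (U ⁻¹' {(z : ℂ)}) • (z : ℂ))
    refine Finset.sum_congr rfl fun i _ => ?_
    rw [Complex.real_smul]
    rfl
  rw [← hval]
  refine tendsto_integral_of_dominated_convergence (fun _ => 1) ?_ (integrable_const _) ?_ ?_
  · intro n
    refine Measurable.aestronglyMeasurable ?_
    have := U.measurable
    fun_prop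
  · refine fun n => ae_of_all _ fun ω => ?_
    rw [norm_prod]
    exact Finset.prod_le_one (fun _ _ => norm_nonneg _) fun k _ => hU1 _
  · -- almost surely, only finitely many points lie in the support of `U`
    have hfin : ∀ᵐ ω ∂P, ∀ i, M ω (A i) < ∞ := by
      rw [ae_all_iff]
      intro i
      refine ae_lt_top (hMm i) ?_
      rw [lintegral_count h (hA i) (hAm i)]
      exact hAm i
    filter_upwards [hfin] with ω hω
    have hMA : ∀ i, M ω (A i) = ∑' k, (A i).indicator 1 (x k ω) := fun i => by
      simp only [M]
      rw [Measure.sum_apply _ (hA i)]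
      simp_rw [Measure.dirac_apply' _ (hA i)]
    have hFi : ∀ i, {k | x k ω ∈ A i}.Finite := fun i => by
      have h1 := ENNReal.finite_const_le_of_tsum_ne_top (hMA i ▸ (hω i).ne) one_ne_zero
      refine h1.subset fun k hk => ?_
      simp only [Set.mem_ofPred_eq] at hk ⊢
      simp [Set.indicator_of_mem hk]
    have hF : {k | U (x k ω) ≠ 0}.Finite := by
      refine (Set.finite_iUnion hFi).subset fun k hk => ?_
      have hz : U (x k ω) ∈ S := Finset.mem_filter.2 ⟨SimpleFunc.mem_range_self _ _, hk⟩
      refine Set.mem_iUnion.2 ⟨e ⟨_, hz⟩, ?_⟩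
      simp [A, c]
    obtain ⟨N, hN⟩ := hF.bddAbove
    refine tendsto_const_nhds.congr' ?_
    filter_upwards [eventually_gt_atTop N] with n hn
    have hcount : ∀ i, ⌊(M ω (A i)).toReal⌋₊ =
        ((Finset.range n).filter fun k => U (x k ω) = c i).card := by
      intro i
      rw [hMA, tsum_eq_sum (s := Finset.range n)]
      · have : ∑ k ∈ Finset.range n, (A i).indicator (1 : E → ℝ≥0∞) (x k ω) =
            (((Finset.range n).filter fun k => U (x k ω) = c i).card : ℝ≥0∞) := by
          rw [Finset.card_filter]
          push_cast
          refine Finset.sum_congr rfl fun k _ => ?_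
          simp [Set.indicator_apply, A]
        rw [this, ENNReal.toReal_natCast, Nat.floor_natCast]
      · intro k hk
        rw [Set.indicator_of_notMem]
        intro hk'
        have : U (x k ω) ≠ 0 := by
          have h5 : U (x k ω) = c i := hk'
          rw [h5]; exact hc0 i
        exact hk (Finset.mem_range.2 ((hN this).trans_lt hn))
    simp only [G]
    simp_rw [hcount]
    rw [← hprod fun z => (1 + z) ^ ((Finset.range n).filter fun k => U (x k ω) = z).card]
    have hfib := Finset.prod_fiberwise_of_maps_to
      (s := (Finset.range n).filter fun k => U (x k ω) ≠ 0) (t := S) (g := fun k => U (x k ω))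
      (fun k hk => Finset.mem_filter.2 ⟨SimpleFunc.mem_range_self _ _, (Finset.mem_filter.1 hk).2⟩)
      (fun k => 1 + U (x k ω))
    refine Eq.trans (Eq.trans ?_ hfib) ?_
    · refine Finset.prod_congr rfl fun z hz => ?_
      rw [Finset.prod_congr (s₂ := (Finset.range n).filter fun k => U (x k ω) = z)
        (g := fun _ => 1 + z), Finset.prod_const]
      · rw [Finset.filter_filter]
        refine Finset.filter_congr fun k _ => ?_
        constructor
        · exact fun h => h.2
        · exact fun h => ⟨h ▸ (Finset.mem_filter.1 hz).2, h⟩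
      · intro k hk
        rw [(Finset.mem_filter.1 hk).2]
    · refine Finset.prod_subset (Finset.filter_subset _ _) fun k hk hk' => ?_
      have : U (x k ω) = 0 := by
        by_contra h0
        exact hk' (Finset.mem_filter.2 ⟨hk, h0⟩)
      rw [this, add_zero]

/-- The **probability generating functional** of a Poisson random measure:
`E ∏ₖ (1 + U(xₖ)) = exp (∫ U dm)`. -/
theorem tendsto_integral_prod_poisson [IsProbabilityMeasure P] [SigmaFinite m]
    (hx : ∀ k, Measurable (x k)) (h : IsPoissonRandomMeasure
    (fun ω => Measure.sum (fun k => Measure.dirac (x k ω))) m P) {U : E → ℂ}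
    (hUm : Measurable U) (hU : Integrable U m) (hU1 : ∀ y, ‖1 + U y‖ ≤ 1) :
    Tendsto (fun n => ∫ ω, ∏ k ∈ Finset.range n, (1 + U (x k ω)) ∂P) atTop
      (𝓝 (Complex.exp (∫ y, U y ∂m))) := by
  let s : Set ℂ := {z | ‖1 + z‖ ≤ 1}
  have h0 : (0 : ℂ) ∈ s := by simp [s]
  let V : ℕ → SimpleFunc E ℂ := SimpleFunc.approxOn U hUm s 0 h0
  have hV1 : ∀ j y, ‖1 + V j y‖ ≤ 1 := fun j y => SimpleFunc.approxOn_mem hUm h0 j y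
  have hVi : ∀ j, Integrable (V j) m := fun j =>
    SimpleFunc.integrable_approxOn hUm hU h0 (integrable_zero _ _ _) j
  have hVlim : Tendsto (fun j => ∫⁻ y, ‖V j y - U y‖ₑ ∂m) atTop (𝓝 0) :=
    SimpleFunc.tendsto_approxOn_L1_enorm hUm h0
      (ae_of_all _ fun y => subset_closure (hU1 y)) (by simpa using hU.2)
  have hprodm : ∀ {W : E → ℂ}, Measurable W → (∀ y, ‖1 + W y‖ ≤ 1) → ∀ n,
      Integrable (fun ω => ∏ k ∈ Finset.range n, (1 + W (x k ω))) P := by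
    intro W hW hW1 n
    refine Integrable.of_bound (C := 1) ?_ (ae_of_all _ fun ω => ?_)
    · exact Measurable.aestronglyMeasurable (by fun_prop)
    · rw [norm_prod]
      exact Finset.prod_le_one (fun _ _ => norm_nonneg _) fun k _ => hW1 _
  have hdiff : ∀ j n, edist (∫ ω, ∏ k ∈ Finset.range n, (1 + V j (x k ω)) ∂P)
      (∫ ω, ∏ k ∈ Finset.range n, (1 + U (x k ω)) ∂P) ≤ ∫⁻ y, ‖V j y - U y‖ₑ ∂m := by
    intro j n
    rw [edist_eq_enorm_sub, ← integral_sub (hprodm (V j).measurable (hV1 j) n)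
      (hprodm hUm hU1 n)]
    refine (enorm_integral_le_lintegral_enorm _).trans ?_
    have hmeas : Measurable fun y => ‖V j y - U y‖ₑ := by
      have := (V j).measurable
      fun_prop
    rw [← lintegral_tsum_poisson h hmeas]
    refine lintegral_mono fun ω => ?_
    have h1 := norm_prod_sub_prod_le n (a := fun k => 1 + V j (x k ω))
      (b := fun k => 1 + U (x k ω)) (fun k => hV1 j _) (fun k => hU1 _)
    simp only [add_sub_add_left_eq_sub] at h1
    refine le_trans ?_ (ENNReal.sum_le_tsum (Finset.range n))
    rw [← ofReal_norm]
    refine (ENNReal.ofReal_le_ofReal h1).trans ?_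
    rw [ENNReal.ofReal_sum_of_nonneg fun _ _ => norm_nonneg _]
    simp_rw [ofReal_norm]
    exact le_rfl
  have hexp : Tendsto (fun j => Complex.exp (∫ y, V j y ∂m)) atTop
      (𝓝 (Complex.exp (∫ y, U y ∂m))) :=
    (Complex.continuous_exp.tendsto _).comp
      (tendsto_integral_of_L1 U hU.1 (Eventually.of_forall hVi) hVlim)
  have hunif : TendstoUniformly
      (fun j n => ∫ ω, ∏ k ∈ Finset.range n, (1 + V j (x k ω)) ∂P)
      (fun n => ∫ ω, ∏ k ∈ Finset.range n, (1 + U (x k ω)) ∂P) atTop := by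
    rw [EMetric.tendstoUniformly_iff]
    intro ε hε
    filter_upwards [hVlim.eventually (gt_mem_nhds hε)] with j hj n
    rw [edist_comm]
    exact (hdiff j n).trans_lt hj
  exact hunif.tendsto_of_eventually_tendsto
    (Eventually.of_forall fun j => tendsto_integral_prod_simpleFunc hx h (V j) (hVi j) (hV1 j)) hexp

end Campbell

/-! ### The path law of the stable Lévy process -/

section PathLaw

variable {Ω : Type*} [MeasurableSpace Ω] {P : Measure Ω} {α : ℝ}

lemma IsStandardStableLevy.measurable_path {X : ℝ≥0 → Ω → ℝ} (hX : IsStandardStableLevy α X P) :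
    Measurable fun ω t => X t ω :=
  measurable_pi_lambda _ hX.measurable

lemma IsStandardStableLevy.map_increment_eq [IsProbabilityMeasure P] {X Y : ℝ≥0 → Ω → ℝ}
    (hX : IsStandardStableLevy α X P) (hY : IsStandardStableLevy α Y P) {s t : ℝ≥0}
    (hst : s ≤ t) :
    P.map (fun ω => X t ω - X s ω) = P.map (fun ω => Y t ω - Y s ω) := by
  have hXm := (hX.measurable t).sub (hX.measurable s)
  have hYm := (hY.measurable t).sub (hY.measurable s)
  have := Measure.isProbabilityMeasure_map (μ := P) hXm.aemeasurable
  have := Measure.isProbabilityMeasure_map (μ := P) hYm.aemeasurable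
  refine Measure.ext_of_charFun (funext fun u => ?_)
  exact (hX.law_increment s t hst u).trans (hY.law_increment s t hst u).symm

/-- The law on path space of a standard symmetric stable Lévy process is unique. -/
lemma IsStandardStableLevy.map_path_eq [IsProbabilityMeasure P] {X Y : ℝ≥0 → Ω → ℝ}
    (hX : IsStandardStableLevy α X P) (hY : IsStandardStableLevy α Y P) :
    P.map (fun ω t => X t ω) = P.map (fun ω t => Y t ω) := by
  rw [map_eq_iff_forall_finset_map_restrict_eq hX.measurable_path.aemeasurable
    hY.measurable_path.aemeasurable]
  intro I
  let τ : Fin (I.card + 1) → ℝ≥0 := Fin.cons 0 (I.orderEmbOfFin rfl)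
  have hτ : Monotone τ := by
    intro i j hij
    induction i using Fin.cases with
    | zero => simp [τ]
    | succ i =>
      induction j using Fin.cases with
      | zero => simp at hij
      | succ j =>
        simp only [τ, Fin.cons_succ]
        exact (I.orderEmbOfFin rfl).monotone (by simpa using hij)
  let L : (Fin I.card → ℝ) → (I → ℝ) := fun v i =>
    ∑ j ∈ Finset.Iic ((I.orderIsoOfFin rfl).symm i), v j
  have hL : Measurable L := by fun_prop
  have key : ∀ {Z : ℝ≥0 → Ω → ℝ}, IsStandardStableLevy α Z P →
      P.map (fun ω => I.restrict (Z · ω)) = (Measure.pi fun i : Fin I.card =>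
        P.map (fun ω => Z (τ i.succ) ω - Z (τ i.castSucc) ω)).map L := by
    intro Z hZ
    have hinc : ∀ i : Fin I.card, Measurable fun ω => Z (τ i.succ) ω - Z (τ i.castSucc) ω :=
      fun i => (hZ.measurable _).sub (hZ.measurable _)
    rw [← (iIndepFun_iff_map_fun_eq_pi_map fun i => (hinc i).aemeasurable).1
      (hZ.indep_increments _ τ hτ), Measure.map_map hL (measurable_pi_lambda _ hinc)]
    refine Measure.map_congr ?_
    filter_upwards [hZ.start] with ω hω
    ext t
    simp only [L, Function.comp_apply, Finset.restrict]
    rw [Fin.sum_Iic_sub _ (fun j ↦ Z (τ j) ω)]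
    have h1 : τ ((I.orderIsoOfFin rfl).symm t).succ = t := by
      simp only [τ, Fin.cons_succ]
      rw [← Finset.coe_orderIsoOfFin_apply]
      simp
    have h2 : τ 0 = 0 := rfl
    rw [h1, h2, hω, sub_zero]
  rw [key hX, key hY]
  congr 2
  funext i
  exact hX.map_increment_eq hY (hτ (Fin.castSucc_le_succ i))

lemma IsStandardStableLevy.map_increment [IsProbabilityMeasure P] (hα : 0 < α)
    {X : ℝ≥0 → Ω → ℝ} (hX : IsStandardStableLevy α X P) {s t : ℝ≥0} (hst : s < t) :
    P.map (fun ω => X t ω - X s ω) = stableLaw α ((t : ℝ) - s) := by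
  have hXm := (hX.measurable t).sub (hX.measurable s)
  have := Measure.isProbabilityMeasure_map (μ := P) hXm.aemeasurable
  refine eq_stableLaw_of_charFun hα (sub_pos.2 (NNReal.coe_lt_coe.2 hst)) fun u => ?_
  exact hX.law_increment s t hst.le u

lemma IsStandardStableLevy.map_three [IsProbabilityMeasure P] (hα : 0 < α)
    {X : ℝ≥0 → Ω → ℝ} (hX : IsStandardStableLevy α X P) {t₁ t₂ t₃ t₄ : ℝ≥0} (h₁ : t₁ < t₂)
    (h₂ : t₂ < t₃) (h₃ : t₃ < t₄) :
    P.map (fun ω => ((X t₂ ω - X t₁ ω, X t₃ ω - X t₂ ω), X t₄ ω - X t₃ ω)) =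
      ((stableLaw α ((t₂ : ℝ) - t₁)).prod (stableLaw α ((t₃ : ℝ) - t₂))).prod
        (stableLaw α ((t₄ : ℝ) - t₃)) := by
  have hτ : Monotone (![t₁, t₂, t₃, t₄] : Fin 4 → ℝ≥0) := by
    rw [Fin.monotone_iff_le_succ]
    intro i
    fin_cases i
    · exact h₁.le
    · exact h₂.le
    · exact h₃.le
  have hind := hX.indep_increments 3 _ hτ
  have hm : ∀ i : Fin 3, Measurable fun ω => X ((![t₁, t₂, t₃, t₄] : Fin 4 → ℝ≥0) i.succ) ω -
      X ((![t₁, t₂, t₃, t₄] : Fin 4 → ℝ≥0) i.castSucc) ω := fun i =>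
    (hX.measurable _).sub (hX.measurable _)
  have h01 : IndepFun (fun ω => X t₂ ω - X t₁ ω) (fun ω => X t₃ ω - X t₂ ω) P :=
    hind.indepFun (i := 0) (j := 1) (by decide)
  have h012 : IndepFun (fun ω => (X t₂ ω - X t₁ ω, X t₃ ω - X t₂ ω))
      (fun ω => X t₄ ω - X t₃ ω) P :=
    hind.indepFun_prodMk hm 0 1 2 (by decide) (by decide)
  have m1 : Measurable fun ω => X t₂ ω - X t₁ ω := (hX.measurable t₂).sub (hX.measurable t₁)
  have m2 : Measurable fun ω => X t₃ ω - X t₂ ω := (hX.measurable t₃).sub (hX.measurable t₂)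
  have m3 : Measurable fun ω => X t₄ ω - X t₃ ω := (hX.measurable t₄).sub (hX.measurable t₃)
  rw [(indepFun_iff_map_prod_eq_prod_map_map (m1.prodMk m2).aemeasurable m3.aemeasurable).1 h012,
    (indepFun_iff_map_prod_eq_prod_map_map m1.aemeasurable m2.aemeasurable).1 h01,
    hX.map_increment hα h₁, hX.map_increment hα h₂, hX.map_increment hα h₃]

end PathLaw

/-- The value at time `s` of the path `w`, read off as a limit along the dyadic times to the right
of `s`. It is jointly measurable in `(s, w)` for the product `σ`-algebra on paths, and equals `w s`
when `w` is right-continuous. -/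
def evalRight (s : ℝ) (w : ℝ≥0 → ℝ) : ℝ :=
  limsup (fun n : ℕ => w ((⌊s.toNNReal * 2 ^ n⌋₊ + 1 : ℕ) / 2 ^ n)) atTop

lemma measurable_evalRight : Measurable fun p : ℝ × (ℝ≥0 → ℝ) => evalRight p.1 p.2 := by
  unfold evalRight
  refine Measurable.limsup fun n => ?_
  have h1 : Measurable fun q : ℕ × (ℝ≥0 → ℝ) => q.2 ((q.1 + 1 : ℕ) / 2 ^ n) :=
    measurable_from_prod_countable_right fun k =>
      show Measurable fun y : ℝ≥0 → ℝ => y ((k + 1 : ℕ) / 2 ^ n) from measurable_pi_apply _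
  have h2 : Measurable fun p : ℝ × (ℝ≥0 → ℝ) => (⌊p.1.toNNReal * 2 ^ n⌋₊, p.2) := by
    refine Measurable.prodMk ?_ measurable_snd
    exact Nat.measurable_floor.comp (measurable_fst.real_toNNReal.mul_const _)
  exact h1.comp h2

lemma evalRight_eq {w : ℝ≥0 → ℝ} (hw : IsCadlagPath w) (s : ℝ) :
    evalRight s w = w s.toNNReal := by
  unfold evalRight
  refine Tendsto.limsup_eq ?_
  refine (hw s.toNNReal).1.tendsto.comp (tendsto_nhdsWithin_iff.2 ⟨?_, ?_⟩)
  · have h1 : ∀ n : ℕ, dist ((⌊s.toNNReal * 2 ^ n⌋₊ + 1 : ℕ) / 2 ^ n : ℝ≥0) s.toNNReal ≤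
        (1 / 2) ^ n := by
      intro n
      have h2 := dyadicFloor_le n s.toNNReal
      have h3 := lt_dyadicFloor_add n s.toNNReal
      have h4 : ((⌊s.toNNReal * 2 ^ n⌋₊ + 1 : ℕ) / 2 ^ n : ℝ≥0) =
          dyadicFloor n s.toNNReal + (1 / 2) ^ n := by
        rw [dyadicFloor, one_div_pow]; push_cast; rw [add_div]
      rw [h4, NNReal.dist_eq, abs_le]
      rw [← NNReal.coe_le_coe] at h2
      rw [← NNReal.coe_lt_coe] at h3
      push_cast at h3 ⊢
      constructor <;> linarith
    exact tendsto_iff_dist_tendsto_zero.2 (squeeze_zero (fun _ => dist_nonneg) h1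
      (tendsto_pow_atTop_nhds_zero_of_lt_one (by norm_num) (by norm_num)))
  · refine Eventually.of_forall fun n => ?_
    rw [Set.mem_Ici, le_div_iff₀ (by positivity)]
    push_cast
    exact (Nat.lt_floor_add_one _).le

/-- A jointly measurable process `Z` on `[0, ∞)` with independent increments, the increment over
`[s, t]` having law `stableLaw α (t - s)`. Recorded are the laws of single increments, the joint
laws of three consecutive ones, and the nonnegativity of the densities, without which `stableLaw` would
not have `stableDensity` as its density. -/
structure HasStableIncrements {W : Type*} [MeasurableSpace W] (α : ℝ) (Z : ℝ → W → ℝ)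
    (Q : Measure W) : Prop where
  measurable : Measurable fun p : ℝ × W => Z p.1 p.2
  law_sub : ∀ s t : ℝ, 0 ≤ s → s < t → Q.map (fun w => Z t w - Z s w) = stableLaw α (t - s)
  density_nonneg : ∀ r : ℝ, 0 < r → ∀ y, 0 ≤ stableDensity α r y
  law_three : ∀ s₁ s₂ s₃ s₄ : ℝ, 0 ≤ s₁ → s₁ < s₂ → s₂ < s₃ → s₃ < s₄ →
    Q.map (fun w => ((Z s₂ w - Z s₁ w, Z s₃ w - Z s₂ w), Z s₄ w - Z s₃ w)) =
      ((stableLaw α (s₂ - s₁)).prod (stableLaw α (s₃ - s₂))).prod (stableLaw α (s₄ - s₃))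

lemma HasStableIncrements.measurable_left {W : Type*} [MeasurableSpace W] {α : ℝ}
    {Z : ℝ → W → ℝ} {Q : Measure W} (hZ : HasStableIncrements α Z Q) (s : ℝ) :
    Measurable (Z s) :=
  hZ.measurable.comp measurable_prodMk_left

/-- Under the path law of a stable Lévy process, `evalRight` has stable increments. -/
lemma IsStandardStableLevy.hasStableIncrements {Ω : Type*} [MeasurableSpace Ω] {P : Measure Ω}
    [IsProbabilityMeasure P] {α : ℝ} (hα : 0 < α) {X : ℝ≥0 → Ω → ℝ}
    (hX : IsStandardStableLevy α X P) :
    HasStableIncrements α evalRight (P.map fun ω t => X t ω) := by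
  have hev : ∀ᵐ ω ∂P, ∀ s : ℝ, evalRight s (fun t => X t ω) = X s.toNNReal ω := by
    filter_upwards [hX.cadlag] with ω hω s using evalRight_eq hω s
  have hm : ∀ s, Measurable (evalRight s) := fun s =>
    Measurable.of_uncurry_left (f := evalRight) measurable_evalRight
  have hlaw : ∀ s t : ℝ, 0 ≤ s → s < t →
      P.map (fun ω => X t.toNNReal ω - X s.toNNReal ω) = stableLaw α (t - s) := by
    intro s t hs hst
    rw [hX.map_increment hα ((Real.toNNReal_lt_toNNReal_iff_of_nonneg hs).2 hst),
      Real.coe_toNNReal _ hs, Real.coe_toNNReal _ (hs.trans hst.le)]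
  have hm2 : ∀ s t, Measurable fun w => evalRight t w - evalRight s w := fun s t =>
    (hm t).sub (hm s)
  refine ⟨measurable_evalRight, fun s t hs hst => ?_, fun r hr => ?_, fun s₁ s₂ s₃ s₄ h1 h2 h3 h4 => ?_⟩
  · rw [Measure.map_map (hm2 s t) hX.measurable_path, ← hlaw s t hs hst]
    refine Measure.map_congr ?_
    filter_upwards [hev] with ω hω
    simp only [Function.comp_apply, hω]
  · have hXm := (hX.measurable r.toNNReal).sub (hX.measurable 0)
    have := Measure.isProbabilityMeasure_map (μ := P) hXm.aemeasurable
    refine stableDensity_nonneg_of_charFun hα hr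
      (μ := P.map fun ω => X r.toNNReal ω - X 0 ω) fun u => ?_
    rw [hX.law_increment 0 r.toNNReal zero_le u, Real.coe_toNNReal _ hr.le, NNReal.coe_zero,
      sub_zero]
  · have hm4 : Measurable fun w => ((evalRight s₂ w - evalRight s₁ w,
        evalRight s₃ w - evalRight s₂ w), evalRight s₄ w - evalRight s₃ w) :=
      ((hm2 s₁ s₂).prodMk (hm2 s₂ s₃)).prodMk (hm2 s₃ s₄)
    have h01 := hX.map_three hα ((Real.toNNReal_lt_toNNReal_iff_of_nonneg h1).2 h2)
      ((Real.toNNReal_lt_toNNReal_iff_of_nonneg (h1.trans h2.le)).2 h3)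
      ((Real.toNNReal_lt_toNNReal_iff_of_nonneg (h1.trans (h2.le.trans h3.le))).2 h4)
    rw [Real.coe_toNNReal _ h1, Real.coe_toNNReal _ (h1.trans h2.le),
      Real.coe_toNNReal _ (h1.trans (h2.le.trans h3.le)),
      Real.coe_toNNReal _ (h1.trans (h2.le.trans (h3.le.trans h4.le)))] at h01
    rw [Measure.map_map hm4 hX.measurable_path, ← h01]
    refine Measure.map_congr ?_
    filter_upwards [hev] with ω hω
    simp only [Function.comp_apply, hω]

/-! ### Odd test functions and the stable semigroup -/

/-- Bounded integrable odd functions with a first absolute moment. -/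
structure IsOddTest (φ : ℝ → ℝ) : Prop where
  measurable : Measurable φ
  bounded : ∃ B, ∀ x, |φ x| ≤ B
  integrable : Integrable φ
  integrable_mul : Integrable fun x => x * φ x
  odd : ∀ x, φ (-x) = -φ x

lemma IsOddTest.integral_eq_zero {φ : ℝ → ℝ} (hφ : IsOddTest φ) : ∫ x, φ x = 0 := by
  have h := integral_neg_eq_self φ (volume : Measure ℝ)
  simp only [hφ.odd, integral_neg] at h
  linarith

lemma isOddTest_sum {n : ℕ} {ψ : Fin n → ℝ → ℝ} (hψ : ∀ i, IsOddTest (ψ i)) (a : Fin n → ℝ) :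
    IsOddTest fun x => ∑ i, a i * ψ i x := by
  choose B hB using fun i => (hψ i).bounded
  refine ⟨Finset.measurable_sum _ fun i _ => (hψ i).measurable.const_mul _, ⟨∑ i, |a i| * B i,
    fun x => (Finset.abs_sum_le_sum_abs _ _).trans (Finset.sum_le_sum fun i _ => ?_)⟩,
    integrable_finsetSum _ fun i _ => (hψ i).integrable.const_mul _, ?_, fun x => ?_⟩
  · rw [abs_mul]
    exact mul_le_mul_of_nonneg_left (hB i x) (abs_nonneg _)
  · have : (fun x => x * ∑ i, a i * ψ i x) = fun x => ∑ i, a i * (x * ψ i x) := by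
      ext x
      rw [Finset.mul_sum]
      exact Finset.sum_congr rfl fun i _ => by ring
    rw [this]
    exact integrable_finsetSum _ fun i _ => (hψ i).integrable_mul.const_mul _
  · simp only [(hψ _).odd, mul_neg, Finset.sum_neg_distrib]

lemma integrable_indicator_Icc_one (a b : ℝ) :
    Integrable ((Set.Icc a b).indicator (1 : ℝ → ℝ)) :=
  (integrable_indicator_iff measurableSet_Icc).2
    ((integrableOn_const_iff).2 (Or.inr (by simp)))

lemma isOddTest_oddStep (t : ℝ≥0) : IsOddTest (oddStep t) := by
  have hm : Measurable (oddStep t) :=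
    (measurable_one.indicator measurableSet_Icc).sub (measurable_one.indicator measurableSet_Icc)
  have hb : ∀ x, |oddStep t x| ≤ (Set.Icc (-(t : ℝ)) t).indicator 1 x := by
    intro x
    have ht := t.2
    simp only [oddStep, Set.indicator_apply, Set.mem_Icc, Pi.one_apply]
    split_ifs with h1 h2 h3 h4 h5 h6 h7 <;> norm_num <;>
      first
      | exact absurd ⟨by linarith [h1.1], h1.2⟩ ‹¬(-(t : ℝ) ≤ x ∧ x ≤ t)›
      | exact absurd ⟨h5.1, by linarith [h5.2]⟩ ‹¬(-(t : ℝ) ≤ x ∧ x ≤ t)›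
  have hi : Integrable (oddStep t) :=
    (integrable_indicator_Icc_one _ _).mono' hm.aestronglyMeasurable (.of_forall hb)
  refine ⟨hm, ⟨1, fun x => (hb x).trans ?_⟩, hi, ?_, fun x => ?_⟩
  · exact Set.indicator_le_self' (by simp) _ |>.trans (by simp)
  · refine ((integrable_indicator_Icc_one (-(t : ℝ)) t).const_mul (t : ℝ)).mono'
      (measurable_id.mul hm).aestronglyMeasurable (.of_forall fun x => ?_)
    rw [Real.norm_eq_abs, abs_mul]
    by_cases hx : x ∈ Set.Icc (-(t : ℝ)) t
    · exact mul_le_mul (abs_le.2 hx) (hb x) (abs_nonneg _) t.2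
    · have := hb x
      rw [Set.indicator_of_notMem hx] at this ⊢
      rw [abs_nonpos_iff.1 this]; simp
  · have h1 : (-x ∈ Set.Icc (0 : ℝ) t) ↔ x ∈ Set.Icc (-(t : ℝ)) 0 := by
      simp only [Set.mem_Icc]; constructor <;> rintro ⟨h, h'⟩ <;> constructor <;> linarith
    have h2 : (-x ∈ Set.Icc (-(t : ℝ)) 0) ↔ x ∈ Set.Icc (0 : ℝ) t := by
      simp only [Set.mem_Icc]; constructor <;> rintro ⟨h, h'⟩ <;> constructor <;> linarith
    simp only [oddStep, Set.indicator_apply, h1, h2, Pi.one_apply]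
    ring

lemma integrable_shear {Y : Type*} [MeasurableSpace Y] {ν : Measure Y} [IsFiniteMeasure ν]
    {z : Y → ℝ} (hz : Measurable z) {φ : ℝ → ℝ} (hφ : Integrable φ) :
    Integrable (fun p : Y × ℝ => φ (p.2 + z p.1)) (ν.prod volume) := by
  have h : MeasurePreserving (fun p : Y × ℝ => (p.1, p.2 + z p.1)) (ν.prod volume)
      (ν.prod volume) :=
    (MeasurePreserving.id ν).skew_product (g := fun y x => x + z y)
      (measurable_snd.add (hz.comp measurable_fst))
      (.of_forall fun y => (measurePreserving_add_right volume (z y)).map_eq)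
  exact h.integrable_comp_of_integrable (g := fun p : Y × ℝ => φ p.2) (hφ.comp_snd ν)

lemma rpow_neg_le_of_bounds {r γ δ a b : ℝ} (hr : 0 < r) (hγ : 0 ≤ γ) (hγδ : γ ≤ δ)
    (ha : 0 ≤ a) (hb : 0 ≤ b) {v : ℝ} (h1 : v ≤ a) (h2 : v ≤ b * r ^ (-δ)) :
    v ≤ (a + b) * r ^ (-γ) := by
  rcases le_total r 1 with h | h
  · have : 1 ≤ r ^ (-γ) := Real.one_le_rpow_of_pos_of_le_one_of_nonpos hr h (by linarith)
    nlinarith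
  · have : r ^ (-δ) ≤ r ^ (-γ) := Real.rpow_le_rpow_of_exponent_le h (by linarith)
    have h3 : 0 ≤ r ^ (-γ) := by positivity
    nlinarith [mul_le_mul_of_nonneg_left this hb, mul_nonneg ha h3]

section Semigroup

variable {W : Type*} [MeasurableSpace W] {Q : Measure W} {α : ℝ}
  {Z : ℝ → W → ℝ}

lemma HasStableIncrements.integral_stableLaw (hα : 0 < α) (hZ : HasStableIncrements α Z Q)
    {r : ℝ} (hr : 0 < r) (g : ℝ → ℝ) :
    ∫ y, g y ∂stableLaw α r = ∫ y, stableDensity α r y * g y := by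
  rw [stableLaw, integral_withDensity_eq_integral_toReal_smul
    (continuous_stableDensity hα hr).measurable.ennreal_ofReal
    (.of_forall fun _ => ENNReal.ofReal_lt_top)]
  simp only [ENNReal.toReal_ofReal (hZ.density_nonneg r hr _), smul_eq_mul]

variable [IsProbabilityMeasure Q]

lemma HasStableIncrements.isProbabilityMeasure_stableLaw (hZ : HasStableIncrements α Z Q)
    {r : ℝ} (hr : 0 < r) : IsProbabilityMeasure (stableLaw α r) := by
  have h := hZ.law_sub 0 r le_rfl hr
  rw [sub_zero] at h
  rw [← h]
  exact Measure.isProbabilityMeasure_map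
    ((hZ.measurable_left r).sub (hZ.measurable_left 0)).aemeasurable

/-- For large `r`, oddness makes the stable semigroup decay at rate `r ^ (-2 / α)`; for small `r`,
boundedness of `φ` suffices. Any exponent in `(3 / 4, 1)` could replace `7 / 8`: above `3 / 4` the
fourth moment of the occupation time is `o(T ^ 2)`, below `1` the bound is integrable at `0`. -/
lemma HasStableIncrements.abs_integral_add_le (hα : 1 < α) (hα₂ : α ≤ 2)
    (hZ : HasStableIncrements α Z Q) {φ : ℝ → ℝ} (hφ : IsOddTest φ) :
    ∃ C, 0 ≤ C ∧ ∀ r, 0 < r → ∀ x, |∫ y, φ (x + y) ∂stableLaw α r| ≤ C * r ^ (-(7 / 8) : ℝ) := by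
  have hα0 : 0 < α := by linarith
  obtain ⟨B, hB⟩ := hφ.bounded
  have hB0 : 0 ≤ B := (abs_nonneg _).trans (hB 0)
  obtain ⟨C, hC0, hC⟩ := abs_stableDensity_sub_le hα0
  have hI0 : 0 ≤ ∫ z, |z * φ z| := integral_nonneg fun _ => abs_nonneg _
  refine ⟨B + C * ∫ z, |z * φ z|, by positivity, fun r hr x => ?_⟩
  refine rpow_neg_le_of_bounds (δ := 2 / α) hr (by norm_num) ?_ hB0 (by positivity) ?_ ?_
  · rw [le_div_iff₀ hα0]; linarith
  · have := hZ.isProbabilityMeasure_stableLaw hr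
    have h := norm_integral_le_of_norm_le_const (μ := stableLaw α r)
      (f := fun y => φ (x + y)) (C := B) (.of_forall fun y => hB (x + y))
    simpa using h
  · have h1 : ∫ y, φ (x + y) ∂stableLaw α r =
        ∫ z, (stableDensity α r (z - x) - stableDensity α r (-x)) * φ z := by
      obtain ⟨D, -, hD⟩ := abs_stableDensity_le hα0
      have hi : Integrable fun z => stableDensity α r (z - x) * φ z :=
        hφ.integrable.bdd_mul (c := D * r ^ (-1 / α))
          ((continuous_stableDensity hα0 hr).comp
            (continuous_sub_right x)).aestronglyMeasurable (.of_forall fun z => hD r hr _)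
      simp only [sub_mul]
      rw [hZ.integral_stableLaw hα0 hr, integral_sub hi (hφ.integrable.const_mul _),
        integral_const_mul, hφ.integral_eq_zero, mul_zero, sub_zero,
        ← integral_add_left_eq_self (fun z => stableDensity α r (z - x) * φ z) x]
      simp only [add_sub_cancel_left]
    rw [h1]
    calc |∫ z, (stableDensity α r (z - x) - stableDensity α r (-x)) * φ z|
        ≤ ∫ z, C * r ^ (-2 / α) * |z * φ z| := by
          refine norm_integral_le_of_norm_le (G := ℝ) (hφ.integrable_mul.abs.const_mul _)
            (.of_forall fun z => ?_)
          rw [norm_mul, abs_mul, ← mul_assoc]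
          refine mul_le_mul_of_nonneg_right ?_ (norm_nonneg _)
          have := hC r hr (z - x) (-x)
          rwa [show z - x - -x = z by ring] at this
      _ = C * (∫ z, |z * φ z|) * r ^ (-(2 / α)) := by
          rw [integral_const_mul, neg_div]; ring

lemma HasStableIncrements.integral_abs_add_le (hα : 1 < α) (hα₂ : α ≤ 2)
    (hZ : HasStableIncrements α Z Q) {φ : ℝ → ℝ} (hφ : IsOddTest φ) :
    ∃ C, 0 ≤ C ∧ ∀ r, 0 < r → ∀ x, ∫ y, |φ (x + y)| ∂stableLaw α r ≤ C * r ^ (-(1 / 2) : ℝ) := by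
  have hα0 : 0 < α := by linarith
  obtain ⟨B, hB⟩ := hφ.bounded
  have hB0 : 0 ≤ B := (abs_nonneg _).trans (hB 0)
  obtain ⟨C, hC0, hC⟩ := abs_stableDensity_le hα0
  have hI0 : 0 ≤ ∫ z, |φ z| := integral_nonneg fun _ => abs_nonneg _
  refine ⟨B + C * ∫ z, |φ z|, by positivity, fun r hr x => ?_⟩
  refine rpow_neg_le_of_bounds (δ := 1 / α) hr (by norm_num) ?_ hB0 (by positivity) ?_ ?_
  · rw [le_div_iff₀ hα0]; linarith
  · have := hZ.isProbabilityMeasure_stableLaw hr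
    have h := norm_integral_le_of_norm_le_const (μ := stableLaw α r) (f := fun y => |φ (x + y)|)
      (C := B) (.of_forall fun y => by simpa using hB (x + y))
    exact (le_abs_self _).trans (by simpa using h)
  · rw [hZ.integral_stableLaw hα0 hr]
    have hi : Integrable fun y => |φ (x + y)| := (hφ.integrable.comp_add_left x).abs
    calc ∫ y, stableDensity α r y * |φ (x + y)|
        ≤ ∫ y, C * r ^ (-1 / α) * |φ (x + y)| := by
          refine integral_mono_of_nonneg (.of_forall fun y =>
            mul_nonneg (hZ.density_nonneg r hr y) (abs_nonneg _)) (hi.const_mul _)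
            (.of_forall fun y => ?_)
          exact mul_le_mul_of_nonneg_right ((le_abs_self _).trans (hC r hr y)) (abs_nonneg _)
      _ = C * (∫ z, |φ z|) * r ^ (-(1 / α)) := by
          rw [integral_const_mul, neg_div, integral_add_left_eq_self fun z => |φ z|]; ring

end Semigroup

/-! ### Correlations of the particle field -/

/-- The sine transform of `φ`; for odd `φ` it carries the whole Fourier transform. -/
def sinTransform (φ : ℝ → ℝ) (u : ℝ) : ℝ := ∫ x, φ x * Real.sin (u * x)

lemma IsOddTest.integral_mul_cos {φ : ℝ → ℝ} (hφ : IsOddTest φ) (u : ℝ) :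
    ∫ x, φ x * Real.cos (u * x) = 0 := by
  have h := integral_neg_eq_self (fun x => φ x * Real.cos (u * x)) (volume : Measure ℝ)
  simp only [hφ.odd, mul_neg, Real.cos_neg, neg_mul, integral_neg] at h
  linarith

lemma IsOddTest.integrable_mul_bdd {φ : ℝ → ℝ} (hφ : IsOddTest φ) {g : ℝ → ℝ} (hg : Continuous g)
    (hg1 : ∀ x, |g x| ≤ 1) : Integrable fun x => φ x * g x :=
  hφ.integrable.mul_bdd (c := 1) hg.aestronglyMeasurable (.of_forall hg1)

lemma measurable_sinTransform {φ : ℝ → ℝ} (hφ : Measurable φ) : Measurable (sinTransform φ) := by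
  have : Measurable fun p : ℝ × ℝ => φ p.2 * Real.sin (p.1 * p.2) := by fun_prop
  exact (this.stronglyMeasurable.integral_prod_right (ν := volume)).measurable

lemma integrable_mul_comp_add {φ : ℝ → ℝ} (hφ : Integrable φ) :
    Integrable (fun p : ℝ × ℝ => φ p.1 * φ (p.1 + p.2)) (volume.prod volume) :=
  (measurePreserving_prod_add (volume : Measure ℝ) (volume : Measure ℝ)).integrable_comp_of_integrable
    (g := fun q : ℝ × ℝ => φ q.1 * φ q.2) (hφ.mul_prod hφ)

lemma IsOddTest.integral_cos_mul_comp_add {φ : ℝ → ℝ} (hφ : IsOddTest φ) (u : ℝ) :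
    ∫ p : ℝ × ℝ, Real.cos (u * p.2) * (φ p.1 * φ (p.1 + p.2)) ∂(volume.prod volume) =
      sinTransform φ u ^ 2 := by
  have hc : Continuous fun z => Real.cos (u * z) := by fun_prop
  have hs : Continuous fun z => Real.sin (u * z) := by fun_prop
  have hci := hφ.integrable_mul_bdd hc fun _ => Real.abs_cos_le_one _
  have hsi := hφ.integrable_mul_bdd hs fun _ => Real.abs_sin_le_one _
  rw [integral_prod]
  · have h1 : ∀ x, ∫ y, Real.cos (u * y) * (φ x * φ (x + y)) =
        (φ x * Real.sin (u * x)) * sinTransform φ u := by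
      intro x
      have h2 : (fun y => Real.cos (u * y) * (φ x * φ (x + y))) = fun y =>
          (fun z => φ x * Real.cos (u * x) * (φ z * Real.cos (u * z)) +
            φ x * Real.sin (u * x) * (φ z * Real.sin (u * z))) (x + y) := by
        ext y
        have : Real.cos (u * y) = Real.cos (u * (x + y) - u * x) := by ring_nf
        rw [this, Real.cos_sub]
        ring
      rw [h2, integral_add_left_eq_self (fun z => φ x * Real.cos (u * x) *
        (φ z * Real.cos (u * z)) + φ x * Real.sin (u * x) * (φ z * Real.sin (u * z))),
        integral_add (hci.const_mul _) (hsi.const_mul _),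
        integral_const_mul, integral_const_mul, hφ.integral_mul_cos, mul_zero, zero_add,
        sinTransform]
    simp only [h1]
    rw [integral_mul_const, sinTransform, sq]
  · exact (integrable_mul_comp_add hφ.integrable).bdd_mul (c := 1)
      (by fun_prop) (.of_forall fun p => Real.abs_cos_le_one _)

section Correlation

variable {W : Type*} [MeasurableSpace W] {Q : Measure W} {α : ℝ} {Z : ℝ → W → ℝ}

/-- The value of the field `φ (x + Z s)` carried by one particle started at `x`. -/
def particleField (φ : ℝ → ℝ) (Z : ℝ → W → ℝ) (s : ℝ) (p : W × ℝ) : ℝ := φ (p.2 + Z s p.1)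

lemma measurable_particleField (hZ : HasStableIncrements α Z Q) {φ : ℝ → ℝ} (hφ : Measurable φ) :
    Measurable fun q : (W × ℝ) × ℝ => particleField φ Z q.2 q.1 := by
  have h := hZ.measurable.comp
    (measurable_snd.prodMk (measurable_fst.comp measurable_fst) :
      Measurable fun q : (W × ℝ) × ℝ => (q.2, q.1.1))
  exact hφ.comp ((measurable_snd.comp measurable_fst).add h)

lemma measurable_particleField_left (hZ : HasStableIncrements α Z Q) {φ : ℝ → ℝ}
    (hφ : Measurable φ) (s : ℝ) : Measurable (particleField φ Z s) :=
  (measurable_particleField hZ hφ).comp measurable_prodMk_right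

variable [IsProbabilityMeasure Q]

lemma integrable_particleField (hZ : HasStableIncrements α Z Q) {φ : ℝ → ℝ} (hφ : Integrable φ)
    (s : ℝ) : Integrable (particleField φ Z s) (Q.prod volume) :=
  integrable_shear (hZ.measurable_left s) hφ

lemma integral_particleField (hZ : HasStableIncrements α Z Q) {φ : ℝ → ℝ} (hφ : IsOddTest φ)
    (s : ℝ) : ∫ p, particleField φ Z s p ∂(Q.prod volume) = 0 := by
  rw [integral_prod _ (integrable_particleField hZ hφ.integrable s)]
  simp only [particleField, integral_add_right_eq_self φ, hφ.integral_eq_zero, integral_zero]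

lemma integral_particleField_mul (hα : 0 < α) (hZ : HasStableIncrements α Z Q) {φ : ℝ → ℝ}
    (hφ : IsOddTest φ) {s t : ℝ} (hs : 0 ≤ s) (hst : s < t) :
    ∫ p, particleField φ Z s p * particleField φ Z t p ∂(Q.prod volume) =
      (2 * Real.pi)⁻¹ * ∫ u, sinTransform φ u ^ 2 * Real.exp (-(t - s) * |u| ^ α) := by
  obtain ⟨B, hB⟩ := hφ.bounded
  have hr : 0 < t - s := sub_pos.2 hst
  have hDm : Measurable fun w => Z t w - Z s w := (hZ.measurable_left t).sub (hZ.measurable_left s)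
  have hφm := hφ.measurable
  have hpm : Measurable fun y : ℝ × ℝ => φ y.2 * φ (y.2 + y.1) := by fun_prop
  have hGm : StronglyMeasurable fun y => ∫ x, φ x * φ (x + y) :=
    hpm.stronglyMeasurable.integral_prod_right (ν := volume)
  have h1 : ∫ p, particleField φ Z s p * particleField φ Z t p ∂(Q.prod volume) =
      ∫ y, (∫ x, φ x * φ (x + y)) ∂stableLaw α (t - s) := by
    rw [integral_prod _ ((integrable_particleField hZ hφ.integrable s).mul_bdd (c := B)
      (measurable_particleField_left hZ hφm t).aestronglyMeasurable (.of_forall fun p => hB _)),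
      ← hZ.law_sub s t hs hst, integral_map hDm.aemeasurable hGm.aestronglyMeasurable]
    refine integral_congr_ae (.of_forall fun w => ?_)
    simp only [particleField]
    -- translating the starting point by `Z s w` leaves only the increment
    rw [← integral_add_right_eq_self (fun x => φ x * φ (x + (Z t w - Z s w))) (Z s w)]
    simp only [add_assoc, add_sub_cancel]
  have hF : Integrable (fun q : ℝ × ℝ × ℝ => Real.cos (q.1 * q.2.2) *
      (Real.exp (-(t - s) * |q.1| ^ α) * (φ q.2.1 * φ (q.2.1 + q.2.2))))
      (volume.prod (volume.prod volume)) :=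
    ((integrable_exp_abs_rpow hα hr).mul_prod (integrable_mul_comp_add hφ.integrable)).bdd_mul
      (c := 1) (by fun_prop) (.of_forall fun p => Real.abs_cos_le_one _)
  have h2 := integral_integral_swap (f := fun (u : ℝ) (p : ℝ × ℝ) => Real.cos (u * p.2) *
      (Real.exp (-(t - s) * |u| ^ α) * (φ p.1 * φ (p.1 + p.2)))) hF
  have h3 : ∀ u, ∫ p : ℝ × ℝ, Real.cos (u * p.2) *
      (Real.exp (-(t - s) * |u| ^ α) * (φ p.1 * φ (p.1 + p.2))) ∂(volume.prod volume) =
      sinTransform φ u ^ 2 * Real.exp (-(t - s) * |u| ^ α) := by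
    intro u
    rw [← hφ.integral_cos_mul_comp_add, ← integral_mul_const]
    exact integral_congr_ae (.of_forall fun p => by ring)
  have h4 : ∀ p : ℝ × ℝ, ∫ u, Real.cos (u * p.2) *
      (Real.exp (-(t - s) * |u| ^ α) * (φ p.1 * φ (p.1 + p.2))) =
      (2 * Real.pi) * (stableDensity α (t - s) p.2 * (φ p.1 * φ (p.1 + p.2))) := by
    intro p
    rw [stableDensity, mul_assoc (2 * Real.pi)⁻¹,
      mul_inv_cancel_left₀ (a := 2 * Real.pi) (by positivity), ← integral_mul_const]
    exact integral_congr_ae (.of_forall fun u => by ring)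
  simp only [h3, h4] at h2
  obtain ⟨D, -, hD⟩ := abs_stableDensity_le hα
  rw [h1, h2, integral_const_mul, inv_mul_cancel_left₀ (by positivity),
    hZ.integral_stableLaw hα hr, integral_prod_symm]
  · simp only [integral_const_mul]
  · exact (integrable_mul_comp_add hφ.integrable).bdd_mul (c := D * (t - s) ^ (-1 / α))
      ((continuous_stableDensity hα hr).comp continuous_snd).aestronglyMeasurable
      (.of_forall fun p => hD _ hr _)

/-- The fourth order correlations. In the first and in the last gap, integrating out the increment
averages `φ` alone, so that its oddness improves the decay there. -/
lemma exists_abs_integral_particleField_mul4_le (hα : 1 < α) (hα₂ : α ≤ 2)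
    (hZ : HasStableIncrements α Z Q) {φ : ℝ → ℝ} (hφ : IsOddTest φ) :
    ∃ C, 0 ≤ C ∧ ∀ s₁ s₂ s₃ s₄, 0 ≤ s₁ → s₁ < s₂ → s₂ < s₃ → s₃ < s₄ →
      |∫ p, particleField φ Z s₁ p * particleField φ Z s₂ p * particleField φ Z s₃ p *
        particleField φ Z s₄ p ∂(Q.prod volume)| ≤
      C * ((s₂ - s₁) ^ (-(7 / 8) : ℝ) * (s₃ - s₂) ^ (-(1 / 2) : ℝ) *
        (s₄ - s₃) ^ (-(7 / 8) : ℝ)) := by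
  obtain ⟨B, hB⟩ := hφ.bounded
  have hB0 : 0 ≤ B := (abs_nonneg _).trans (hB 0)
  obtain ⟨C₁, hC₁0, hC₁⟩ := hZ.abs_integral_add_le hα hα₂ hφ
  obtain ⟨C₂, hC₂0, hC₂⟩ := hZ.integral_abs_add_le hα hα₂ hφ
  have hφm := hφ.measurable
  have hI0 : 0 ≤ ∫ z, |φ z| := integral_nonneg fun _ => abs_nonneg _
  refine ⟨C₁ * C₂ * C₁ * ∫ x, |φ x|, by positivity, fun s₁ s₂ s₃ s₄ h1 h2 h3 h4 => ?_⟩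
  have p1 := hZ.isProbabilityMeasure_stableLaw (sub_pos.2 h2)
  have p2 := hZ.isProbabilityMeasure_stableLaw (sub_pos.2 h3)
  have p3 := hZ.isProbabilityMeasure_stableLaw (sub_pos.2 h4)
  set L₁ := stableLaw α (s₂ - s₁)
  set L₂ := stableLaw α (s₃ - s₂)
  set L₃ := stableLaw α (s₄ - s₃)
  set r₁ := (s₂ - s₁) ^ (-(7 / 8) : ℝ)
  set r₂ := (s₃ - s₂) ^ (-(1 / 2) : ℝ)
  set r₃ := (s₄ - s₃) ^ (-(7 / 8) : ℝ)
  have hr₁ : 0 ≤ r₁ := Real.rpow_nonneg (sub_nonneg.2 h2.le) _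
  have hr₂ : 0 ≤ r₂ := Real.rpow_nonneg (sub_nonneg.2 h3.le) _
  have hr₃ : 0 ≤ r₃ := Real.rpow_nonneg (sub_nonneg.2 h4.le) _
  have hDm : Measurable fun w => ((Z s₂ w - Z s₁ w, Z s₃ w - Z s₂ w), Z s₄ w - Z s₃ w) := by
    have e1 := hZ.measurable_left s₁
    have e2 := hZ.measurable_left s₂
    have e3 := hZ.measurable_left s₃
    have e4 := hZ.measurable_left s₄
    fun_prop
  -- seen from the position at time `s₂`, the four positions depend on the increments only
  let F : ((ℝ × ℝ) × ℝ) → ℝ → ℝ := fun d x =>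
    φ x * (φ (x - d.1.1) * (φ (x + d.1.2) * φ (x + d.1.2 + d.2)))
  have hFm : Measurable fun q : ((ℝ × ℝ) × ℝ) × ℝ => F q.1 q.2 := by fun_prop
  have hbd : ∀ a b c, |φ a * (φ b * φ c)| ≤ B * (B * B) := fun a b c => by
    rw [abs_mul, abs_mul]
    have := hB a; have := hB b; have := hB c
    gcongr
  have hG : StronglyMeasurable fun d => ∫ x, F d x :=
    hFm.stronglyMeasurable.integral_prod_right (ν := volume)
  have e1 : ∫ p, particleField φ Z s₁ p * particleField φ Z s₂ p * particleField φ Z s₃ p *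
        particleField φ Z s₄ p ∂(Q.prod volume) = ∫ d, (∫ x, F d x) ∂((L₁.prod L₂).prod L₃) := by
    have hm := fun s => measurable_particleField_left hZ hφm s
    have hi : Integrable (fun p => particleField φ Z s₁ p * particleField φ Z s₂ p *
        particleField φ Z s₃ p * particleField φ Z s₄ p) (Q.prod volume) := by
      have := (integrable_particleField hZ hφ.integrable s₁).mul_bdd (c := B * (B * B))
        (((hm s₂).mul ((hm s₃).mul (hm s₄))).aestronglyMeasurable)
        (.of_forall fun p => hbd _ _ _)
      exact this.congr (.of_forall fun p => by simp only [Pi.mul_apply]; ring)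
    rw [integral_prod _ hi, ← hZ.law_three s₁ s₂ s₃ s₄ h1 h2 h3 h4,
      integral_map hDm.aemeasurable hG.aestronglyMeasurable]
    refine integral_congr_ae (.of_forall fun w => ?_)
    simp only [particleField, F]
    rw [← integral_add_right_eq_self (fun x => φ x * (φ (x - (Z s₂ w - Z s₁ w)) *
      (φ (x + (Z s₃ w - Z s₂ w)) * φ (x + (Z s₃ w - Z s₂ w) + (Z s₄ w - Z s₃ w))))) (Z s₂ w)]
    refine integral_congr_ae (.of_forall fun x => ?_)
    have a1 : x + Z s₂ w - (Z s₂ w - Z s₁ w) = x + Z s₁ w := by ring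
    have a2 : x + Z s₂ w + (Z s₃ w - Z s₂ w) = x + Z s₃ w := by ring
    have a3 : x + Z s₃ w + (Z s₄ w - Z s₃ w) = x + Z s₄ w := by ring
    simp only [a1, a2, a3]
    ring
  have hFi : Integrable (Function.uncurry F) (((L₁.prod L₂).prod L₃).prod volume) := by
    refine (hφ.integrable.comp_snd ((L₁.prod L₂).prod L₃)).mul_bdd (c := B * (B * B)) ?_
      (.of_forall fun p => hbd _ _ _)
    exact Measurable.aestronglyMeasurable (by fun_prop)
  have hb1 : ∀ x, |∫ a, φ (x - a) ∂L₁| ≤ C₁ * r₁ := fun x => by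
    have h5 : (fun a => φ (x - a)) = fun a => -φ (-x + a) := by
      ext a; rw [← hφ.odd]; ring_nf
    rw [h5, integral_neg, abs_neg]
    exact hC₁ _ (sub_pos.2 h2) _
  have hb3 : ∀ x, |∫ c, φ (x + c) ∂L₃| ≤ C₁ * r₃ := hC₁ _ (sub_pos.2 h4)
  have hb2 : ∀ x, |∫ b, φ (x + b) * (∫ c, φ (x + b + c) ∂L₃) ∂L₂| ≤ C₂ * r₂ * (C₁ * r₃) := by
    intro x
    have hbi : Integrable (fun b => |φ (x + b)|) L₂ :=
      (integrable_const B).mono'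
        (hφm.comp (measurable_const_add x)).abs.aestronglyMeasurable
        (.of_forall fun b => by simpa using hB (x + b))
    refine (norm_integral_le_of_norm_le (G := ℝ) (hbi.mul_const (C₁ * r₃))
      (.of_forall fun b => ?_)).trans ?_
    · rw [norm_mul]
      exact mul_le_mul_of_nonneg_left (hb3 _) (norm_nonneg _)
    · rw [integral_mul_const]
      exact mul_le_mul_of_nonneg_right (hC₂ _ (sub_pos.2 h3) x) (by positivity)
  have e2 : ∀ x, ∫ d, F d x ∂((L₁.prod L₂).prod L₃) =
      φ x * ((∫ a, φ (x - a) ∂L₁) * ∫ b, φ (x + b) * (∫ c, φ (x + b + c) ∂L₃) ∂L₂) := by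
    intro x
    simp only [F]
    rw [integral_const_mul, integral_prod]
    · rw [← integral_prod_mul (μ := L₁) (ν := L₂) (fun a => φ (x - a))
        (fun b => φ (x + b) * (∫ c, φ (x + b + c) ∂L₃))]
      simp only [integral_const_mul]
    · refine (integrable_const (B * (B * B))).mono' (Measurable.aestronglyMeasurable (by fun_prop))
        (.of_forall fun p => hbd _ _ _)
  rw [e1, integral_integral_swap hFi]
  simp only [e2]
  refine (norm_integral_le_of_norm_le (G := ℝ)
    (hφ.integrable.abs.mul_const (C₁ * r₁ * (C₂ * r₂ * (C₁ * r₃)))) (.of_forall fun x => ?_)).trans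
      (le_of_eq ?_)
  · rw [norm_mul, norm_mul]
    refine mul_le_mul_of_nonneg_left ?_ (norm_nonneg _)
    exact mul_le_mul (hb1 x) (hb2 x) (norm_nonneg _) (by positivity)
  · rw [integral_mul_const]; ring

end Correlation

/-! ### Second moment of the occupation time -/

lemma integral_exp_mul_add {c : ℝ} (hc : c ≠ 0) (d a b : ℝ) :
    ∫ t in a..b, Real.exp (c * t + d) = (Real.exp (c * b + d) - Real.exp (c * a + d)) / c := by
  rw [intervalIntegral.integral_comp_mul_add Real.exp hc d, integral_exp, smul_eq_mul,
    div_eq_inv_mul]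

lemma integral_exp_neg_mul_abs_sub {κ T s : ℝ} (hκ : 0 < κ) (hs : 0 ≤ s) (hsT : s ≤ T) :
    ∫ t in Set.Ioc 0 T, Real.exp (-|t - s| * κ) =
      (2 - Real.exp (-κ * s + 0) - Real.exp (κ * s + -(T * κ))) / κ := by
  have hc : Continuous fun t => Real.exp (-|t - s| * κ) := by fun_prop
  rw [← intervalIntegral.integral_of_le (hs.trans hsT),
    ← intervalIntegral.integral_add_adjacent_intervals (b := s) (hc.intervalIntegrable _ _)
      (hc.intervalIntegrable _ _),
    intervalIntegral.integral_congr (a := 0) (g := fun t => Real.exp (κ * t + -(s * κ)))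
      fun t ht => ?_,
    intervalIntegral.integral_congr (a := s) (g := fun t => Real.exp (-κ * t + s * κ))
      fun t ht => ?_, integral_exp_mul_add hκ.ne', integral_exp_mul_add (neg_ne_zero.2 hκ.ne')]
  · have e1 : κ * s + -(s * κ) = 0 := by ring
    have e2 : -κ * s + s * κ = 0 := by ring
    have e3 : κ * 0 + -(s * κ) = -κ * s + 0 := by ring
    have e4 : -κ * T + s * κ = κ * s + -(T * κ) := by ring
    rw [e1, e2, e3, e4, Real.exp_zero, div_neg]
    ring
  · rw [Set.uIcc_of_le hsT] at ht
    simp only [abs_of_nonneg (sub_nonneg.2 ht.1)]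
    ring_nf
  · rw [Set.uIcc_of_le hs] at ht
    simp only [abs_of_nonpos (sub_nonpos.2 ht.2)]
    ring_nf

/-- Normalised double time integral of the exponential correlation `exp (-κ |s - t|)`. -/
def meanExpCorr (T κ : ℝ) : ℝ :=
  T⁻¹ * ∫ s in Set.Ioc 0 T, ∫ t in Set.Ioc 0 T, Real.exp (-|t - s| * κ)

lemma meanExpCorr_eq {κ T : ℝ} (hκ : 0 < κ) (hT : 0 < T) :
    meanExpCorr T κ = 2 / κ - T⁻¹ * (2 * (1 - Real.exp (-T * κ)) / κ ^ 2) := by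
  have h : ∫ s in Set.Ioc 0 T, ∫ t in Set.Ioc 0 T, Real.exp (-|t - s| * κ) =
      2 * T / κ - 2 * (1 - Real.exp (-T * κ)) / κ ^ 2 := by
    have h1 : ∀ c d : ℝ, IntervalIntegrable (fun s => Real.exp (c * s + d)) volume 0 T :=
      fun c d => Continuous.intervalIntegrable (by fun_prop) _ _
    rw [setIntegral_congr_fun measurableSet_Ioc fun s hs =>
      integral_exp_neg_mul_abs_sub hκ hs.1.le hs.2, ← intervalIntegral.integral_of_le hT.le,
      intervalIntegral.integral_div, intervalIntegral.integral_sub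
        (intervalIntegrable_const.sub (h1 _ _)) (h1 _ _),
      intervalIntegral.integral_sub intervalIntegrable_const (h1 _ _),
      integral_exp_mul_add hκ.ne', integral_exp_mul_add (neg_ne_zero.2 hκ.ne'),
      intervalIntegral.integral_const]
    have e1 : -κ * T + 0 = -T * κ := by ring
    have e2 : -κ * 0 + 0 = 0 := by ring
    have e3 : κ * T + -(T * κ) = 0 := by ring
    have e4 : κ * 0 + -(T * κ) = -T * κ := by ring
    rw [e1, e2, e3, e4, Real.exp_zero, smul_eq_mul]
    field_simp
    ring
  rw [meanExpCorr, h, mul_sub]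
  congr 1
  field_simp

lemma meanExpCorr_nonneg {T : ℝ} (hT : 0 < T) (κ : ℝ) : 0 ≤ meanExpCorr T κ :=
  mul_nonneg (by positivity) (integral_nonneg fun _ => integral_nonneg fun _ => by positivity)

lemma meanExpCorr_le {κ T : ℝ} (hκ : 0 < κ) (hT : 0 < T) : meanExpCorr T κ ≤ 2 / κ := by
  rw [meanExpCorr_eq hκ hT]
  have : Real.exp (-T * κ) ≤ 1 := Real.exp_le_one_iff.2 (by nlinarith)
  have : 0 ≤ T⁻¹ * (2 * (1 - Real.exp (-T * κ)) / κ ^ 2) := by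
    have : 0 ≤ 1 - Real.exp (-T * κ) := by linarith
    positivity
  linarith

lemma tendsto_meanExpCorr {κ : ℝ} (hκ : 0 < κ) :
    Tendsto (fun T => meanExpCorr T κ) atTop (𝓝 (2 / κ)) := by
  have h1 : Tendsto (fun T => 2 / κ - T⁻¹ * (2 * (1 - Real.exp (-(T * κ))) / κ ^ 2)) atTop
      (𝓝 (2 / κ - 0 * (2 * (1 - 0) / κ ^ 2))) := by
    refine tendsto_const_nhds.sub (tendsto_inv_atTop_zero.mul (Tendsto.div_const
      (Tendsto.const_mul _ (tendsto_const_nhds.sub ?_)) _))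
    exact Real.tendsto_exp_neg_atTop_nhds_zero.comp (tendsto_id.atTop_mul_const hκ)
  rw [zero_mul, sub_zero] at h1
  refine h1.congr' ?_
  filter_upwards [eventually_gt_atTop 0] with T hT
  rw [meanExpCorr_eq hκ hT, neg_mul]

lemma ae_fst_ne_snd {μ : Measure ℝ} [SFinite μ] [NullSingletonClass μ] :
    ∀ᵐ q : ℝ × ℝ ∂(μ.prod μ), q.1 ≠ q.2 := by
  have h : MeasurableSet {q : ℝ × ℝ | q.1 = q.2} := measurableSet_eq_fun measurable_fst measurable_snd
  have h0 : (μ.prod μ) {q : ℝ × ℝ | q.1 = q.2} = 0 := by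
    rw [Measure.measure_prod_null h]
    refine .of_forall fun x => ?_
    have : Prod.mk x ⁻¹' {q : ℝ × ℝ | q.1 = q.2} = {x} := by
      ext y; simp [eq_comm]
    exact (congrArg μ this).trans (measure_singleton x)
  exact measure_eq_zero_iff_ae_notMem.1 h0

section Occupation

/-- The occupation time integral `∫₀ᵀ φ (x + Z s) ds` of one particle started at `x`. -/
def occupation {W : Type*} (φ : ℝ → ℝ) (Z : ℝ → W → ℝ) (T : ℝ) (p : W × ℝ) : ℝ :=
  ∫ s in Set.Ioc 0 T, particleField φ Z s p

lemma abs_occupation_le {W : Type*} {Z : ℝ → W → ℝ} {φ : ℝ → ℝ} {B T : ℝ} (hT : 0 ≤ T)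
    (hB : ∀ x, |φ x| ≤ B) (p : W × ℝ) :
    |occupation φ Z T p| ≤ B * T := by
  have h := norm_setIntegral_le_of_norm_le_const (μ := volume) (s := Set.Ioc 0 T)
    (f := fun s => particleField φ Z s p) (C := B) (by simp) (fun s _ => hB _)
  rw [Real.norm_eq_abs] at h
  rwa [measureReal_def, Real.volume_Ioc, sub_zero, ENNReal.toReal_ofReal hT] at h

variable {W : Type*} [MeasurableSpace W] {Q : Measure W} {α : ℝ} {Z : ℝ → W → ℝ}

lemma measurable_occupation (hZ : HasStableIncrements α Z Q) {φ : ℝ → ℝ} (hφ : Measurable φ)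
    (T : ℝ) : Measurable (occupation φ Z T) :=
  ((measurable_particleField hZ hφ).stronglyMeasurable.integral_prod_right
    (ν := volume.restrict (Set.Ioc 0 T))).measurable

variable [IsProbabilityMeasure Q]

lemma integrable_particleField_uncurry (hZ : HasStableIncrements α Z Q) {φ : ℝ → ℝ}
    (hφ : Integrable φ) (hφm : Measurable φ) {Y : Type*} [MeasurableSpace Y] (ν : Measure Y)
    [IsFiniteMeasure ν] {τ : Y → ℝ} (hτ : Measurable τ) :
    Integrable (fun q : (W × ℝ) × Y => particleField φ Z (τ q.2) q.1)
      ((Q.prod volume).prod ν) := by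
  have hm : Measurable fun q : (W × ℝ) × Y => particleField φ Z (τ q.2) q.1 :=
    (measurable_particleField hZ hφm).comp (measurable_fst.prodMk (hτ.comp measurable_snd))
  rw [integrable_prod_iff' hm.aestronglyMeasurable]
  refine ⟨.of_forall fun y => integrable_particleField hZ hφ (τ y), ?_⟩
  have : ∀ s, ∫ p, ‖particleField φ Z s p‖ ∂(Q.prod volume) = ∫ x, ‖φ x‖ := by
    intro s
    rw [integral_prod _ (integrable_particleField hZ hφ s).norm]
    simp only [particleField, integral_add_right_eq_self fun x => ‖φ x‖]
    simp
  simp only [this]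
  exact integrable_const _

lemma integrable_occupation (hZ : HasStableIncrements α Z Q) {φ : ℝ → ℝ}
    (hφ : Integrable φ) (hφm : Measurable φ) (T : ℝ) :
    Integrable (occupation φ Z T) (Q.prod volume) :=
  (integrable_particleField_uncurry hZ hφ hφm (volume.restrict (Set.Ioc 0 T))
    measurable_id).integral_prod_left

lemma integral_occupation (hZ : HasStableIncrements α Z Q) {φ : ℝ → ℝ} (hφ : IsOddTest φ)
    (T : ℝ) : ∫ p, occupation φ Z T p ∂(Q.prod volume) = 0 := by
  simp only [occupation]
  rw [integral_integral_swap (integrable_particleField_uncurry hZ hφ.integrable hφ.measurable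
    (volume.restrict (Set.Ioc 0 T)) measurable_id)]
  simp only [integral_particleField hZ hφ, integral_zero]

lemma integrable_occupation_sq (hZ : HasStableIncrements α Z Q) {φ : ℝ → ℝ} (hφ : IsOddTest φ)
    {T : ℝ} (hT : 0 ≤ T) : Integrable (fun p => occupation φ Z T p ^ 2) (Q.prod volume) := by
  obtain ⟨B, hB⟩ := hφ.bounded
  simp only [sq]
  exact (integrable_occupation hZ hφ.integrable hφ.measurable T).mul_bdd (c := B * T)
    (measurable_occupation hZ hφ.measurable T).aestronglyMeasurable
    (.of_forall fun p => abs_occupation_le hT hB p)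

lemma integral_occupation_sq (hα : 0 < α) (hZ : HasStableIncrements α Z Q) {φ : ℝ → ℝ}
    (hφ : IsOddTest φ) (hφs : Integrable fun u => sinTransform φ u ^ 2 * |u| ^ (-α)) {T : ℝ}
    (hT : 0 < T) : T⁻¹ * ∫ p, occupation φ Z T p ^ 2 ∂(Q.prod volume) =
      (2 * Real.pi)⁻¹ * ∫ u, sinTransform φ u ^ 2 * meanExpCorr T (|u| ^ α) := by
  obtain ⟨B, hB⟩ := hφ.bounded
  have hφm := hφ.measurable
  set μ : Measure ℝ := volume.restrict (Set.Ioc 0 T) with hμ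
  have hm := measurable_particleField hZ hφm
  have hprod : Integrable (fun q : (W × ℝ) × (ℝ × ℝ) => particleField φ Z q.2.1 q.1 *
      particleField φ Z q.2.2 q.1) ((Q.prod volume).prod (μ.prod μ)) := by
    have h1 := integrable_particleField_uncurry hZ hφ.integrable hφm (μ.prod μ) measurable_fst
    refine h1.mul_bdd (c := B) ?_ (.of_forall fun q => hB _)
    exact (hm.comp (measurable_fst.prodMk
      (measurable_snd.comp measurable_snd))).aestronglyMeasurable
  have h1 : ∫ p, occupation φ Z T p ^ 2 ∂(Q.prod volume) =
      ∫ q : ℝ × ℝ, (∫ p, particleField φ Z q.1 p * particleField φ Z q.2 p ∂(Q.prod volume))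
        ∂(μ.prod μ) := by
    rw [← integral_integral_swap hprod]
    refine integral_congr_ae (.of_forall fun p => ?_)
    simp only [occupation]
    rw [integral_prod_mul (μ := μ) (ν := μ) (fun s => particleField φ Z s p)
      (fun s => particleField φ Z s p), sq]
  have hpos : ∀ᵐ q : ℝ × ℝ ∂(μ.prod μ), q ∈ Set.Ioc 0 T ×ˢ Set.Ioc 0 T := by
    rw [hμ, Measure.prod_restrict]
    exact ae_restrict_mem (measurableSet_Ioc.prod measurableSet_Ioc)
  have h2 : ∀ᵐ q : ℝ × ℝ ∂(μ.prod μ),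
      ∫ p, particleField φ Z q.1 p * particleField φ Z q.2 p ∂(Q.prod volume) =
        (2 * Real.pi)⁻¹ * ∫ u, sinTransform φ u ^ 2 * Real.exp (-|q.2 - q.1| * |u| ^ α) := by
    filter_upwards [ae_fst_ne_snd (μ := μ), hpos] with q hq hq0
    rcases lt_or_gt_of_ne hq with h | h
    · rw [integral_particleField_mul hα hZ hφ hq0.1.1.le h, abs_of_pos (sub_pos.2 h)]
    · rw [abs_of_neg (sub_neg.2 h), neg_sub, ← integral_particleField_mul hα hZ hφ hq0.2.1.le h]
      simp only [mul_comm]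
  have hsm := measurable_sinTransform hφm
  have hne : ∀ᵐ u : ℝ, u ≠ 0 := by simp [ae_iff]
  have hci : ∀ u, Integrable (fun q : ℝ × ℝ => Real.exp (-|q.2 - q.1| * |u| ^ α))
      (μ.prod μ) := fun u => by
    refine (integrable_const (1 : ℝ)).mono' (Measurable.aestronglyMeasurable (by fun_prop))
      (.of_forall fun q => ?_)
    rw [Real.norm_of_nonneg (by positivity), Real.exp_le_one_iff]
    exact mul_nonpos_of_nonpos_of_nonneg (neg_nonpos.2 (abs_nonneg _)) (by positivity)
  have hJ : ∀ u, ∫ q : ℝ × ℝ, sinTransform φ u ^ 2 * Real.exp (-|q.2 - q.1| * |u| ^ α)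
      ∂(μ.prod μ) = T * (sinTransform φ u ^ 2 * meanExpCorr T (|u| ^ α)) := by
    intro u
    rw [integral_const_mul, integral_prod _ (hci u), meanExpCorr, mul_left_comm T,
      mul_inv_cancel_left₀ hT.ne']
  have hEi : Integrable (fun q : ℝ × (ℝ × ℝ) => sinTransform φ q.1 ^ 2 *
      Real.exp (-|q.2.2 - q.2.1| * |q.1| ^ α)) (volume.prod (μ.prod μ)) := by
    have hmE : Measurable (fun q : ℝ × (ℝ × ℝ) => sinTransform φ q.1 ^ 2 *
      Real.exp (-|q.2.2 - q.2.1| * |q.1| ^ α)) := by fun_prop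
    rw [integrable_prod_iff hmE.aestronglyMeasurable]
    refine ⟨.of_forall fun u => (hci u).const_mul (sinTransform φ u ^ 2), ?_⟩
    have h3 : ∀ u (q : ℝ × ℝ), ‖sinTransform φ u ^ 2 * Real.exp (-|q.2 - q.1| * |u| ^ α)‖ =
        sinTransform φ u ^ 2 * Real.exp (-|q.2 - q.1| * |u| ^ α) :=
      fun u q => Real.norm_of_nonneg (by positivity)
    simp only [h3]
    refine (hφs.const_mul (2 * T)).mono'
      (hmE.stronglyMeasurable.integral_prod_right (ν := μ.prod μ)).aestronglyMeasurable ?_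
    filter_upwards [hne] with u hu
    have hu0 : 0 < |u| ^ α := by positivity
    rw [hJ, Real.norm_of_nonneg (mul_nonneg hT.le (mul_nonneg (by positivity)
      (meanExpCorr_nonneg hT _)))]
    have h4 := mul_le_mul_of_nonneg_left (meanExpCorr_le hu0 hT)
      (mul_nonneg hT.le (sq_nonneg (sinTransform φ u)))
    rw [Real.rpow_neg (abs_nonneg u)]
    calc _ = T * sinTransform φ u ^ 2 * meanExpCorr T (|u| ^ α) := by ring
      _ ≤ _ := h4
      _ = _ := by ring
  rw [h1, integral_congr_ae h2, integral_const_mul, ← integral_integral_swap hEi]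
  simp only [hJ]
  rw [integral_const_mul]
  field_simp

lemma integral_occupation_sq_le (hα : 0 < α) (hZ : HasStableIncrements α Z Q) {φ : ℝ → ℝ}
    (hφ : IsOddTest φ) (hφs : Integrable fun u => sinTransform φ u ^ 2 * |u| ^ (-α)) {T : ℝ}
    (hT : 0 < T) : T⁻¹ * ∫ p, occupation φ Z T p ^ 2 ∂(Q.prod volume) ≤
      Real.pi⁻¹ * ∫ u, sinTransform φ u ^ 2 * |u| ^ (-α) := by
  have hne : ∀ᵐ u : ℝ, u ≠ 0 := by simp [ae_iff]
  rw [integral_occupation_sq hα hZ hφ hφs hT, mul_inv, mul_comm (2 : ℝ)⁻¹, mul_assoc,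
    ← integral_const_mul]
  refine mul_le_mul_of_nonneg_left (integral_mono_of_nonneg (.of_forall fun u => ?_) hφs ?_)
    (by positivity)
  · exact mul_nonneg (by norm_num) (mul_nonneg (sq_nonneg _) (meanExpCorr_nonneg hT _))
  · filter_upwards [hne] with u hu
    have h4 := mul_le_mul_of_nonneg_left (meanExpCorr_le (by positivity : 0 < |u| ^ α) hT)
      (sq_nonneg (sinTransform φ u))
    rw [Real.rpow_neg (abs_nonneg u)]
    rw [div_eq_mul_inv] at h4
    linarith

/-- The occupation time of an odd test function has a variance of order `T`. -/
lemma tendsto_integral_occupation_sq (hα : 0 < α) (hZ : HasStableIncrements α Z Q) {φ : ℝ → ℝ}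
    (hφ : IsOddTest φ) (hφs : Integrable fun u => sinTransform φ u ^ 2 * |u| ^ (-α)) :
    Tendsto (fun T => T⁻¹ * ∫ p, occupation φ Z T p ^ 2 ∂(Q.prod volume)) atTop
      (𝓝 (Real.pi⁻¹ * ∫ u, sinTransform φ u ^ 2 * |u| ^ (-α))) := by
  have hne : ∀ᵐ u : ℝ, u ≠ 0 := by simp [ae_iff]
  have hsm := measurable_sinTransform hφ.measurable
  have h1 : Tendsto (fun T => ∫ u, sinTransform φ u ^ 2 * meanExpCorr T (|u| ^ α)) atTop
      (𝓝 (∫ u, sinTransform φ u ^ 2 * (2 * |u| ^ (-α)))) := by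
    refine tendsto_integral_filter_of_dominated_convergence
      (fun u => 2 * (sinTransform φ u ^ 2 * |u| ^ (-α))) ?_ ?_ (hφs.const_mul 2) ?_
    · filter_upwards [eventually_gt_atTop 0] with T hT
      have hm : Measurable fun κ => 2 / κ - T⁻¹ * (2 * (1 - Real.exp (-T * κ)) / κ ^ 2) := by
        fun_prop
      have hm2 : Measurable fun u : ℝ => |u| ^ α := by fun_prop
      refine AEStronglyMeasurable.congr (f := fun u => sinTransform φ u ^ 2 *
        (2 / |u| ^ α - T⁻¹ * (2 * (1 - Real.exp (-T * |u| ^ α)) / (|u| ^ α) ^ 2)))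
        ((hsm.pow_const 2).mul (hm.comp hm2)).aestronglyMeasurable ?_
      filter_upwards [hne] with u hu
      rw [meanExpCorr_eq (by positivity) hT]
    · filter_upwards [eventually_gt_atTop 0] with T hT
      filter_upwards [hne] with u hu
      rw [Real.norm_of_nonneg (mul_nonneg (sq_nonneg _) (meanExpCorr_nonneg hT _))]
      have h4 := mul_le_mul_of_nonneg_left (meanExpCorr_le (by positivity : 0 < |u| ^ α) hT)
        (sq_nonneg (sinTransform φ u))
      rw [Real.rpow_neg (abs_nonneg u)]
      rw [div_eq_mul_inv] at h4
      linarith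
    · filter_upwards [hne] with u hu
      rw [Real.rpow_neg (abs_nonneg u), ← div_eq_mul_inv]
      exact (tendsto_meanExpCorr (by positivity)).const_mul _
  have h2 : Real.pi⁻¹ * ∫ u, sinTransform φ u ^ 2 * |u| ^ (-α) =
      (2 * Real.pi)⁻¹ * ∫ u, sinTransform φ u ^ 2 * (2 * |u| ^ (-α)) := by
    have : ∫ u, sinTransform φ u ^ 2 * (2 * |u| ^ (-α)) =
        2 * ∫ u, sinTransform φ u ^ 2 * |u| ^ (-α) := by
      rw [← integral_const_mul]
      exact integral_congr_ae (.of_forall fun u => by ring)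
    rw [this]
    field_simp
  rw [h2]
  refine (h1.const_mul _).congr' ?_
  filter_upwards [eventually_gt_atTop 0] with T hT
  rw [integral_occupation_sq hα hZ hφ hφs hT]

end Occupation

/-! ### Fourth moment of the occupation time -/

lemma lintegral_pi_chain_le {μ : Measure ℝ} [SigmaFinite μ] {n : ℕ} (w : Fin n → ℝ → ℝ≥0∞)
    (hw : ∀ i, Measurable (w i)) (K : Fin n → ℝ≥0∞)
    (hK : ∀ i x, ∫⁻ y, w i (x - y) ∂μ ≤ K i) :
    ∫⁻ s : Fin (n + 1) → ℝ, ∏ i, w i (s i.succ - s i.castSucc) ∂(Measure.pi fun _ => μ) ≤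
      (∏ i, K i) * μ Set.univ := by
  induction n with
  | zero => simp [Measure.pi_univ]
  | succ n ih =>
    have he := (measurePreserving_piFinSuccAbove (fun _ : Fin (n + 2) => μ) 0).symm
    rw [← he.lintegral_comp_emb (MeasurableEquiv.measurableEmbedding _)]
    have h1 : ∀ q : ℝ × (Fin (n + 1) → ℝ), ∏ i : Fin (n + 1),
        w i ((MeasurableEquiv.piFinSuccAbove (fun _ : Fin (n + 2) => ℝ) 0).symm q i.succ -
          (MeasurableEquiv.piFinSuccAbove (fun _ : Fin (n + 2) => ℝ) 0).symm q i.castSucc) =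
        w 0 (q.2 0 - q.1) * ∏ i : Fin n, w i.succ (q.2 i.succ - q.2 i.castSucc) := by
      intro q
      rw [Fin.prod_univ_succ]
      rfl
    simp only [h1]
    have hm : Measurable fun q : ℝ × (Fin (n + 1) → ℝ) => w 0 (q.2 0 - q.1) *
        ∏ i : Fin n, w i.succ (q.2 i.succ - q.2 i.castSucc) := by fun_prop
    rw [lintegral_prod_symm _ hm.aemeasurable]
    have hm0 : ∀ s : Fin (n + 1) → ℝ, Measurable fun x => w 0 (s 0 - x) := fun s => by fun_prop
    calc ∫⁻ s, ∫⁻ x, w 0 (s 0 - x) * ∏ i : Fin n, w i.succ (s i.succ - s i.castSucc) ∂μ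
          ∂(Measure.pi fun _ => μ)
        ≤ ∫⁻ s : Fin (n + 1) → ℝ, K 0 * ∏ i : Fin n, w i.succ (s i.succ - s i.castSucc)
          ∂(Measure.pi fun _ => μ) := by
          refine lintegral_mono fun s => ?_
          rw [lintegral_mul_const _ (hm0 s)]
          gcongr
          exact hK 0 _
      _ ≤ K 0 * ((∏ i : Fin n, K i.succ) * μ Set.univ) := by
          rw [lintegral_const_mul _ (by fun_prop)]
          gcongr
          exact ih (fun i => w i.succ) (fun i => hw i.succ) (fun i => K i.succ)
            fun i x => hK i.succ x
      _ = _ := by rw [Fin.prod_univ_succ, mul_assoc]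

lemma lintegral_pi_comp_perm {μ : Measure ℝ} [SigmaFinite μ] {n : ℕ} (σ : Equiv.Perm (Fin n))
    (b : (Fin n → ℝ) → ℝ≥0∞) :
    ∫⁻ s, b (s ∘ σ) ∂(Measure.pi fun _ => μ) = ∫⁻ s, b s ∂(Measure.pi fun _ => μ) := by
  have h := measurePreserving_arrowCongr' (fun _ : Fin n => μ) (fun _ : Fin n => μ) σ.symm
    (MeasurableEquiv.refl ℝ) fun _ => MeasurePreserving.id μ
  exact h.lintegral_comp_emb (MeasurableEquiv.measurableEmbedding _) b

/-- The truncated singularity `|r| ^ (-γ)`, `|r| < T`; it is infinite at `r = 0`. -/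
def singularWeight (T γ r : ℝ) : ℝ≥0∞ :=
  (Set.Ioo (-T) T).indicator (fun r => ENNReal.ofReal |r| ^ (-γ)) r

lemma measurable_singularWeight (T γ : ℝ) : Measurable (singularWeight T γ) :=
  Measurable.indicator (by fun_prop) measurableSet_Ioo

lemma singularWeight_of_pos {T γ r : ℝ} (hr : 0 < r) (hrT : r < T) :
    singularWeight T γ r = ENNReal.ofReal (r ^ (-γ)) := by
  rw [singularWeight, Set.indicator_of_mem (by constructor <;> linarith), abs_of_pos hr,
    ENNReal.ofReal_rpow_of_pos hr]

lemma lintegral_singularWeight {T γ : ℝ} (hT : 0 < T) (hγ : γ < 1) :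
    ∫⁻ r, singularWeight T γ r = ENNReal.ofReal (2 / (1 - γ) * T ^ (1 - γ)) := by
  let g : ℝ → ℝ := (Set.Iio T).indicator fun r => r ^ (-γ)
  have hI : ∫ r in Set.Ioi 0, g r = T ^ (1 - γ) / (1 - γ) := by
    rw [setIntegral_indicator measurableSet_Iio, Set.Ioi_inter_Iio, ← integral_Ioc_eq_integral_Ioo,
      ← intervalIntegral.integral_of_le hT.le, integral_rpow (Or.inl (by linarith)),
      Real.zero_rpow (by linarith), sub_zero, neg_add_eq_sub]
  have hi : IntegrableOn g (Set.Ioi 0) := by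
    rw [IntegrableOn, integrable_indicator_iff measurableSet_Iio, IntegrableOn,
      Measure.restrict_restrict measurableSet_Iio, Set.inter_comm, Set.Ioi_inter_Iio]
    exact (intervalIntegrable_iff_integrableOn_Ioo_of_le hT.le).1
      (intervalIntegral.intervalIntegrable_rpow' (by linarith))
  have hg0 : ∀ r : ℝ, 0 ≤ g |r| := fun r =>
    Set.indicator_apply_nonneg fun _ => Real.rpow_nonneg (abs_nonneg r) _
  have hne : ∀ᵐ u : ℝ, u ≠ 0 := by simp [ae_iff]
  rw [show 2 / (1 - γ) * T ^ (1 - γ) = ∫ r, g |r| by rw [integral_comp_abs, hI]; ring,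
    ofReal_integral_eq_lintegral_ofReal (integrable_comp_abs hi) (.of_forall hg0)]
  refine lintegral_congr_ae ?_
  filter_upwards [hne] with r hr
  simp only [singularWeight, g, Set.indicator_apply, Set.mem_Ioo, Set.mem_Iio, ← abs_lt]
  split_ifs
  · rw [ENNReal.ofReal_rpow_of_pos (abs_pos.2 hr)]
  · simp

lemma singularWeight_ne_zero {T γ r : ℝ} (hr : |r| < T) (hγ : 0 < γ) :
    singularWeight T γ r ≠ 0 := by
  rw [singularWeight, Set.indicator_of_mem (Set.mem_Ioo.2 (abs_lt.1 hr))]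
  simp [ENNReal.rpow_eq_zero_iff, hγ.le]

lemma singularWeight_zero {T γ : ℝ} (hT : 0 < T) (hγ : 0 < γ) : singularWeight T γ 0 = ∞ := by
  rw [singularWeight, Set.indicator_of_mem (by constructor <;> linarith)]
  simp [hγ]

section Occupation

variable {W : Type*} [MeasurableSpace W] {Q : Measure W} {α : ℝ} {Z : ℝ → W → ℝ}
  [IsProbabilityMeasure Q]

/-- The exponents of the bound on the fourth order correlations. -/
def gapExponent : Fin 3 → ℝ := ![7 / 8, 1 / 2, 7 / 8]

lemma gapExponent_pos (i : Fin 3) : 0 < gapExponent i := by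
  fin_cases i <;> norm_num [gapExponent]

/-- On monotone times, the fourth order correlation is bounded by a product over the three gaps.
At ties the right-hand side is infinite. -/
lemma exists_enorm_correlation_le (hα : 1 < α) (hα₂ : α ≤ 2)
    (hZ : HasStableIncrements α Z Q) {φ : ℝ → ℝ} (hφ : IsOddTest φ) :
    ∃ C : ℝ, 0 < C ∧ ∀ T, 0 < T → ∀ s : Fin 4 → ℝ, (∀ i, s i ∈ Set.Ioc 0 T) → Monotone s →
      ‖∫ p, ∏ i, particleField φ Z (s i) p ∂(Q.prod volume)‖ₑ ≤
        ENNReal.ofReal C *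
          ∏ i : Fin 3, singularWeight T (gapExponent i) (s i.succ - s i.castSucc) := by
  obtain ⟨C, hC0, hC⟩ := exists_abs_integral_particleField_mul4_le hα hα₂ hZ hφ
  refine ⟨C + 1, by positivity, fun T hT s hs hmono => ?_⟩
  have hlt : ∀ i j, |s i - s j| < T := fun i j => by
    rw [abs_lt]
    constructor <;> linarith [(hs i).1, (hs i).2, (hs j).1, (hs j).2]
  by_cases hst : ∃ i : Fin 3, s i.succ = s i.castSucc
  · obtain ⟨i, hi⟩ := hst
    have : ∏ i : Fin 3, singularWeight T (gapExponent i) (s i.succ - s i.castSucc) = ∞ := by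
      rw [← Finset.mul_prod_erase _ _ (Finset.mem_univ i), hi, sub_self,
        singularWeight_zero hT (gapExponent_pos i)]
      exact ENNReal.top_mul (Finset.prod_ne_zero_iff.2 fun j _ =>
        singularWeight_ne_zero (hlt _ _) (gapExponent_pos j))
    rw [this, ENNReal.mul_top (by positivity)]
    exact le_top
  · push Not at hst
    have hlt' : ∀ i : Fin 3, s i.castSucc < s i.succ := fun i =>
      lt_of_le_of_ne (hmono (Fin.castSucc_le_succ i)) (hst i).symm
    have h := hC (s 0) (s 1) (s 2) (s 3) (hs 0).1.le (hlt' 0) (hlt' 1) (hlt' 2)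
    have hw : ∀ i : Fin 3, singularWeight T (gapExponent i) (s i.succ - s i.castSucc) =
        ENNReal.ofReal ((s i.succ - s i.castSucc) ^ (-gapExponent i)) := fun i =>
      singularWeight_of_pos (sub_pos.2 (hlt' i)) (lt_of_abs_lt (hlt _ _))
    have hnn : ∀ i : Fin 3, 0 ≤ (s i.succ - s i.castSucc) ^ (-gapExponent i) := fun i =>
      Real.rpow_nonneg (sub_nonneg.2 (hlt' i).le) _
    rw [Finset.prod_congr rfl fun i _ => hw i, ← ENNReal.ofReal_prod_of_nonneg fun i _ => hnn i,
      ← ENNReal.ofReal_mul (by positivity), Real.enorm_eq_ofReal_abs]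
    refine ENNReal.ofReal_le_ofReal ?_
    simp only [Fin.prod_univ_four, Fin.prod_univ_three] at hnn ⊢
    refine h.trans ?_
    refine mul_le_mul (by linarith) (le_of_eq rfl) ?_ (by positivity)
    exact mul_nonneg (mul_nonneg (hnn 0) (hnn 1)) (hnn 2)

/-- The fourth moment of the occupation time is of smaller order than `T ^ 2`, the square of the
order of the variance. -/
lemma exists_integral_occupation_pow_four_le (hα : 1 < α) (hα₂ : α ≤ 2)
    (hZ : HasStableIncrements α Z Q) {φ : ℝ → ℝ} (hφ : IsOddTest φ) :
    ∃ C : ℝ, 0 ≤ C ∧ ∀ T, 0 < T →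
      ∫ p, occupation φ Z T p ^ 4 ∂(Q.prod volume) ≤ C * T ^ (7 / 4 : ℝ) := by
  obtain ⟨B, hB⟩ := hφ.bounded
  have hB0 : 0 ≤ B := (abs_nonneg _).trans (hB 0)
  have hφm := hφ.measurable
  obtain ⟨C, hC0, hC⟩ := exists_enorm_correlation_le hα hα₂ hZ hφ
  refine ⟨24 * C * (16 * 4 * 16), by positivity, fun T hT => ?_⟩
  set μ : Measure ℝ := volume.restrict (Set.Ioc 0 T) with hμ
  set π : Measure (Fin 4 → ℝ) := Measure.pi fun _ => μ with hπ
  let b : (Fin 4 → ℝ) → ℝ≥0∞ := fun s =>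
    ∏ i : Fin 3, singularWeight T (gapExponent i) (s i.succ - s i.castSucc)
  have hbm : Measurable b := Finset.measurable_prod _ fun i _ =>
    (measurable_singularWeight _ _).comp ((measurable_pi_apply _).sub (measurable_pi_apply _))
  have hΓ : ∀ᵐ s ∂π, ‖∫ p, ∏ i, particleField φ Z (s i) p ∂(Q.prod volume)‖ₑ ≤
      ∑ σ : Equiv.Perm (Fin 4), ENNReal.ofReal C * b (s ∘ σ) := by
    have hmem : ∀ᵐ s ∂π, ∀ i, s i ∈ Set.Ioc 0 T := by
      refine ae_all_iff.2 fun i => ?_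
      exact (Measure.tendsto_eval_ae_ae (μ := fun _ : Fin 4 => μ) (i := i)).eventually
        (ae_restrict_mem measurableSet_Ioc)
    filter_upwards [hmem] with s hs
    -- only the sorting permutation of `s` is needed; adding the others makes the bound symmetric
    have h1 := hC T hT (s ∘ Tuple.sort s) (fun i => hs _) (Tuple.monotone_sort s)
    simp only [Function.comp_apply] at h1
    have h2 : ∀ p, ∏ i, particleField φ Z (s (Tuple.sort s i)) p =
        ∏ i, particleField φ Z (s i) p := fun p =>
      Equiv.prod_comp (Tuple.sort s) fun i => particleField φ Z (s i) p
    simp only [h2] at h1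
    exact h1.trans (Finset.single_le_sum (f := fun σ : Equiv.Perm (Fin 4) =>
      ENNReal.ofReal C * b (s ∘ σ)) (fun _ _ => zero_le) (Finset.mem_univ (Tuple.sort s)))
  have hFub : Integrable (fun q : (W × ℝ) × (Fin 4 → ℝ) => ∏ i, particleField φ Z (q.2 i) q.1)
      ((Q.prod volume).prod π) := by
    have hm : ∀ i : Fin 4, Measurable fun q : (W × ℝ) × (Fin 4 → ℝ) =>
        particleField φ Z (q.2 i) q.1 := fun i =>
      (measurable_particleField hZ hφm).comp (measurable_fst.prodMk
        ((measurable_pi_apply i).comp measurable_snd))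
    have h0 := integrable_particleField_uncurry hZ hφ.integrable hφm π (measurable_pi_apply 0)
    have hsplit : (fun q : (W × ℝ) × (Fin 4 → ℝ) => ∏ i, particleField φ Z (q.2 i) q.1) =
        fun q => particleField φ Z (q.2 0) q.1 * ∏ i : Fin 3, particleField φ Z (q.2 i.succ) q.1 :=
      funext fun q => Fin.prod_univ_succ _
    rw [hsplit]
    refine h0.mul_bdd (c := ∏ i : Fin 3, B)
      (Finset.measurable_prod _ fun i _ => hm i.succ).aestronglyMeasurable (.of_forall fun q => ?_)
    rw [norm_prod]
    exact Finset.prod_le_prod (fun _ _ => norm_nonneg _) fun i _ => hB _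
  have h1 : ∫ p, occupation φ Z T p ^ 4 ∂(Q.prod volume) =
      ∫ s, (∫ p, ∏ i, particleField φ Z (s i) p ∂(Q.prod volume)) ∂π := by
    rw [← integral_integral_swap hFub]
    refine integral_congr_ae (.of_forall fun p => ?_)
    exact (integral_fintype_prod_eq_pow (ι := Fin 4) (μ := μ)
      (fun s => particleField φ Z s p)).symm
  have hchain : ∫⁻ s, b s ∂π ≤ ENNReal.ofReal (16 * 4 * 16 * T ^ (7 / 4 : ℝ)) := by
    have hK : ∀ (i : Fin 3) (x : ℝ), ∫⁻ y, singularWeight T (gapExponent i) (x - y) ∂μ ≤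
        ENNReal.ofReal (2 / (1 - gapExponent i) * T ^ (1 - gapExponent i)) := by
      intro i x
      rw [← lintegral_singularWeight hT (by fin_cases i <;> norm_num [gapExponent])]
      refine (lintegral_mono' Measure.restrict_le_self le_rfl).trans (le_of_eq ?_)
      exact lintegral_sub_left_eq_self (fun y => singularWeight T (gapExponent i) y) x
    refine (lintegral_pi_chain_le _ (fun i => measurable_singularWeight T (gapExponent i)) _
      hK).trans (le_of_eq ?_)
    have g0 : gapExponent 0 = 7 / 8 := rfl
    have g1 : gapExponent 1 = 1 / 2 := rfl
    have g2 : gapExponent 2 = 7 / 8 := rfl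
    rw [hμ, Measure.restrict_apply_univ, Real.volume_Ioc, sub_zero, Fin.prod_univ_three, g0, g1, g2,
      ← ENNReal.ofReal_mul (by norm_num; positivity),
      ← ENNReal.ofReal_mul (by norm_num; positivity),
      ← ENNReal.ofReal_mul (by norm_num; positivity)]
    congr 1
    have e : T ^ (7 / 4 : ℝ) = T ^ (1 / 8 : ℝ) * T ^ (1 / 2 : ℝ) * T ^ (1 / 8 : ℝ) * T := by
      nth_rw 5 [← Real.rpow_one T]
      rw [← Real.rpow_add hT, ← Real.rpow_add hT, ← Real.rpow_add hT]
      norm_num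
    rw [e]
    norm_num
    ring
  have h2 : ENNReal.ofReal (∫ p, occupation φ Z T p ^ 4 ∂(Q.prod volume)) ≤
      ENNReal.ofReal (24 * C * (16 * 4 * 16) * T ^ (7 / 4 : ℝ)) := by
    calc ENNReal.ofReal (∫ p, occupation φ Z T p ^ 4 ∂(Q.prod volume))
        ≤ ‖∫ p, occupation φ Z T p ^ 4 ∂(Q.prod volume)‖ₑ := by
          rw [Real.enorm_eq_ofReal_abs]; exact ENNReal.ofReal_le_ofReal (le_abs_self _)
      _ ≤ ∫⁻ s, ‖∫ p, ∏ i, particleField φ Z (s i) p ∂(Q.prod volume)‖ₑ ∂π := by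
          rw [h1]; exact enorm_integral_le_lintegral_enorm _
      _ ≤ ∫⁻ s, ∑ σ : Equiv.Perm (Fin 4), ENNReal.ofReal C * b (s ∘ σ) ∂π := lintegral_mono_ae hΓ
      _ = 24 * (ENNReal.ofReal C * ∫⁻ s, b s ∂π) := by
          have hbσ : ∀ σ : Equiv.Perm (Fin 4), Measurable fun s => b (s ∘ σ) := fun σ =>
            hbm.comp (measurable_pi_lambda _ fun i => measurable_pi_apply (σ i))
          rw [lintegral_finsetSum _ fun σ _ => (hbσ σ).const_mul _]
          have : ∀ σ : Equiv.Perm (Fin 4), ∫⁻ s, ENNReal.ofReal C * b (s ∘ σ) ∂π =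
              ENNReal.ofReal C * ∫⁻ s, b s ∂π := fun σ => by
            rw [lintegral_const_mul _ (hbσ σ), lintegral_pi_comp_perm]
          rw [Finset.sum_congr rfl fun σ _ => this σ, Finset.sum_const, Finset.card_univ,
            Fintype.card_perm, Fintype.card_fin, nsmul_eq_mul]
          norm_num [Nat.factorial]
      _ ≤ 24 * (ENNReal.ofReal C * ENNReal.ofReal (16 * 4 * 16 * T ^ (7 / 4 : ℝ))) := by gcongr
      _ = _ := by
          rw [← ENNReal.ofReal_mul hC0.le, show (24 : ℝ≥0∞) = ENNReal.ofReal 24 by norm_num,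
            ← ENNReal.ofReal_mul (by norm_num)]
          congr 1; ring
  exact (ENNReal.ofReal_le_ofReal_iff (by positivity)).1 h2

end Occupation

/-! ### The logarithm of the limiting characteristic function -/

/-- The second order Taylor remainder of `exp (i a)`. -/
def expRemainder (a : ℝ) : ℂ :=
  Complex.exp (a * Complex.I) - 1 - a * Complex.I + (a : ℂ) ^ 2 / 2

lemma norm_expRemainder_le (a : ℝ) : ‖expRemainder a‖ ≤ 4 * |a| ^ 3 := by
  rcases le_total |a| 1 with h | h
  · have h1 := Complex.exp_bound (x := a * Complex.I) (by simpa using h) (n := 3) (by norm_num)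
    have h2 : Complex.exp (a * Complex.I) - ∑ m ∈ Finset.range 3, (a * Complex.I) ^ m /
        (m.factorial : ℂ) = expRemainder a := by
      simp only [Finset.sum_range_succ, Finset.sum_range_zero, expRemainder, mul_pow,
        Complex.I_sq]
      norm_num [Nat.factorial]
      ring
    rw [h2] at h1
    refine h1.trans ?_
    rw [norm_mul, Complex.norm_I, mul_one, Complex.norm_real, Real.norm_eq_abs]
    norm_num [Nat.factorial]
    nlinarith [pow_nonneg (abs_nonneg a) 3]
  · have h1 : ‖expRemainder a‖ ≤ 1 + 1 + |a| + |a| ^ 2 / 2 := by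
      refine (norm_add_le _ _).trans (add_le_add ((norm_sub_le _ _).trans (add_le_add
        ((norm_sub_le _ _).trans (add_le_add ?_ ?_)) ?_)) ?_)
      · rw [Complex.norm_exp_ofReal_mul_I]
      · simp
      · simp
      · simp
    have h2 : 1 ≤ |a| ^ 3 := one_le_pow₀ h
    have h3 : |a| ≤ |a| ^ 3 := le_self_pow₀ h (by norm_num)
    have h4 : |a| ^ 2 ≤ |a| ^ 3 := pow_le_pow_right₀ h (by norm_num)
    linarith

/-- The cubic bound in terms of second and fourth moments, by `2 |a|³ ≤ ε a² + ε⁻¹ a⁴`. -/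
lemma norm_expRemainder_le_sq_add {ε : ℝ} (hε : 0 < ε) (a : ℝ) :
    ‖expRemainder a‖ ≤ 2 * (ε * a ^ 2 + ε⁻¹ * a ^ 4) := by
  refine (norm_expRemainder_le a).trans ?_
  have h : 0 ≤ ε⁻¹ * (ε * |a| - a ^ 2) ^ 2 := by positivity
  have e1 : |a| ^ 2 = a ^ 2 := sq_abs a
  have e2 : ε⁻¹ * (ε * |a| - a ^ 2) ^ 2 = ε * |a| ^ 2 - 2 * (|a| * a ^ 2) + ε⁻¹ * a ^ 4 := by
    field_simp
    ring
  have e3 : |a| ^ 3 = |a| * a ^ 2 := by rw [pow_succ, e1]; ring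
  rw [e2, e1] at h
  rw [e3]
  linarith

section Occupation

variable {W : Type*} [MeasurableSpace W] {Q : Measure W} {α : ℝ} {Z : ℝ → W → ℝ}

lemma measurable_exp_occupation_sub_one (hZ : HasStableIncrements α Z Q) {φ : ℝ → ℝ}
    (hφ : Measurable φ) (c T : ℝ) :
    Measurable fun p => Complex.exp ((c * occupation φ Z T p : ℝ) * Complex.I) - 1 := by
  have := measurable_occupation hZ hφ T
  fun_prop

variable [IsProbabilityMeasure Q]

lemma integrable_exp_occupation_sub_one (hZ : HasStableIncrements α Z Q) {φ : ℝ → ℝ}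
    (hφ : IsOddTest φ) (c T : ℝ) :
    Integrable (fun p => Complex.exp ((c * occupation φ Z T p : ℝ) * Complex.I) - 1)
      (Q.prod volume) := by
  refine ((integrable_occupation hZ hφ.integrable hφ.measurable T).const_mul c).mono
    (measurable_exp_occupation_sub_one hZ hφ.measurable c T).aestronglyMeasurable
    (.of_forall fun p => ?_)
  rw [mul_comm _ Complex.I]
  exact Real.norm_exp_I_mul_ofReal_sub_one_le

lemma tendsto_integral_exp_occupation (hα : 1 < α) (hα₂ : α ≤ 2)
    (hZ : HasStableIncrements α Z Q) {φ : ℝ → ℝ} (hφ : IsOddTest φ)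
    (hφs : Integrable fun u => sinTransform φ u ^ 2 * |u| ^ (-α)) :
    Tendsto (fun T : ℝ => ∫ p, (Complex.exp (((√T)⁻¹ * occupation φ Z T p : ℝ) * Complex.I) - 1)
      ∂(Q.prod volume)) atTop
      (𝓝 (-((Real.pi⁻¹ * ∫ u, sinTransform φ u ^ 2 * |u| ^ (-α) : ℝ) : ℂ) / 2)) := by
  have hα0 : 0 < α := by linarith
  obtain ⟨B, hB⟩ := hφ.bounded
  obtain ⟨C, hC0, hC⟩ := exists_integral_occupation_pow_four_le hα hα₂ hZ hφ
  set V := Real.pi⁻¹ * ∫ u, sinTransform φ u ^ 2 * |u| ^ (-α) with hV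
  have hR : ∀ T : ℝ, 0 < T →
      Integrable (fun p => expRemainder ((√T)⁻¹ * occupation φ Z T p)) (Q.prod volume) ∧
      ‖∫ p, expRemainder ((√T)⁻¹ * occupation φ Z T p) ∂(Q.prod volume)‖ ≤
        2 * (T ^ (-(1 / 8) : ℝ) * V + C * T ^ (-(1 / 8) : ℝ)) := by
    intro T hT
    have hm := measurable_occupation hZ hφ.measurable T
    have h2 := integrable_occupation_sq hZ hφ hT.le
    have h4 : Integrable (fun p => occupation φ Z T p ^ 4) (Q.prod volume) := by
      have : (fun p => occupation φ Z T p ^ 4) =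
          fun p => occupation φ Z T p ^ 2 * occupation φ Z T p ^ 2 := by ext; ring
      rw [this]
      refine h2.mul_bdd (c := (B * T) ^ 2) (hm.pow_const 2).aestronglyMeasurable
        (.of_forall fun p => ?_)
      rw [norm_pow]
      exact pow_le_pow_left₀ (norm_nonneg _) (abs_occupation_le hT.le hB p) 2
    -- this choice balances `ε` from the variance against `ε⁻¹ T ^ (-1 / 4)` from the fourth moment
    set ε := T ^ (-(1 / 8) : ℝ) with hε
    have hε0 : 0 < ε := by positivity
    have hs : (√T)⁻¹ ^ 2 = T⁻¹ := by rw [inv_pow, Real.sq_sqrt hT.le]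
    have hs4 : (√T)⁻¹ ^ 4 = T⁻¹ ^ 2 := by rw [← hs]; ring
    have hbd : ∀ p, ‖expRemainder ((√T)⁻¹ * occupation φ Z T p)‖ ≤
        2 * (ε * (T⁻¹ * occupation φ Z T p ^ 2) + ε⁻¹ * (T⁻¹ ^ 2 * occupation φ Z T p ^ 4)) := by
      intro p
      have := norm_expRemainder_le_sq_add hε0 ((√T)⁻¹ * occupation φ Z T p)
      rwa [mul_pow, mul_pow, hs, hs4] at this
    have hdom : Integrable (fun p => 2 * (ε * (T⁻¹ * occupation φ Z T p ^ 2) +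
        ε⁻¹ * (T⁻¹ ^ 2 * occupation φ Z T p ^ 4))) (Q.prod volume) :=
      (((h2.const_mul _).const_mul _).add ((h4.const_mul _).const_mul _)).const_mul 2
    have hmR : Measurable fun p => expRemainder ((√T)⁻¹ * occupation φ Z T p) := by
      unfold expRemainder
      fun_prop
    refine ⟨hdom.mono' hmR.aestronglyMeasurable (.of_forall hbd), ?_⟩
    refine (norm_integral_le_of_norm_le hdom (.of_forall hbd)).trans ?_
    rw [integral_const_mul, integral_add ((h2.const_mul _).const_mul _)
      ((h4.const_mul _).const_mul _), integral_const_mul, integral_const_mul, integral_const_mul,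
      integral_const_mul]
    have b2 := integral_occupation_sq_le hα0 hZ hφ hφs hT
    have b4 := hC T hT
    have e : ε⁻¹ * (T⁻¹ ^ 2 * T ^ (7 / 4 : ℝ)) = ε := by
      have : T⁻¹ ^ 2 = T ^ (-2 : ℝ) := by
        rw [Real.rpow_neg hT.le, Real.rpow_two, inv_pow]
      rw [this, hε, ← Real.rpow_neg hT.le, ← Real.rpow_add hT, ← Real.rpow_add hT]
      norm_num
    have c4 : ε⁻¹ * (T⁻¹ ^ 2 * ∫ p, occupation φ Z T p ^ 4 ∂(Q.prod volume)) ≤ C * ε := by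
      calc _ ≤ ε⁻¹ * (T⁻¹ ^ 2 * (C * T ^ (7 / 4 : ℝ))) := by gcongr
        _ = C * (ε⁻¹ * (T⁻¹ ^ 2 * T ^ (7 / 4 : ℝ))) := by ring
        _ = C * ε := by rw [e]
    have c2 := mul_le_mul_of_nonneg_left b2 hε0.le
    linarith
  have hpow : Tendsto (fun T : ℝ => T ^ (-(1 / 8) : ℝ)) atTop (𝓝 0) :=
    tendsto_rpow_neg_atTop (by norm_num)
  have hR0 : Tendsto (fun T : ℝ => ∫ p, expRemainder ((√T)⁻¹ * occupation φ Z T p)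
      ∂(Q.prod volume)) atTop (𝓝 0) := by
    have hlim : Tendsto (fun T : ℝ => 2 * (T ^ (-(1 / 8) : ℝ) * V + C * T ^ (-(1 / 8) : ℝ))) atTop
        (𝓝 0) := by
      have := ((hpow.mul_const V).add (hpow.const_mul C)).const_mul 2
      simpa using this
    refine squeeze_zero_norm' ?_ hlim
    filter_upwards [eventually_gt_atTop 0] with T hT using (hR T hT).2
  have hsq := tendsto_integral_occupation_sq hα0 hZ hφ hφs
  have hmain : Tendsto (fun T : ℝ => (∫ p, expRemainder ((√T)⁻¹ * occupation φ Z T p)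
      ∂(Q.prod volume)) + -((T⁻¹ * ∫ p, occupation φ Z T p ^ 2 ∂(Q.prod volume) : ℝ) : ℂ) / 2)
      atTop (𝓝 (0 + -((V : ℝ) : ℂ) / 2)) :=
    hR0.add (((Complex.continuous_ofReal.tendsto _).comp hsq).neg.div_const 2)
  rw [zero_add] at hmain
  refine hmain.congr' ?_
  filter_upwards [eventually_gt_atTop 0] with T hT
  have h1 : Integrable (fun p => ((occupation φ Z T p : ℝ) : ℂ)) (Q.prod volume) :=
    (integrable_occupation hZ hφ.integrable hφ.measurable T).ofReal
  have h2 : Integrable (fun p => ((occupation φ Z T p ^ 2 : ℝ) : ℂ)) (Q.prod volume) :=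
    (integrable_occupation_sq hZ hφ hT.le).ofReal
  have hs : (√T)⁻¹ ^ 2 = T⁻¹ := by rw [inv_pow, Real.sq_sqrt hT.le]
  have hdec : ∀ p, Complex.exp (((√T)⁻¹ * occupation φ Z T p : ℝ) * Complex.I) - 1 =
      expRemainder ((√T)⁻¹ * occupation φ Z T p) +
        (((√T)⁻¹ : ℝ) * Complex.I * (occupation φ Z T p : ℝ) +
          -((T⁻¹ : ℝ) : ℂ) / 2 * ((occupation φ Z T p ^ 2 : ℝ) : ℂ)) := by
    intro p
    rw [expRemainder, ← hs]
    push_cast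
    ring
  have h12 : Integrable (fun p => ((√T)⁻¹ : ℝ) * Complex.I * ((occupation φ Z T p : ℝ) : ℂ) +
      -((T⁻¹ : ℝ) : ℂ) / 2 * ((occupation φ Z T p ^ 2 : ℝ) : ℂ)) (Q.prod volume) :=
    (h1.const_mul _).add (h2.const_mul _)
  simp only [hdec]
  rw [integral_add (hR T hT).1 h12,
    integral_add (h1.const_mul _) (h2.const_mul _), integral_const_mul, integral_const_mul,
    integral_complex_ofReal, integral_complex_ofReal, integral_occupation hZ hφ]
  push_cast
  ring

end Occupation

/-! ### The test functions `ψ_t` -/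

lemma sinTransform_oddStep (t : ℝ≥0) {u : ℝ} (hu : u ≠ 0) :
    sinTransform (oddStep t) u = 2 * (1 - Real.cos (u * t)) / u := by
  have hs : Continuous fun x => Real.sin (u * x) := by fun_prop
  have hI : ∀ a b : ℝ, a ≤ b → ∫ x in Set.Icc a b, Real.sin (u * x) =
      (Real.cos (u * a) - Real.cos (u * b)) / u := by
    intro a b hab
    rw [integral_Icc_eq_integral_Ioc, ← intervalIntegral.integral_of_le hab,
      intervalIntegral.integral_comp_mul_left Real.sin hu, integral_sin, smul_eq_mul,
      div_eq_inv_mul]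
  have hint : ∀ a b : ℝ, Integrable ((Set.Icc a b).indicator fun x => Real.sin (u * x)) :=
    fun a b => (integrable_indicator_iff measurableSet_Icc).2 (hs.integrableOn_Icc)
  have h1 : (fun x => oddStep t x * Real.sin (u * x)) = fun x =>
      (Set.Icc (0 : ℝ) t).indicator (fun x => Real.sin (u * x)) x -
        (Set.Icc (-(t : ℝ)) 0).indicator (fun x => Real.sin (u * x)) x := by
    ext x
    simp only [oddStep, Set.indicator_apply, Pi.one_apply]
    split_ifs <;> ring
  have ht : (0 : ℝ) ≤ t := t.2
  rw [sinTransform, h1, integral_sub (hint _ _) (hint _ _), integral_indicator measurableSet_Icc,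
    integral_indicator measurableSet_Icc, hI _ _ ht, hI _ _ (by linarith)]
  simp only [mul_zero, mul_neg, Real.cos_neg, Real.cos_zero]
  ring

lemma sinTransform_sum {n : ℕ} {ψ : Fin n → ℝ → ℝ} (hψ : ∀ i, IsOddTest (ψ i)) (a : Fin n → ℝ)
    (u : ℝ) : sinTransform (fun x => ∑ i, a i * ψ i x) u = ∑ i, a i * sinTransform (ψ i) u := by
  have hs : Continuous fun x => Real.sin (u * x) := by fun_prop
  simp only [sinTransform, Finset.sum_mul, mul_assoc]
  rw [integral_finsetSum _ fun i _ => ((hψ i).integrable_mul_bdd hs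
    fun _ => Real.abs_sin_le_one _).const_mul _]
  simp only [integral_const_mul]

lemma sinTransform_oddStep_sum_sq {n : ℕ} (t : Fin n → ℝ≥0) (a : Fin n → ℝ) (α : ℝ) :
    (fun u => sinTransform (fun x => ∑ i, a i * oddStep (t i) x) u ^ 2 * |u| ^ (-α)) =ᵐ[volume]
      fun u => 4 * ∑ i, ∑ j, a i * a j * (specFun α (t i) u * specFun α (t j) u) := by
  have hne : ∀ᵐ u : ℝ, u ≠ 0 := by simp [ae_iff]
  filter_upwards [hne] with u hu
  simp only [sinTransform_sum fun i => isOddTest_oddStep (t i), sinTransform_oddStep _ hu,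
    specFun_mul_specFun, rpow_abs_split hu]
  rw [sq, Finset.sum_mul_sum, Finset.sum_mul, Finset.mul_sum]
  refine Finset.sum_congr rfl fun i _ => ?_
  rw [Finset.sum_mul, Finset.mul_sum]
  refine Finset.sum_congr rfl fun j _ => ?_
  field_simp
  ring

lemma integrable_sinTransform_oddStep_sum_sq {α : ℝ} (hα : 1 < α) (hα₂ : α ≤ 2) {n : ℕ}
    (t : Fin n → ℝ≥0) (a : Fin n → ℝ) :
    Integrable fun u => sinTransform (fun x => ∑ i, a i * oddStep (t i) x) u ^ 2 * |u| ^ (-α) :=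
  ((integrable_finsetSum _ fun i _ => integrable_finsetSum _ fun j _ =>
    (integrable_specFun_mul hα hα₂ (t i) (t j)).const_mul (a i * a j)).const_mul 4).congr
    (sinTransform_oddStep_sum_sq t a α).symm

lemma integral_sinTransform_oddStep_sum_sq {α : ℝ} (hα : 1 < α) (hα₂ : α ≤ 2) {n : ℕ}
    (t : Fin n → ℝ≥0) (a : Fin n → ℝ) :
    ∫ u, sinTransform (fun x => ∑ i, a i * oddStep (t i) x) u ^ 2 * |u| ^ (-α) =
      4 * ∑ i, ∑ j, a i * a j * ∫ u, specFun α (t i) u * specFun α (t j) u := by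
  have h : ∀ i j, Integrable fun u => a i * a j * (specFun α (t i) u * specFun α (t j) u) :=
    fun i j => (integrable_specFun_mul hα hα₂ (t i) (t j)).const_mul (a i * a j)
  rw [integral_congr_ae (sinTransform_oddStep_sum_sq t a α), integral_const_mul,
    integral_finsetSum _ fun i _ => integrable_finsetSum _ fun j _ => h i j]
  congr 1
  refine Finset.sum_congr rfl fun i _ => ?_
  rw [integral_finsetSum _ fun j _ => h i j]
  simp only [integral_const_mul]

/-! ### The limit process -/

lemma memLp_specFun {α : ℝ} (hα : 1 < α) (hα₂ : α ≤ 2) (t : ℝ) : MemLp (specFun α t) 2 :=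
  (memLp_two_iff_integrable_sq (measurable_specFun α t).aestronglyMeasurable).2 <| by
    simpa only [sq] using integrable_specFun_mul hα hα₂ t t

/-- The covariance of negative sub-fractional Brownian motion is, up to a positive factor, the
Gram matrix of the functions `specFun α t` in `L²`; this gives the process. -/
lemma exists_negSubFBM {α : ℝ} (hα : 1 < α) (hα₂ : α ≤ 2) :
    ∃ (Ω : Type) (_ : MeasurableSpace Ω) (P : Measure Ω) (_ : IsProbabilityMeasure P)
      (ζ : ℝ≥0 → Ω → ℝ), IsNegSubFBM ((1 + α) / 2) ζ P ∧
      ∀ (n : ℕ) (t : Fin n → ℝ≥0) (a : Fin n → ℝ), ∫ ω, Complex.exp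
        (((∑ i, a i * ζ (t i) ω : ℝ) : ℂ) * Complex.I) ∂P =
          Complex.exp (-((∑ i, ∑ j, a i * a j * (((1 + α) / 2 - 1) / cosConst α *
            ∫ u, specFun α (t i) u * specFun α (t j) u) : ℝ) : ℂ) / 2) := by
  have hc := cosConst_pos hα hα₂
  set κ : ℝ := ((1 + α) / 2 - 1) / cosConst α with hκ
  have hκ0 : 0 < κ := div_pos (by linarith) hc
  let g : ℝ≥0 → Lp ℝ 2 (volume : Measure ℝ) := fun t => (memLp_specFun hα hα₂ t).toLp _
  let k : ℝ≥0 → Lp ℝ 2 (volume : Measure ℝ) := fun t => √κ • g t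
  have hg : ∀ s t : ℝ≥0, inner ℝ (g s) (g t) = ∫ u, specFun α s u * specFun α t u := by
    intro s t
    rw [L2.inner_def]
    refine integral_congr_ae ?_
    filter_upwards [(memLp_specFun hα hα₂ s).coeFn_toLp, (memLp_specFun hα hα₂ t).coeFn_toLp]
      with u h1 h2
    simp only [g, h1, h2]
    exact mul_comm _ _
  have hk : ∀ s t : ℝ≥0, inner ℝ (k s) (k t) = κ * ∫ u, specFun α s u * specFun α t u := by
    intro s t
    simp only [k]
    rw [real_inner_smul_left, real_inner_smul_right, hg, ← mul_assoc, Real.mul_self_sqrt hκ0.le]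
  have hlip : ∀ m : ℕ, ∃ C : ℝ≥0, ∀ s t : ℝ≥0, s ≤ m → t ≤ m →
      ‖k s - k t‖ ^ 2 ≤ C * ((s : ℝ) - t) ^ 2 := by
    intro m
    obtain ⟨C, hC0, hC⟩ := integral_specFun_sub_sq_le hα hα₂ (m : ℝ)
    refine ⟨⟨κ * C, by positivity⟩, fun s t hs ht => ?_⟩
    have h := hC s t s.2 (by exact_mod_cast hs) t.2 (by exact_mod_cast ht)
    have e : ‖k s - k t‖ ^ 2 = κ * ∫ u, (specFun α s u - specFun α t u) ^ 2 := by
      have h1 := integrable_specFun_mul hα hα₂ s s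
      have h2 := integrable_specFun_mul hα hα₂ s t
      have h3 := integrable_specFun_mul hα hα₂ t t
      rw [norm_sub_sq_real, ← real_inner_self_eq_norm_sq, ← real_inner_self_eq_norm_sq, hk, hk, hk]
      have h4 : ∀ u, (specFun α s u - specFun α t u) ^ 2 = specFun α s u * specFun α s u -
          2 * (specFun α s u * specFun α t u) + specFun α t u * specFun α t u := fun u => by ring
      have h12 : Integrable fun u => specFun α s u * specFun α s u -
          2 * (specFun α s u * specFun α t u) := h1.sub (h2.const_mul 2)
      simp only [h4]
      rw [integral_add h12 h3, integral_sub h1 (h2.const_mul 2),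
        integral_const_mul]
      ring
    rw [e]
    calc κ * ∫ u, (specFun α s u - specFun α t u) ^ 2 ≤ κ * (C * ((s : ℝ) - t) ^ 2) := by gcongr
      _ = _ := by rw [← mul_assoc]; rfl
  obtain ⟨Ω, mΩ, P, hP, ζ, h1, h2, h3, h4, h5⟩ := exists_gaussianProcess k hlip
  refine ⟨Ω, mΩ, P, hP, ζ, ⟨by linarith, by linarith, h1, h2, fun s t => ?_, h4⟩,
    fun n t a => ?_⟩
  · rw [h3, hk, integral_specFun_mul hα hα₂ s.coe_nonneg t.coe_nonneg, hκ,
      mul_div_cancel₀ (1 + α) two_ne_zero]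
    field_simp
    ring
  · rw [h5]
    simp only [hk]

/-! ### The particle system as a marked Poisson process -/

section System

variable {Ω : Type*} [MeasurableSpace Ω] {P : Measure Ω} {α : ℝ}
  {x : ℕ → Ω → ℝ} {ϑ : ℕ → ℝ≥0 → Ω → ℝ}

/-- The path and the starting point of the `k`-th particle. -/
def mark (x : ℕ → Ω → ℝ) (ϑ : ℕ → ℝ≥0 → Ω → ℝ) (k : ℕ) (ω : Ω) : (ℝ≥0 → ℝ) × ℝ :=
  (fun t => ϑ k t ω, x k ω)

/-- The common law of the paths, taken from the particle `0`. -/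
def pathLaw (ϑ : ℕ → ℝ≥0 → Ω → ℝ) (P : Measure Ω) : Measure (ℝ≥0 → ℝ) :=
  P.map fun ω t => ϑ 0 t ω

namespace IsPoissonStableSystem

lemma measurable_path (h : IsPoissonStableSystem α x ϑ P) (k : ℕ) :
    Measurable fun ω t => ϑ k t ω := (h.stable_motion k).measurable_path

lemma measurable_mark (h : IsPoissonStableSystem α x ϑ P) (k : ℕ) : Measurable (mark x ϑ k) :=
  (h.measurable_path k).prodMk (h.measurable_start k)

lemma ae_isCadlagPath (h : IsPoissonStableSystem α x ϑ P) :
    ∀ᵐ ω ∂P, ∀ k, IsCadlagPath fun t => ϑ k t ω :=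
  ae_all_iff.2 fun k => (h.stable_motion k).cadlag

variable [IsProbabilityMeasure P]

lemma isProbabilityMeasure_pathLaw (h : IsPoissonStableSystem α x ϑ P) :
    IsProbabilityMeasure (pathLaw ϑ P) :=
  Measure.isProbabilityMeasure_map (h.measurable_path 0).aemeasurable

lemma map_path (h : IsPoissonStableSystem α x ϑ P) (k : ℕ) :
    P.map (fun ω t => ϑ k t ω) = pathLaw ϑ P :=
  (h.stable_motion k).map_path_eq (h.stable_motion 0)

lemma hasStableIncrements (h : IsPoissonStableSystem α x ϑ P) (hα : 0 < α) :
    HasStableIncrements α evalRight (pathLaw ϑ P) :=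
  (h.stable_motion 0).hasStableIncrements hα

lemma map_mark (h : IsPoissonStableSystem α x ϑ P) (k : ℕ) :
    P.map (mark x ϑ k) = (pathLaw ϑ P).prod (P.map (x k)) := by
  have hi : IndepFun (fun ω t => ϑ k t ω) (x k) P :=
    (h.indep_start.comp (measurable_pi_apply k) (measurable_pi_apply k)).symm
  rw [← h.map_path k]
  exact (indepFun_iff_map_prod_eq_prod_map_map (h.measurable_path k).aemeasurable
    (h.measurable_start k).aemeasurable).1 hi

/-- Campbell's formula: the marked configuration has intensity `pathLaw ⊗ volume`. -/
lemma sum_map_mark (h : IsPoissonStableSystem α x ϑ P) :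
    Measure.sum (fun k => P.map (mark x ϑ k)) = (pathLaw ϑ P).prod volume := by
  have := h.isProbabilityMeasure_pathLaw
  refine Measure.ext_of_lintegral _ fun f hf => ?_
  have hG : Measurable fun y => ∫⁻ w, f (w, y) ∂pathLaw ϑ P := hf.lintegral_prod_left'
  have hk : ∀ k, ∫⁻ p, f p ∂(P.map (mark x ϑ k)) =
      ∫⁻ ω, (∫⁻ w, f (w, x k ω) ∂pathLaw ϑ P) ∂P := fun k => by
    have := Measure.isProbabilityMeasure_map (μ := P) (h.measurable_start k).aemeasurable
    rw [h.map_mark, lintegral_prod_symm _ hf.aemeasurable, lintegral_map hG (h.measurable_start k)]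
  rw [lintegral_sum_measure, lintegral_prod_symm _ hf.aemeasurable,
    ← lintegral_tsum_poisson h.poisson_start hG,
    lintegral_tsum (f := fun k ω => ∫⁻ w, f (w, x k ω) ∂pathLaw ϑ P)
      fun k => (hG.comp (h.measurable_start k)).aemeasurable]
  exact tsum_congr hk

lemma tsum_lintegral_mark (h : IsPoissonStableSystem α x ϑ P) {f : (ℝ≥0 → ℝ) × ℝ → ℝ≥0∞}
    (hf : Measurable f) :
    ∑' k, ∫⁻ ω, f (mark x ϑ k ω) ∂P = ∫⁻ p, f p ∂((pathLaw ϑ P).prod volume) := by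
  rw [← h.sum_map_mark, lintegral_sum_measure]
  exact tsum_congr fun k => (lintegral_map hf (h.measurable_mark k)).symm

lemma ae_tsum_mark_ne_top (h : IsPoissonStableSystem α x ϑ P) {f : (ℝ≥0 → ℝ) × ℝ → ℝ≥0∞}
    (hf : Measurable f) (hfi : ∫⁻ p, f p ∂((pathLaw ϑ P).prod volume) ≠ ∞) :
    ∀ᵐ ω ∂P, ∑' k, f (mark x ϑ k ω) ≠ ∞ := by
  have hm : ∀ k, Measurable fun ω => f (mark x ϑ k ω) := fun k => hf.comp (h.measurable_mark k)
  refine (ae_lt_top (Measurable.tsum hm) ?_).mono fun ω hω => hω.ne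
  rwa [lintegral_tsum fun k => (hm k).aemeasurable, h.tsum_lintegral_mark hf]

lemma integral_tsum_mark (h : IsPoissonStableSystem α x ϑ P) {f : (ℝ≥0 → ℝ) × ℝ → ℝ}
    (hf : Measurable f) (hfi : Integrable f ((pathLaw ϑ P).prod volume)) :
    ∫ ω, ∑' k, f (mark x ϑ k ω) ∂P = ∫ p, f p ∂((pathLaw ϑ P).prod volume) := by
  rw [integral_tsum (f := fun k ω => f (mark x ϑ k ω))
    (fun k => (hf.comp (h.measurable_mark k)).aestronglyMeasurable)
    (by rw [h.tsum_lintegral_mark hf.enorm]; exact hfi.2.ne), ← h.sum_map_mark,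
    integral_sum_measure (by rwa [h.sum_map_mark])]
  exact tsum_congr fun k =>
    (integral_map (h.measurable_mark k).aemeasurable hf.aestronglyMeasurable).symm

/-- The Laplace functional of the marked Poisson configuration, at an imaginary argument. -/
lemma tendsto_integral_prod_mark (h : IsPoissonStableSystem α x ϑ P)
    {f : (ℝ≥0 → ℝ) × ℝ → ℂ} (hf : Measurable f) (hf1 : ∀ p, ‖f p‖ ≤ 1)
    (hfi : Integrable (fun p => f p - 1) ((pathLaw ϑ P).prod volume)) :
    Tendsto (fun n => ∫ ω, ∏ k ∈ Finset.range n, f (mark x ϑ k ω) ∂P) atTop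
      (𝓝 (Complex.exp (∫ p, (f p - 1) ∂((pathLaw ϑ P).prod volume)))) := by
  have hQ := h.isProbabilityMeasure_pathLaw
  let U : ℝ → ℂ := fun y => ∫ w, (f (w, y) - 1) ∂pathLaw ϑ P
  have hfy : ∀ y, Integrable (fun w => f (w, y)) (pathLaw ϑ P) := fun y =>
    (integrable_const (1 : ℝ)).mono' (hf.comp measurable_prodMk_right).aestronglyMeasurable
      (.of_forall fun w => hf1 _)
  have hU : ∀ y, 1 + U y = ∫ w, f (w, y) ∂pathLaw ϑ P := fun y => by
    simp only [U]
    rw [integral_sub (hfy y) (integrable_const _)]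
    simp
  have hUm : Measurable U :=
    ((hf.sub_const 1).stronglyMeasurable.integral_prod_left' (μ := pathLaw ϑ P)).measurable
  have hU1 : ∀ y, ‖1 + U y‖ ≤ 1 := fun y => by
    rw [hU]
    simpa using norm_integral_le_of_norm_le_const (μ := pathLaw ϑ P)
      (f := fun w => f (w, y)) (C := 1) (.of_forall fun w => hf1 _)
  have hlim := tendsto_integral_prod_poisson h.measurable_start h.poisson_start hUm
    hfi.integral_prod_right hU1
  rw [integral_prod_symm _ hfi]
  refine hlim.congr fun n => ?_
  let X : Ω → ℕ → ℝ := fun ω k => x k ω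
  let Θ : Ω → ℕ → ℝ≥0 → ℝ := fun ω k t => ϑ k t ω
  have hX : Measurable X := measurable_pi_lambda _ h.measurable_start
  have hΘ : Measurable Θ := measurable_pi_lambda _ h.measurable_path
  have hXp := Measure.isProbabilityMeasure_map (μ := P) hX.aemeasurable
  have hΘp := Measure.isProbabilityMeasure_map (μ := P) hΘ.aemeasurable
  have hj : P.map (fun ω => (X ω, Θ ω)) = (P.map X).prod (P.map Θ) :=
    (indepFun_iff_map_prod_eq_prod_map_map hX.aemeasurable hΘ.aemeasurable).1 h.indep_start
  let F : (ℕ → ℝ) × (ℕ → ℝ≥0 → ℝ) → ℂ := fun q => ∏ k ∈ Finset.range n, f (q.2 k, q.1 k)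
  have hF : Measurable F := Finset.measurable_prod _ fun k _ => hf.comp
    (((measurable_pi_apply k).comp measurable_snd).prodMk
      ((measurable_pi_apply k).comp measurable_fst))
  have hFi : Integrable F ((P.map X).prod (P.map Θ)) := by
    refine (integrable_const (1 : ℝ)).mono' hF.aestronglyMeasurable (.of_forall fun q => ?_)
    rw [norm_prod]
    exact Finset.prod_le_one (fun _ _ => norm_nonneg _) fun k _ => hf1 _
  have hinner : ∀ y : ℕ → ℝ, ∫ v, F (y, v) ∂(P.map Θ) = ∏ k ∈ Finset.range n, (1 + U (y k)) := by
    intro y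
    have hFy : Measurable fun v => F (y, v) := hF.comp measurable_prodMk_left
    rw [integral_map hΘ.aemeasurable hFy.aestronglyMeasurable]
    have hfm : ∀ k, Measurable fun w => f (w, y k) := fun k => hf.comp measurable_prodMk_right
    have hind : iIndepFun (fun (k : Fin n) ω => f ((fun t => ϑ k t ω), y k)) P :=
      (h.indep_motions.comp (fun k w => f (w, y k)) hfm).precomp Fin.val_injective
    have := hind.integral_fun_prod_eq_prod_integral
      fun k => ((hfm k).comp (h.measurable_path k)).aestronglyMeasurable
    simp only [F, Θ, Finset.prod_range]
    rw [this]
    refine Finset.prod_congr rfl fun k _ => ?_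
    rw [hU, ← h.map_path k, integral_map (h.measurable_path k).aemeasurable
      (hfm k).aestronglyMeasurable]
  have hpm : Measurable fun y : ℕ → ℝ => ∏ k ∈ Finset.range n, (1 + U (y k)) :=
    Finset.measurable_prod _ fun k _ => (hUm.comp (measurable_pi_apply k)).const_add 1
  calc ∫ ω, ∏ k ∈ Finset.range n, (1 + U (x k ω)) ∂P
      = ∫ y, ∏ k ∈ Finset.range n, (1 + U (y k)) ∂(P.map X) :=
        (integral_map hX.aemeasurable hpm.aestronglyMeasurable).symm
    _ = ∫ q, F q ∂((P.map X).prod (P.map Θ)) := by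
        rw [integral_prod _ hFi]; simp only [hinner]
    _ = ∫ ω, ∏ k ∈ Finset.range n, f (mark x ϑ k ω) ∂P := by
        rw [← hj, integral_map (hX.prodMk hΘ).aemeasurable hF.aestronglyMeasurable]
        rfl

end IsPoissonStableSystem

end System

/-! ### The occupation time fluctuation as a sum over the particles -/

lemma integral_empirical {Ω : Type*} {x : ℕ → Ω → ℝ} {ϑ : ℕ → ℝ≥0 → Ω → ℝ} {φ : ℝ → ℝ}
    (hφ : Measurable φ) {ω : Ω} (hω : ∀ k, IsCadlagPath fun t => ϑ k t ω) {s : ℝ}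
    (hs : ∑' k, ‖particleField φ evalRight s (mark x ϑ k ω)‖ₑ ≠ ∞) :
    ∫ y, φ y ∂(empirical x ϑ s.toNNReal ω) =
      ∑' k, particleField φ evalRight s (mark x ϑ k ω) := by
  have hk : ∀ k, particleField φ evalRight s (mark x ϑ k ω) =
      φ (x k ω + ϑ k s.toNNReal ω) := fun k => by
    simp only [particleField, mark, evalRight_eq (hω k)]
  have hi : Integrable φ (empirical x ϑ s.toNNReal ω) := by
    refine ⟨hφ.aestronglyMeasurable, ?_⟩
    rw [HasFiniteIntegral, empirical, lintegral_sum_measure]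
    simp only [lintegral_dirac' _ hφ.enorm, ← hk]
    exact lt_top_iff_ne_top.2 hs
  rw [empirical, integral_sum_measure hi]
  simp only [integral_dirac' _ _ hφ.stronglyMeasurable, hk]

section System

variable {Ω : Type*} [MeasurableSpace Ω] {P : Measure Ω} {α : ℝ}
  {x : ℕ → Ω → ℝ} {ϑ : ℕ → ℝ≥0 → Ω → ℝ}

lemma integrable_particleField_time {W : Type*} [MeasurableSpace W] {Q : Measure W}
    {Z : ℝ → W → ℝ} (hZ : HasStableIncrements α Z Q) {φ : ℝ → ℝ} (hφ : IsOddTest φ) (T : ℝ)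
    (p : W × ℝ) :
    Integrable (fun s => particleField φ Z s p) (volume.restrict (Set.Ioc 0 T)) := by
  obtain ⟨B, hB⟩ := hφ.bounded
  exact (integrable_const B).mono' ((measurable_particleField hZ hφ.measurable).comp
    measurable_prodMk_left).aestronglyMeasurable (.of_forall fun s => hB _)

lemma occupation_sum {W : Type*} [MeasurableSpace W] {Q : Measure W} {Z : ℝ → W → ℝ}
    (hZ : HasStableIncrements α Z Q) {n : ℕ} {ψ : Fin n → ℝ → ℝ} (hψ : ∀ i, IsOddTest (ψ i))
    (a : Fin n → ℝ) (T : ℝ) (p : W × ℝ) :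
    occupation (fun y => ∑ i, a i * ψ i y) Z T p = ∑ i, a i * occupation (ψ i) Z T p := by
  simp only [occupation, ← integral_const_mul]
  exact integral_finsetSum _ fun i _ =>
    (integrable_particleField_time hZ (hψ i) T p).const_mul (a i)

variable [IsProbabilityMeasure P]

namespace IsPoissonStableSystem

lemma integral_integral_empirical (h : IsPoissonStableSystem α x ϑ P) (hα : 0 < α) {φ : ℝ → ℝ}
    (hφ : IsOddTest φ) (s : ℝ) :
    ∫ ω, (∫ y, φ y ∂(empirical x ϑ s.toNNReal ω)) ∂P = 0 := by
  have hQ := h.isProbabilityMeasure_pathLaw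
  have hZ := h.hasStableIncrements hα
  have hm := measurable_particleField_left hZ hφ.measurable s
  have hi := integrable_particleField hZ hφ.integrable s
  rw [← integral_particleField hZ hφ s, ← h.integral_tsum_mark hm hi]
  refine integral_congr_ae ?_
  filter_upwards [h.ae_isCadlagPath, h.ae_tsum_mark_ne_top hm.enorm hi.2.ne] with ω h1 h2
  exact integral_empirical hφ.measurable h1 h2

/-- Almost surely, the occupation time of the system is the sum of those of the particles. -/
lemma ae_hasSum_occupation (h : IsPoissonStableSystem α x ϑ P) (hα : 0 < α) {φ : ℝ → ℝ}
    (hφ : IsOddTest φ) {T : ℝ} (hT : 0 < T) :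
    ∀ᵐ ω ∂P, HasSum (fun k => occupation φ evalRight T (mark x ϑ k ω))
      (∫ s in (0 : ℝ)..T, ∫ y, φ y ∂(empirical x ϑ s.toNNReal ω)) := by
  have hQ := h.isProbabilityMeasure_pathLaw
  have hZ := h.hasStableIncrements hα
  have hm := measurable_particleField hZ hφ.measurable
  have hi := integrable_particleField_uncurry hZ hφ.integrable hφ.measurable
    (volume.restrict (Set.Ioc 0 T)) measurable_id
  have hfin : ∫⁻ p, (∫⁻ s in Set.Ioc 0 T, ‖particleField φ evalRight s p‖ₑ)
      ∂((pathLaw ϑ P).prod volume) ≠ ∞ := by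
    have := hi.2.ne
    simp only [id] at this
    rwa [lintegral_prod _ hm.enorm.aemeasurable] at this
  filter_upwards [h.ae_isCadlagPath, h.ae_tsum_mark_ne_top hm.enorm.lintegral_prod_right' hfin]
    with ω h1 h2
  have hms : ∀ k, Measurable fun s => particleField φ evalRight s (mark x ϑ k ω) := fun k =>
    hm.comp measurable_prodMk_left
  have hsum : Summable fun k => occupation φ evalRight T (mark x ϑ k ω) := by
    have : ∑' k, ‖occupation φ evalRight T (mark x ϑ k ω)‖ₑ ≠ ∞ :=
      ne_top_of_le_ne_top h2 (ENNReal.tsum_le_tsum fun k => enorm_integral_le_lintegral_enorm _)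
    exact Summable.of_nnnorm (ENNReal.tsum_coe_ne_top_iff_summable.1 this)
  have hae : ∀ᵐ s ∂(volume.restrict (Set.Ioc 0 T)),
      ∑' k, ‖particleField φ evalRight s (mark x ϑ k ω)‖ₑ ≠ ∞ := by
    refine (ae_lt_top (Measurable.tsum fun k => (hms k).enorm) ?_).mono fun s hs => hs.ne
    rwa [lintegral_tsum fun k => (hms k).enorm.aemeasurable]
  have heq : ∫ s in (0 : ℝ)..T, ∫ y, φ y ∂(empirical x ϑ s.toNNReal ω) =
      ∑' k, occupation φ evalRight T (mark x ϑ k ω) := by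
    simp only [occupation]
    rw [intervalIntegral.integral_of_le hT.le,
      ← integral_tsum (fun k => (hms k).aestronglyMeasurable) h2]
    refine integral_congr_ae ?_
    filter_upwards [hae] with s hs using integral_empirical hφ.measurable h1 hs
  rw [heq]
  exact hsum.hasSum

lemma ae_hasSum_occFluct (h : IsPoissonStableSystem α x ϑ P) (hα : 0 < α) {φ : ℝ → ℝ}
    (hφ : IsOddTest φ) {T : ℝ} (hT : 0 < T) :
    ∀ᵐ ω ∂P, HasSum (fun k => (√T)⁻¹ * occupation φ evalRight T (mark x ϑ k ω))
      (occFluct P (empirical x ϑ) Real.sqrt T 1 φ ω) := by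
  filter_upwards [h.ae_hasSum_occupation hα hφ hT] with ω hω
  simp only [occFluct, h.integral_integral_empirical hα hφ, mul_one, one_div,
    intervalIntegral.integral_zero, sub_zero]
  exact hω.mul_left _

lemma aemeasurable_occFluct (h : IsPoissonStableSystem α x ϑ P) (hα : 0 < α) {φ : ℝ → ℝ}
    (hφ : IsOddTest φ) (T : ℝ) :
    AEMeasurable (occFluct P (empirical x ϑ) Real.sqrt T 1 φ) P := by
  rcases le_or_gt T 0 with hT | hT
  -- for `T ≤ 0` the norming `√T` is `0`, and division by it gives the constant `0`
  · have : occFluct P (empirical x ϑ) Real.sqrt T 1 φ = fun _ => 0 := by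
      funext ω
      rw [occFluct, Real.sqrt_eq_zero_of_nonpos hT, div_zero, zero_mul]
    rw [this]
    exact aemeasurable_const
  · have hZ := h.hasStableIncrements hα
    refine aemeasurable_of_tendsto_metrizable_ae atTop
      (f := fun n ω => ∑ k ∈ Finset.range n, (√T)⁻¹ * occupation φ evalRight T (mark x ϑ k ω))
      (fun n => (Finset.measurable_sum _ fun k _ =>
        ((measurable_occupation hZ hφ.measurable T).comp
          (h.measurable_mark k)).const_mul _).aemeasurable) ?_
    filter_upwards [h.ae_hasSum_occFluct hα hφ hT] with ω hω using hω.tendsto_sum_nat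

/-- The joint characteristic function of the occupation time fluctuations, by the exponential
formula for the marked Poisson configuration. -/
lemma integral_exp_occFluct (h : IsPoissonStableSystem α x ϑ P) (hα : 0 < α) {n : ℕ}
    {ψ : Fin n → ℝ → ℝ} (hψ : ∀ i, IsOddTest (ψ i)) (a : Fin n → ℝ) {T : ℝ} (hT : 0 < T) :
    ∫ ω, Complex.exp (((∑ i, a i * occFluct P (empirical x ϑ) Real.sqrt T 1 (ψ i) ω : ℝ) : ℂ) *
      Complex.I) ∂P = Complex.exp (∫ p, (Complex.exp
        (((√T)⁻¹ * occupation (fun y => ∑ i, a i * ψ i y) evalRight T p : ℝ) * Complex.I) - 1)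
          ∂((pathLaw ϑ P).prod volume)) := by
  have hQ := h.isProbabilityMeasure_pathLaw
  have hZ := h.hasStableIncrements hα
  have hφ := isOddTest_sum hψ a
  set φ : ℝ → ℝ := fun y => ∑ i, a i * ψ i y with hφdef
  let f : (ℝ≥0 → ℝ) × ℝ → ℂ := fun p =>
    Complex.exp (((√T)⁻¹ * occupation φ evalRight T p : ℝ) * Complex.I)
  have hf : Measurable f := by
    have := measurable_occupation hZ hφ.measurable T
    fun_prop
  have hf1 : ∀ p, ‖f p‖ = 1 := fun p => Complex.norm_exp_ofReal_mul_I _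
  refine tendsto_nhds_unique ?_ (h.tendsto_integral_prod_mark hf (fun p => (hf1 p).le)
    (integrable_exp_occupation_sub_one hZ hφ _ T))
  refine tendsto_integral_of_dominated_convergence (fun _ => 1) (fun n =>
    (Finset.measurable_prod _ fun k _ => hf.comp (h.measurable_mark k)).aestronglyMeasurable)
    (integrable_const _) (fun n => .of_forall fun ω => ?_) ?_
  · rw [norm_prod]
    exact (Finset.prod_congr rfl fun k _ => hf1 _).trans_le (by simp)
  · filter_upwards [ae_all_iff.2 fun i => h.ae_hasSum_occFluct hα (hψ i) hT] with ω hω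
    have h1 := hasSum_sum (s := Finset.univ) fun i _ => (hω i).mul_left (a i)
    have h2 : ∀ k, ∑ i, a i * ((√T)⁻¹ * occupation (ψ i) evalRight T (mark x ϑ k ω)) =
        (√T)⁻¹ * occupation φ evalRight T (mark x ϑ k ω) := fun k => by
      rw [hφdef, occupation_sum hZ hψ, Finset.mul_sum]
      exact Finset.sum_congr rfl fun i _ => by ring
    simp only [h2] at h1
    have hcont : Continuous fun y : ℝ => Complex.exp ((y : ℂ) * Complex.I) := by fun_prop
    refine ((hcont.tendsto _).comp h1.tendsto_sum_nat).congr fun n => ?_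
    simp only [Function.comp_apply]
    rw [← Complex.exp_sum, Complex.ofReal_sum, Finset.sum_mul]

end IsPoissonStableSystem

end System

/-! ### Convergence of the finite-dimensional distributions -/

lemma aemeasurable_toLp_pi {S : Type*} [MeasurableSpace S] {μ : Measure S} {n : ℕ}
    {V : Fin n → S → ℝ} (hV : ∀ i, AEMeasurable (V i) μ) :
    AEMeasurable (fun ω => (WithLp.toLp 2 fun i => V i ω : EuclideanSpace ℝ (Fin n))) μ :=
  (PiLp.continuous_toLp 2 _).measurable.comp_aemeasurable (aemeasurable_pi_lambda _ hV)

lemma charFun_map_toLp_pi {S : Type*} [MeasurableSpace S] {μ : Measure S} {n : ℕ}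
    {V : Fin n → S → ℝ} (hV : ∀ i, AEMeasurable (V i) μ) (a : EuclideanSpace ℝ (Fin n)) :
    charFun (μ.map fun ω => (WithLp.toLp 2 fun i => V i ω : EuclideanSpace ℝ (Fin n))) a =
      ∫ ω, Complex.exp (((∑ i, a i * V i ω : ℝ) : ℂ) * Complex.I) ∂μ := by
  rw [charFun_apply, integral_map (aemeasurable_toLp_pi hV) (by fun_prop)]
  simp only [PiLp.inner_apply, RCLike.inner_apply, conj_trivial]

/-- Lévy's continuity theorem for random vectors with real parameter `T → ∞`. -/
lemma tendstoInDistribution_pi_of_charFun {Ω Ω' : Type*} [MeasurableSpace Ω] [MeasurableSpace Ω']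
    {P : Measure Ω} [IsProbabilityMeasure P] {P' : Measure Ω'} [IsProbabilityMeasure P'] {n : ℕ}
    {X : ℝ → Fin n → Ω → ℝ} {Y : Fin n → Ω' → ℝ} (hX : ∀ T i, AEMeasurable (X T i) P)
    (hY : ∀ i, AEMeasurable (Y i) P')
    (hlim : ∀ a : Fin n → ℝ, Tendsto
      (fun T => ∫ ω, Complex.exp (((∑ i, a i * X T i ω : ℝ) : ℂ) * Complex.I) ∂P) atTop
      (𝓝 (∫ ω, Complex.exp (((∑ i, a i * Y i ω : ℝ) : ℂ) * Complex.I) ∂P'))) :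
    TendstoInDistribution (fun T ω i => X T i ω) atTop (fun ω i => Y i ω) (fun _ => P) P' := by
  have hE : TendstoInDistribution
      (fun T ω => (WithLp.toLp 2 fun i => X T i ω : EuclideanSpace ℝ (Fin n))) atTop
      (fun ω => (WithLp.toLp 2 fun i => Y i ω : EuclideanSpace ℝ (Fin n))) (fun _ => P) P' := by
    refine ⟨fun T => aemeasurable_toLp_pi (hX T), aemeasurable_toLp_pi hY, ?_⟩
    refine tendsto_of_seq_tendsto fun u hu => ProbabilityMeasure.tendsto_of_tendsto_charFun
      fun a => ?_
    simp only [ProbabilityMeasure.coe_mk]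
    rw [charFun_map_toLp_pi hY]
    exact ((hlim a).comp hu).congr fun m => (charFun_map_toLp_pi (hX (u m)) a).symm
  exact hE.continuous_comp (g := fun v : EuclideanSpace ℝ (Fin n) => (v : Fin n → ℝ))
    (PiLp.continuous_ofLp 2 _)

end OccupationFluctuation

end

theorem proposition2p14 (α : ℝ) (hα : 1 < α) (hα₂ : α ≤ 2) :
    (1 + α) / 2 ∈ Set.Ioc (1 : ℝ) (3 / 2) ∧
    ∃ K : ℝ, 0 < K ∧
    ∃ (Ω' : Type) (_ : MeasurableSpace Ω') (P' : Measure Ω') (_ : IsProbabilityMeasure P')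
      (ζ : ℝ≥0 → Ω' → ℝ),
      OccupationFluctuation.IsNegSubFBM ((1 + α) / 2) ζ P' ∧
      ∀ (Ω : Type*) [MeasurableSpace Ω] (P : Measure Ω) [IsProbabilityMeasure P]
        (x : ℕ → Ω → ℝ) (ϑ : ℕ → ℝ≥0 → Ω → ℝ),
        OccupationFluctuation.IsPoissonStableSystem α x ϑ P →
        OccupationFluctuation.TendstoFDD
          (fun T t => OccupationFluctuation.occFluct P
            (OccupationFluctuation.empirical x ϑ) Real.sqrt T 1
            (OccupationFluctuation.oddStep t))
          (fun t ω => K * ζ t ω) P P' := by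
  open OccupationFluctuation in
  have hα0 : 0 < α := by linarith
  have hc := cosConst_pos hα hα₂
  have hH : 0 < (1 + α) / 2 - 1 := by linarith
  -- `K` turns the normalization of the covariance into that of the limit, `K ^ 2 κ = 4 / π`, where
  -- `κ = (H - 1) / cosConst α` is the constant in `exists_negSubFBM`
  refine ⟨⟨by linarith, by linarith⟩, √(4 / Real.pi * (cosConst α / ((1 + α) / 2 - 1))),
    by positivity, ?_⟩
  obtain ⟨Ω', mΩ', P', hP', ζ, hζ, hchar⟩ := exists_negSubFBM hα hα₂
  refine ⟨Ω', mΩ', P', hP', ζ, hζ, fun Ω _ P _ x ϑ h n t => ?_⟩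
  have hQ := h.isProbabilityMeasure_pathLaw
  set K := √(4 / Real.pi * (cosConst α / ((1 + α) / 2 - 1))) with hK
  have hK2 : K ^ 2 * (((1 + α) / 2 - 1) / cosConst α) = 4 / Real.pi := by
    rw [hK, Real.sq_sqrt (by positivity), mul_assoc, div_mul_div_cancel₀ hH.ne',
      div_self hc.ne', mul_one]
  refine tendstoInDistribution_pi_of_charFun
    (fun T i => h.aemeasurable_occFluct hα0 (isOddTest_oddStep (t i)) T)
    (fun i => (hζ.gaussian.aemeasurable (t i)).const_mul K) fun a => ?_
  have hlim := (Complex.continuous_exp.tendsto _).comp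
    (tendsto_integral_exp_occupation hα hα₂ (h.hasStableIncrements hα0)
      (isOddTest_sum (fun i => isOddTest_oddStep (t i)) a)
      (integrable_sinTransform_oddStep_sum_sq hα hα₂ t a))
  have hval : ∫ ω, Complex.exp (((∑ i, a i * (K * ζ (t i) ω) : ℝ) : ℂ) * Complex.I) ∂P' =
      Complex.exp (-((Real.pi⁻¹ * ∫ u, sinTransform (fun y => ∑ i, a i * oddStep (t i) y) u ^ 2 *
        |u| ^ (-α) : ℝ) : ℂ) / 2) := by
    have h1 := hchar n t fun i => a i * K
    simp only [mul_assoc] at h1 ⊢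
    rw [h1, integral_sinTransform_oddStep_sum_sq hα hα₂]
    congr 4
    rw [← mul_assoc, inv_mul_eq_div, ← hK2, Finset.mul_sum]
    refine Finset.sum_congr rfl fun i _ => ?_
    rw [Finset.mul_sum]
    exact Finset.sum_congr rfl fun j _ => by ring
  rw [hval]
  refine hlim.congr' ?_
  filter_upwards [eventually_gt_atTop 0] with T hT
  exact (h.integral_exp_occFluct hα0 (fun i => isOddTest_oddStep (t i)) a hT).symm
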